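/- Let $n\in\{2,3,4\}$ and let $\Phi$ be a genus one model of degree $n$ over $\mathbb R$, with variety $\mathcal C_\Phi$: for $n=2$ a generalised binary quartic $y^2+P(x_1,x_2)y=Q(x_1,x_2)$, with $P,Q$ forms of degrees $2,4$ ($\mathcal C_\Phi$ lies in the weighted projective plane with coordinates $(x_1:x_2:y)$ of weights $1,1,2$); for $n=3$ a ternary cubic form $U$, with $\mathcal C_\Phi=\{U=0\}\subset\mathbb P^2$; for $n=4$ a pair $(Q_1,Q_2)$ of quadratic forms in $x_1,\dots,x_4$, with $\mathcal C_\Phi=\{Q_1=Q_2=0\}\subset\mathbb P^3$. Assume that $\Phi$ is non-singular, i.e. $\mathcal C_\Phi$ is a smooth curve of genus one, and that $\mathcal C_\Phi(\mathbb R)\neq\emptyset$. Define forms $F_n,G_n$ of degree $2n$ in $x_1,\dots,x_n$ as follows (subscripts on forms denote partial derivatives). * $n=2$: write $P=l x_1^2+m x_1x_2+n' x_2^2$ and $Q=a x_1^4+b x_1^3x_2+c x_1^2x_2^2+d x_1x_2^3+e x_2^4$, and put $g=\frac14P^2+Q$, $h=\frac13(g_{12}^2-g_{11}g_{22})$, $b_2=m^2+4(c-l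 n')$. Then $F_2=P^2+4Q$ and $G_2=\frac13(h-b_2g)$. * $n=3$: write $U=a x_1^3+b x_2^3+c x_3^3+f x_2^2x_3+g x_3^2x_1+h x_1^2x_2+i x_2x_3^2+j x_3x_1^2+k x_1x_2^2+m x_1x_2x_3$, and put $b_2=m^2-4(fj+gk+hi)$, $H=-\frac12\det(U_{ij})$, $Z=\frac14(H+b_2U)$, and let $\Theta$ be $\frac13$ times the determinant of the $4\times4$ matrix obtained by bordering $(U_{ij})$ with the row and the column $(H_1,H_2,H_3)$ and the corner entry $0$. Then $F_3=Z^2$ and $G_3=\frac1{192}(\Theta-16b_2Z^2-12b_2^2ZU+b_2^3U^2)$. * $n=4$: let $A,B$ be the matrices of second partial derivatives of $Q_1,Q_2$, and let $\sum_{r\le s}a^*_{rs}x_rx_s$ and $\sum_{r\le s}b^*_{rs}x_rx_s$ be the quadratic forms whose matrices of second partial derivatives are $\operatorname{adj}A$ and $\operatorname{adj}B$. Put $T_1=\sum_{i,j}\sum_{r\le s}b^*_{rs}(A_{ij}A_{rs}-A_{is}A_{jr})x_ix_j$ and $T_2=\sum_{i,j}\sum_{r\le s}a^*_{rs}(B_{ij}B_{rs}-B_{is}B_{jr})x_ix_j$.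 With $M=xA+zB$, put $P(x,z)=M_{12}M_{34}+M_{13}M_{24}+M_{14}M_{23}$ and $Q(x,z)=\frac14(\det M-P^2)$. Then $F_4=F_2(T_1,-T_2)$ and $G_4=G_2(T_1,-T_2)$, where $F_2,G_2$ are the forms attached to the generalised binary quartic $(P,Q)$. For $r\in\mathbb R$ and $p\in\mathcal C_\Phi(\mathbb R)$ with coordinates $p=(x_1:x_2:y)$ or $(x_1:\dots:x_n)$ put $$\rho_r(p)=\frac{\max(|F_n(\mathbf x)|,|rF_n(\mathbf x)+G_n(\mathbf x)|)}{\max(|x_1|,\dots,|x_n|)^{2n}},\qquad \delta(\Phi,r)=\sup_{p\in\mathcal C_\Phi(\mathbb R)}\rho_r(p),\qquad \varepsilon(\Phi,r)=\inf_{p\in\mathcal C_\Phi(\mathbb R)}\rho_r(p).$$ Let $S\subset\mathcal C_\Phi(\mathbb R)$ be the set of real points $p$ that satisfy at least one of the following conditions: 1. $x_i=\pm x_j$ for some $i\ne j$ in $\{1,\dots,n\}$; 2. $F_n(p)=\pm(rF_n(p)+G_n(p))$; 3. $n=2$ and $F_2(p)=0$; 4. for $f=F_n$ or $f=rF_n+G_n$,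 and for some index $i$, respectively some distinct $i,j$, respectively some distinct $i,j,k$, according as $n=2,3,4$, $$\frac{\partial f}{\partial x_i}(p)=0,\qquad \frac{\partial(U,f)}{\partial(x_i,x_j)}(p)=0,\qquad \frac{\partial(Q_1,Q_2,f)}{\partial(x_i,x_j,x_k)}(p)=0.$$ Then $S$ is finite, $\rho_r$ is bounded on $\mathcal C_\Phi(\mathbb R)$, and $\delta(\Phi,r)$ and $\varepsilon(\Phi,r)$ are respectively the maximum and the minimum of $\rho_r$ over $S$; in particular both are attained at points of $S$. -/

import Mathlib

open MvPolynomial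

noncomputable section

/-- A genus one model of degree `n ∈ {2, 3, 4}` over `ℝ`: a generalised binary quartic
`y² + P(x₁,x₂) y = Q(x₁,x₂)`, a ternary cubic `U`, or a quadric intersection `(Q₁, Q₂)`.
The index `n` is also the number of the variables `x₁, …, xₙ`. -/
inductive GenusOneModel : ℕ → Type
  | quartic (P Q : MvPolynomial (Fin 2) ℝ) (hP : P.IsHomogeneous 2) (hQ : Q.IsHomogeneous 4) :
      GenusOneModel 2
  | cubic (U : MvPolynomial (Fin 3) ℝ) (hU : U.IsHomogeneous 3) : GenusOneModel 3
  | quadrics (Q₁ Q₂ : MvPolynomial (Fin 4) ℝ) (h₁ : Q₁.IsHomogeneous 2)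
      (h₂ : Q₂.IsHomogeneous 2) : GenusOneModel 4

/-- The Hessian matrix of second partial derivatives. -/
def hessianMatrix {n : ℕ} (f : MvPolynomial (Fin n) ℝ) :
    Matrix (Fin n) (Fin n) (MvPolynomial (Fin n) ℝ) :=
  Matrix.of fun i j => pderiv i (pderiv j f)

/-- The `k × k` minor `∂(g₁,…,g_k) / ∂(x_{s 1},…,x_{s k})` of the Jacobian matrix. -/
def jacobianDet {k n : ℕ} (g : Fin k → MvPolynomial (Fin n) ℝ) (s : Fin k → Fin n) :
    MvPolynomial (Fin n) ℝ :=
  (Matrix.of fun a b => pderiv (s b) (g a)).det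

/-! ### Generalised binary quartics -/

namespace BinaryQuartic

/-- The coefficient of `x₁^i x₂^j`. -/
def cf (f : MvPolynomial (Fin 2) ℝ) (i j : ℕ) : ℝ :=
  coeff (Finsupp.single 0 i + Finsupp.single 1 j) f

/-- `b₂ = a₁² + 4 a₂`, where `a₁ = m` and `a₂ = -l n + c` for `P = l x₁² + m x₁ x₂ + n x₂²` and
`Q = a x₁⁴ + b x₁³ x₂ + c x₁² x₂² + d x₁ x₂³ + e x₂⁴`. -/
def b₂ (P Q : MvPolynomial (Fin 2) ℝ) : ℝ :=
  cf P 1 1 ^ 2 + 4 * (-(cf P 2 0 * cf P 0 2) + cf Q 2 2)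

/-- The binary quartic `g = P²/4 + Q` obtained by completing the square. -/
def g (P Q : MvPolynomial (Fin 2) ℝ) : MvPolynomial (Fin 2) ℝ :=
  C (1 / 4) * P ^ 2 + Q

/-- The covariant `h = (g₁₂² - g₁₁ g₂₂) / 3`. -/
def h (P Q : MvPolynomial (Fin 2) ℝ) : MvPolynomial (Fin 2) ℝ :=
  C (1 / 3) * (pderiv 0 (pderiv 1 (g P Q)) ^ 2 -
    pderiv 0 (pderiv 0 (g P Q)) * pderiv 1 (pderiv 1 (g P Q)))

/-- `F₂ = P² + 4 Q`. -/
def F (P Q : MvPolynomial (Fin 2) ℝ) : MvPolynomial (Fin 2) ℝ :=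
  P ^ 2 + 4 * Q

/-- `G₂ = (h - b₂ g) / 3`. -/
def G (P Q : MvPolynomial (Fin 2) ℝ) : MvPolynomial (Fin 2) ℝ :=
  C (1 / 3) * (h P Q - C (b₂ P Q) * g P Q)

/-- Homogeneous coordinates `(x₁, x₂, y)` of a real point of `y² + P y = Q`. (On this curve
`x₁ = x₂ = 0` would force `y = 0`.) -/
structure Solution (P Q : MvPolynomial (Fin 2) ℝ) where
  x : Fin 2 → ℝ
  y : ℝ
  x_ne_zero : x ≠ 0
  equation : y ^ 2 + eval x P * y = eval x Q

/-- `(x₁ : x₂ : y) = (t x₁ : t x₂ : t² y)` for `t ≠ 0`. -/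
instance scaling (P Q : MvPolynomial (Fin 2) ℝ) : Setoid (Solution P Q) where
  r p q := ∃ t : ℝ, t ≠ 0 ∧ q.x = t • p.x ∧ q.y = t ^ 2 * p.y
  iseqv :=
    { refl := fun p => ⟨1, one_ne_zero, by simp, by simp⟩
      symm := by
        rintro p q ⟨t, ht, hx, hy⟩
        refine ⟨t⁻¹, inv_ne_zero ht, ?_, ?_⟩
        · rw [hx, smul_smul, inv_mul_cancel₀ ht, one_smul]
        · rw [hy]
          field_simp
      trans := by
        rintro p q s ⟨t, ht, hx, hy⟩ ⟨u, hu, hx', hy'⟩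
        refine ⟨u * t, mul_ne_zero hu ht, ?_, ?_⟩
        · rw [hx', hx, smul_smul]
        · rw [hy', hy]
          ring }

end BinaryQuartic

/-! ### Ternary cubics -/

namespace TernaryCubic

/-- The coefficient of `x₁^i x₂^j x₃^k`. -/
def cf (U : MvPolynomial (Fin 3) ℝ) (i j k : ℕ) : ℝ :=
  coeff (Finsupp.single 0 i + Finsupp.single 1 j + Finsupp.single 2 k) U

/-- `b₂ = a₁² + 4 a₂`, where `a₁ = m` and `a₂ = -(f j + g k + h i)` for
`U = a x₁³ + b x₂³ + c x₃³ + f x₂² x₃ + g x₃² x₁ + h x₁² x₂ + i x₂ x₃² + j x₃ x₁² + k x₁ x₂²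
+ m x₁ x₂ x₃`. -/
def b₂ (U : MvPolynomial (Fin 3) ℝ) : ℝ :=
  cf U 1 1 1 ^ 2 +
    4 * -(cf U 0 2 1 * cf U 2 0 1 + cf U 1 0 2 * cf U 1 2 0 + cf U 2 1 0 * cf U 0 1 2)

/-- The Hessian `H = -(1/2) det (U_{ij})`. -/
def H (U : MvPolynomial (Fin 3) ℝ) : MvPolynomial (Fin 3) ℝ :=
  C (-(1 / 2)) * (hessianMatrix U).det

/-- The covariant `Θ`: one third of the determinant of the matrix `(U_{ij})` bordered by the
gradient of `H`, with `0` in the corner. -/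
def Θ (U : MvPolynomial (Fin 3) ℝ) : MvPolynomial (Fin 3) ℝ :=
  C (1 / 3) * (Matrix.fromBlocks (hessianMatrix U)
    (Matrix.of fun i (_ : Unit) => pderiv i (H U))
    (Matrix.of fun (_ : Unit) j => pderiv j (H U)) 0).det

/-- `Z = (H + b₂ U) / 4`. -/
def Z (U : MvPolynomial (Fin 3) ℝ) : MvPolynomial (Fin 3) ℝ :=
  C (1 / 4) * (H U + C (b₂ U) * U)

/-- `F₃ = Z²`. -/
def F (U : MvPolynomial (Fin 3) ℝ) : MvPolynomial (Fin 3) ℝ :=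
  Z U ^ 2

/-- `G₃ = (Θ - 16 b₂ Z² - 12 b₂² Z U + b₂³ U²) / 192`. -/
def G (U : MvPolynomial (Fin 3) ℝ) : MvPolynomial (Fin 3) ℝ :=
  C (1 / 192) * (Θ U - C (16 * b₂ U) * Z U ^ 2 - C (12 * b₂ U ^ 2) * Z U * U
    + C (b₂ U ^ 3) * U ^ 2)

end TernaryCubic

/-! ### Quadric intersections -/

namespace QuadricIntersection

/-- The (constant) matrix of second partial derivatives of a quadratic form. -/
def mat (q : MvPolynomial (Fin 4) ℝ) : Matrix (Fin 4) (Fin 4) ℝ :=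
  Matrix.of fun i j => constantCoeff (pderiv i (pderiv j q))

/-- For `r ≤ s`, the coefficient of `x_r x_s` in the quadratic form `q*` whose matrix of second
partial derivatives is the adjugate of that of `q`. -/
def dualCoeff (q : MvPolynomial (Fin 4) ℝ) (r s : Fin 4) : ℝ :=
  if r = s then (mat q).adjugate r r / 2 else (mat q).adjugate r s

/-- The covariant
`T(q, q') = ∑_{i,j} ∑_{r ≤ s} q'*_{rs} (A_{ij} A_{rs} - A_{is} A_{jr}) x_i x_j`, with `A` the
matrix of second partial derivatives of `q`. Thus `T₁ = T(Q₁, Q₂)` and `T₂ = T(Q₂, Q₁)`. -/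
def T (q q' : MvPolynomial (Fin 4) ℝ) : MvPolynomial (Fin 4) ℝ :=
  ∑ i, ∑ j, ∑ r, ∑ s ∈ Finset.Ici r,
    C (dualCoeff q' r s * (mat q i j * mat q r s - mat q i s * mat q j r)) * X i * X j

/-- The matrix of second partial derivatives of `x Q₁ + z Q₂`, with entries in `ℝ[x, z]`. -/
def pencil (Q₁ Q₂ : MvPolynomial (Fin 4) ℝ) :
    Matrix (Fin 4) (Fin 4) (MvPolynomial (Fin 2) ℝ) :=
  Matrix.of fun i j => C (mat Q₁ i j) * X 0 + C (mat Q₂ i j) * X 1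

/-- `P = pf (x Q₁ + z Q₂)`, where `pf Γ = c₁₂ c₃₄ + c₁₃ c₂₄ + c₁₄ c₂₃` for `Γ = ∑_{i ≤ j} c_{ij} x_i x_j`.
For `i < j` the second partial derivative of `Γ` is `c_{ij}`. -/
def P (Q₁ Q₂ : MvPolynomial (Fin 4) ℝ) : MvPolynomial (Fin 2) ℝ :=
  pencil Q₁ Q₂ 0 1 * pencil Q₁ Q₂ 2 3 + pencil Q₁ Q₂ 0 2 * pencil Q₁ Q₂ 1 3
    + pencil Q₁ Q₂ 0 3 * pencil Q₁ Q₂ 1 2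

/-- `Q = rd (x Q₁ + z Q₂)`, where `rd` is defined by `det (∂²Γ/∂x_i∂x_j) = pf Γ ² + 4 rd Γ`. -/
def Q (Q₁ Q₂ : MvPolynomial (Fin 4) ℝ) : MvPolynomial (Fin 2) ℝ :=
  C (1 / 4) * ((pencil Q₁ Q₂).det - P Q₁ Q₂ ^ 2)

/-- `F₄ = F₂(T₁, -T₂)`, where `F₂` belongs to the generalised binary quartic `(P, Q)`. -/
def F (Q₁ Q₂ : MvPolynomial (Fin 4) ℝ) : MvPolynomial (Fin 4) ℝ :=
  bind₁ ![T Q₁ Q₂, -T Q₂ Q₁] (BinaryQuartic.F (P Q₁ Q₂) (Q Q₁ Q₂))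

/-- `G₄ = G₂(T₁, -T₂)`, where `G₂` belongs to the generalised binary quartic `(P, Q)`. -/
def G (Q₁ Q₂ : MvPolynomial (Fin 4) ℝ) : MvPolynomial (Fin 4) ℝ :=
  bind₁ ![T Q₁ Q₂, -T Q₂ Q₁] (BinaryQuartic.G (P Q₁ Q₂) (Q Q₁ Q₂))

end QuadricIntersection

/-! ### Genus one models of degree 2, 3, 4 -/

namespace GenusOneModel

/-- The variety `C_Φ` is a smooth curve of genus one. This is the Jacobian criterion at all complex
points of `C_Φ`, for a variety of codimension one (`n = 2, 3`) or two (`n = 4`); by the degrees of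
the equations a smooth such curve has genus one. -/
def IsNonsingular : {n : ℕ} → GenusOneModel n → Prop
  | _, quartic P Q _ _ => ∀ (x : Fin 2 → ℂ) (y : ℂ), x ≠ 0 →
      y ^ 2 + aeval x P * y = aeval x Q →
      ¬ (2 * y + aeval x P = 0 ∧
        ∀ i, aeval x (pderiv i P) * y - aeval x (pderiv i Q) = 0)
  | _, cubic U _ => ∀ x : Fin 3 → ℂ, x ≠ 0 → aeval x U = 0 → ∃ i, aeval x (pderiv i U) ≠ 0
  | _, quadrics Q₁ Q₂ _ _ => ∀ x : Fin 4 → ℂ, x ≠ 0 → aeval x Q₁ = 0 → aeval x Q₂ = 0 →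
      LinearIndependent ℂ
        ![fun i => aeval x (pderiv i Q₁), fun i => aeval x (pderiv i Q₂)]

/-- The set of real points `C_Φ(ℝ)`: a subset of the weighted projective plane with coordinates
`(x₁ : x₂ : y)` of weights `1, 1, 2` if `n = 2`, and of projective `(n-1)`-space if `n = 3, 4`. -/
def RealPoint : {n : ℕ} → GenusOneModel n → Type
  | _, quartic P Q _ _ => Quotient (BinaryQuartic.scaling P Q)
  | _, cubic U _ => {p : Projectivization ℝ (Fin 3 → ℝ) // eval p.rep U = 0}
  | _, quadrics Q₁ Q₂ _ _ =>
      {p : Projectivization ℝ (Fin 4 → ℝ) // eval p.rep Q₁ = 0 ∧ eval p.rep Q₂ = 0}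

/-- Homogeneous coordinates `(x₁, …, xₙ)` of a point `P = (x₁ : x₂ : y)` or
`P = (x₁ : … : xₙ)`. They are chosen up to a common factor, on which nothing below depends. -/
def coords : {n : ℕ} → (Φ : GenusOneModel n) → Φ.RealPoint → Fin n → ℝ
  | _, quartic _ _ _ _ => fun p => (Quotient.out p).x
  | _, cubic _ _ => fun p => p.1.rep
  | _, quadrics _ _ _ _ => fun p => p.1.rep

/-- The form `Fₙ` of degree `2n`. -/
def F : {n : ℕ} → GenusOneModel n → MvPolynomial (Fin n) ℝ
  | _, quartic P Q _ _ => BinaryQuartic.F P Q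
  | _, cubic U _ => TernaryCubic.F U
  | _, quadrics Q₁ Q₂ _ _ => QuadricIntersection.F Q₁ Q₂

/-- The form `Gₙ` of degree `2n`. -/
def G : {n : ℕ} → GenusOneModel n → MvPolynomial (Fin n) ℝ
  | _, quartic P Q _ _ => BinaryQuartic.G P Q
  | _, cubic U _ => TernaryCubic.G U
  | _, quadrics Q₁ Q₂ _ _ => QuadricIntersection.G Q₁ Q₂

variable {n : ℕ}

/-- The form `r Fₙ + Gₙ`. -/
def shifted (Φ : GenusOneModel n) (r : ℝ) : MvPolynomial (Fin n) ℝ :=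
  C r * Φ.F + Φ.G

/-- `max (|Fₙ(x)|, |r Fₙ(x) + Gₙ(x)|) / max (|x₁|, …, |xₙ|)^{2n}` at a real point; the norm of
`Fin n → ℝ` is the maximum norm. -/
def ratio (Φ : GenusOneModel n) (r : ℝ) (p : Φ.RealPoint) : ℝ :=
  max |eval (Φ.coords p) Φ.F| |eval (Φ.coords p) (Φ.shifted r)| / ‖Φ.coords p‖ ^ (2 * n)

/-- `δ(Φ, r)`, the supremum over `C_Φ(ℝ)`. -/
def δ (Φ : GenusOneModel n) (r : ℝ) : ℝ :=
  ⨆ p : Φ.RealPoint, Φ.ratio r p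

/-- `ε(Φ, r)`, the infimum over `C_Φ(ℝ)`. -/
def ε (Φ : GenusOneModel n) (r : ℝ) : ℝ :=
  ⨅ p : Φ.RealPoint, Φ.ratio r p

/-- For some (distinct) indices, the equation `∂f/∂x_i = 0`, `∂(U,f)/∂(x_i,x_j) = 0`,
`∂(Q₁,Q₂,f)/∂(x_i,x_j,x_k) = 0` holds at `x`, according as `n = 2, 3, 4`. -/
def IsCritical : {n : ℕ} → GenusOneModel n → MvPolynomial (Fin n) ℝ → (Fin n → ℝ) → Prop
  | _, quartic _ _ _ _, f, x => ∃ i : Fin 2, eval x (pderiv i f) = 0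
  | _, cubic U _, f, x => ∃ i j : Fin 3, i ≠ j ∧ eval x (jacobianDet ![U, f] ![i, j]) = 0
  | _, quadrics Q₁ Q₂ _ _, f, x => ∃ i j k : Fin 4, i ≠ j ∧ i ≠ k ∧ j ≠ k ∧
      eval x (jacobianDet ![Q₁, Q₂, f] ![i, j, k]) = 0

/-- The real points of `C_Φ` at which `δ(Φ, r)` and `ε(Φ, r)` are to be looked for. -/
def candidates (Φ : GenusOneModel n) (r : ℝ) : Set Φ.RealPoint :=
  {p |
    (∃ i j : Fin n, i ≠ j ∧
      (Φ.coords p i = Φ.coords p j ∨ Φ.coords p i = -Φ.coords p j)) ∨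
    (eval (Φ.coords p) Φ.F = eval (Φ.coords p) (Φ.shifted r) ∨
      eval (Φ.coords p) Φ.F = -eval (Φ.coords p) (Φ.shifted r)) ∨
    (n = 2 ∧ eval (Φ.coords p) Φ.F = 0) ∨
    (Φ.IsCritical Φ.F (Φ.coords p) ∨ Φ.IsCritical (Φ.shifted r) (Φ.coords p))}

end GenusOneModel

end

/-! ### Homogeneity, derivatives and Lagrange multipliers. -/

open Filter Topology

/-! Extremal values. The ratio is homogeneous of degree zero, so it is a function on the cone over
the real curve, and compactness of the cone's unit sphere makes it attain its extremes
(`exists_extremal`). At an extremal point outside conditions 1 and 2, one coordinate `x_i` and one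
form `φ` among `F`, `rF + G` strictly dominate. Nearby, on the slice where `x_i` is constant, the
ratio is therefore a nonzero constant times `φ`. Lagrange multipliers on that slice make the
Jacobian minors that avoid column `i` vanish, which is condition 4. For `n = 2` the cone is `F ≥ 0`;
off condition 3 it is a neighbourhood of the point, and no constraint besides the slice remains.

Finiteness. No condition may hold identically on the curve. Conditions 2, 3 and 4 concern
combinations `φ = sF + κG` with `(s, κ) ≠ 0`.

For `n = 2` each condition is the vanishing of a binary form. The only danger is `∂φ/∂x_i = 0`
identically, which makes a combination of `g` and `h` a multiple of a fourth power of a variable.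
Then `g` has a multiple root (`exists_double_root`), and the curve is singular.

For `n = 4` the two quadrics are diagonalized simultaneously over the complex numbers, with
coordinates `y_i` and diagonal entries `a_i`, `b_i`. On the curve `a_i T₁ - b_i T₂` is a nonzero
constant times `y_i²` (`c_mul_sq`). Hence, up to a common scaling, the `y_i` are square roots of
four pairwise non-proportional linear polynomials in `t = -T₁/T₂`. Such roots are linearly
independent over the polynomials (`linear_four`), and linear conditions as well as Jacobian
conditions become nontrivial relations `∑ p_i(t) y_i = 0`. These leave finitely many `t`, hence
finitely many points.

For `n = 3` the cubic `U` is irreducible, and it suffices that `U` does not divide the form in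
question (`finite_setOf_common_zero`). A minor of the Jacobian of `(U, φ)` is, up to sign, the
determinant of the gradients of `λ = x_k`, `U` and `φ`. If it vanished on the curve, `φ/λ⁶` would be
locally constant there, and `φ` would vanish to high order at a real point of the curve on the line
`λ = 0`. Modulo `U`, `φ` is a combination of `Θ` and `H²`. Expanding these to third order in a
normal form at that point shows that the vanishing forces `s = κ = 0` or a singular curve
(`nonflex_not_dvd`, `flex_not_dvd`). -/

theorem aeval_smul_of_isHomogeneous {R A σ : Type*} [CommRing R] [CommRing A] [Algebra R A]
    {f : MvPolynomial σ R} {d : ℕ} (hf : f.IsHomogeneous d) (t : A) (x : σ → A) :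
    aeval (t • x) f = t ^ d * aeval x f := by
  rw [aeval_def, aeval_def, eval₂_eq, eval₂_eq, Finset.mul_sum]
  refine Finset.sum_congr rfl fun m hm => ?_
  have hd := hf.degree_eq_sum_deg_support hm
  simp only [Pi.smul_apply, smul_eq_mul, mul_pow, Finset.prod_mul_distrib]
  rw [Finset.prod_pow_eq_pow_sum, hd]
  ring

theorem eval_smul_of_isHomogeneous {R σ : Type*} [CommRing R]
    {f : MvPolynomial σ R} {d : ℕ} (hf : f.IsHomogeneous d) (t : R) (x : σ → R) :
    eval (t • x) f = t ^ d * eval x f := by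
  have := aeval_smul_of_isHomogeneous hf t x
  simpa [aeval_eq_eval] using this

/-- The strict derivative of a polynomial function, in terms of formal partial derivatives. -/
theorem hasStrictFDerivAt_eval {n : ℕ} (f : MvPolynomial (Fin n) ℝ) (x : Fin n → ℝ) :
    HasStrictFDerivAt (fun y : Fin n → ℝ => eval y f)
      (∑ i, eval x (pderiv i f) • ContinuousLinearMap.proj (R := ℝ) (φ := fun _ : Fin n => ℝ) i)
      x := by
  induction f using MvPolynomial.induction_on with
  | C a => simpa using hasStrictFDerivAt_const a x
  | add p q hp hq =>
    simp only [map_add, add_smul, Finset.sum_add_distrib]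
    exact hp.add hq
  | mul_X p i hp =>
    have h := hp.mul (hasStrictFDerivAt_apply (𝕜 := ℝ) i x)
    simp only [map_mul, eval_X]
    refine h.congr_fderiv ?_
    ext v
    simp [pderiv_X, Finset.sum_add_distrib, add_mul, Finset.mul_sum, Pi.single_apply, apply_ite,
      mul_assoc]

/-- Lagrange multipliers on a slice `y i = x i`: at a local extremum of the last polynomial on the
common level set of the others, the minors of the Jacobian matrix avoiding column `i` vanish. -/
theorem eval_jacobianDet_eq_zero_of_isLocalExtrOn {k n : ℕ}
    (g : Fin (k + 1) → MvPolynomial (Fin n) ℝ) (x : Fin n → ℝ) (i : Fin n)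
    (s : Fin (k + 1) → Fin n) (hs : ∀ b, s b ≠ i)
    (h : IsLocalExtrOn (fun y : Fin n → ℝ => eval y (g (Fin.last k)))
      {y | y i = x i ∧ ∀ a : Fin k, eval y (g a.castSucc) = eval x (g a.castSucc)} x) :
    eval x (jacobianDet g s) = 0 := by
  -- The slice condition enters as one more constraint, the polynomial `X i`, at the index `none`.
  have h' : IsLocalExtrOn (fun y : Fin n → ℝ => eval y (g (Fin.last k)))
      {y | ∀ a : Option (Fin k), eval y (a.elim (X i) fun a => g a.castSucc) =
        eval x (a.elim (X i) fun a => g a.castSucc)} x := by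
    convert h using 2
    ext y
    simp [Option.forall]
  obtain ⟨Λ, c, hne, hΛ⟩ := h'.exists_multipliers_of_hasStrictFDerivAt
    (fun a => hasStrictFDerivAt_eval _ x) (hasStrictFDerivAt_eval _ x)
  have key : ∀ j, ∑ a, Λ a * eval x (pderiv j (a.elim (X i) fun a => g a.castSucc)) +
      c * eval x (pderiv j (g (Fin.last k))) = 0 := by
    intro j
    have := congrArg (fun (T : (Fin n → ℝ) →L[ℝ] ℝ) => T (Pi.single j 1)) hΛ
    simpa [Pi.single_apply] using this
  simp only [Fintype.sum_option, Option.elim_none, Option.elim_some] at key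
  rw [jacobianDet, RingHom.map_det]
  apply Matrix.exists_vecMul_eq_zero_iff.1
  -- The multiplier of `X i` is dropped: its gradient has no entry in the columns `s b`. If all the
  -- others vanish, the equation in column `i` makes it vanish as well, against nontriviality.
  refine ⟨Fin.snoc (fun a => Λ (some a)) c, ?_, ?_⟩
  · intro h0
    have hc : c = 0 := by simpa using congrFun h0 (Fin.last k)
    have hS : ∀ a, Λ (some a) = 0 := fun a => by simpa using congrFun h0 a.castSucc
    have hN : Λ none = 0 := by simpa [hc, hS] using key i
    apply hne
    rw [Prod.mk_eq_zero]
    refine ⟨?_, hc⟩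
    ext a
    cases a <;> simp [hN, hS]
  · ext b
    have := key (s b)
    rw [pderiv_X_of_ne (hs b).symm] at this
    simpa [Matrix.vecMul, dotProduct, Fin.sum_univ_castSucc] using this

/-- Away from ties, the normalised maximum of two forms is locally, on a slice `y i = x i`, a
nonzero multiple of one of the two forms. -/
theorem exists_eventually_ratio_eq {n d : ℕ} (F f : MvPolynomial (Fin n) ℝ) (x : Fin n → ℝ)
    (hx : x ≠ 0) (h₁ : ∀ i j, i ≠ j → x i ≠ x j ∧ x i ≠ -x j)
    (h₂ : eval x F ≠ eval x f ∧ eval x F ≠ -eval x f) :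
    ∃ i, ∃ φ, (φ = F ∨ φ = f) ∧ ∃ c : ℝ, c ≠ 0 ∧ ∀ᶠ y in 𝓝 x, y i = x i →
      max |eval y F| |eval y f| / ‖y‖ ^ d = c * eval y φ := by
  have hn : Nonempty (Fin n) := by
    by_contra h
    rw [not_nonempty_iff] at h
    exact hx (Subsingleton.elim _ _)
  obtain ⟨i, hi⟩ := Finite.exists_max fun j => |x j|
  have hlt : ∀ j, j ≠ i → |x j| < |x i| := by
    intro j hj
    refine lt_of_le_of_ne (hi j) fun h => ?_
    rcases abs_eq_abs.1 h with h | h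
    exacts [(h₁ j i hj).1 h, (h₁ j i hj).2 h]
  have hxi : x i ≠ 0 := by
    intro h0
    apply hx
    ext j
    have := hi j
    rw [h0, abs_zero] at this
    exact abs_eq_zero.1 (le_antisymm this (abs_nonneg _))
  have hnorm : ∀ᶠ y in 𝓝 x, ‖y‖ = |y i| := by
    have : ∀ᶠ y : Fin n → ℝ in 𝓝 x, ∀ j, j ≠ i → |y j| < |y i| := by
      rw [eventually_all]
      intro j
      by_cases hj : j = i
      · simp [hj]
      · simp only [ne_eq, hj, not_false_eq_true, forall_const]
        exact ((continuous_apply j).abs.continuousAt).eventually_lt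
          ((continuous_apply i).abs.continuousAt) (hlt j hj)
    filter_upwards [this] with y hy
    apply le_antisymm
    · refine (pi_norm_le_iff_of_nonneg (abs_nonneg _)).2 fun j => ?_
      by_cases hj : j = i
      · simp [hj]
      · exact (hy j hj).le
    · exact norm_le_pi_norm y i
  have main : ∀ φ ψ : MvPolynomial (Fin n) ℝ, |eval x ψ| < |eval x φ| →
      ∃ c : ℝ, c ≠ 0 ∧ ∀ᶠ y in 𝓝 x, y i = x i →
        max |eval y φ| |eval y ψ| / ‖y‖ ^ d = c * eval y φ := by
    intro φ ψ h
    have e1 : ∀ᶠ y in 𝓝 x, |eval y ψ| < |eval y φ| :=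
      ((MvPolynomial.continuous_eval ψ).abs.continuousAt).eventually_lt
        ((MvPolynomial.continuous_eval φ).abs.continuousAt) h
    have hd : |x i| ^ d ≠ 0 := pow_ne_zero _ (abs_ne_zero.2 hxi)
    rcases lt_or_gt_of_ne (abs_pos.1 ((abs_nonneg _).trans_lt h)) with h0 | h0
    · have e2 : ∀ᶠ y in 𝓝 x, eval y φ < 0 :=
        ((MvPolynomial.continuous_eval φ).continuousAt).eventually_lt continuousAt_const h0
      refine ⟨-(|x i| ^ d)⁻¹, neg_ne_zero.2 (inv_ne_zero hd), ?_⟩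
      filter_upwards [e1, e2, hnorm] with y h1 h2 h3 h4
      rw [max_eq_left h1.le, abs_of_neg h2, h3, h4]
      ring
    · have e2 : ∀ᶠ y in 𝓝 x, 0 < eval y φ :=
        continuousAt_const.eventually_lt ((MvPolynomial.continuous_eval φ).continuousAt) h0
      refine ⟨(|x i| ^ d)⁻¹, inv_ne_zero hd, ?_⟩
      filter_upwards [e1, e2, hnorm] with y h1 h2 h3 h4
      rw [max_eq_left h1.le, abs_of_pos h2, h3, h4]
      ring
  refine ⟨i, ?_⟩
  have hne : |eval x F| ≠ |eval x f| := fun h => by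
    rcases abs_eq_abs.1 h with h | h
    exacts [h₂.1 h, h₂.2 h]
  rcases lt_or_gt_of_ne hne with h | h
  · obtain ⟨c, hc, hev⟩ := main f F h
    refine ⟨f, Or.inr rfl, c, hc, ?_⟩
    filter_upwards [hev] with y hy hi
    rw [max_comm, hy hi]
  · obtain ⟨c, hc, hev⟩ := main F f h
    exact ⟨F, Or.inl rfl, c, hc, hev⟩

/-- Under the hypotheses of `exists_eventually_ratio_eq`, a local extremum of the normalised
maximum on a set is a local extremum of one of the two forms on a slice. -/
theorem exists_isLocalExtrOn_slice {n d : ℕ} (F f : MvPolynomial (Fin n) ℝ) (x : Fin n → ℝ)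
    (hx : x ≠ 0) (h₁ : ∀ i j, i ≠ j → x i ≠ x j ∧ x i ≠ -x j)
    (h₂ : eval x F ≠ eval x f ∧ eval x F ≠ -eval x f) (V : Set (Fin n → ℝ))
    (hV : IsLocalExtrOn (fun y => max |eval y F| |eval y f| / ‖y‖ ^ d) V x) :
    ∃ i, ∃ φ, (φ = F ∨ φ = f) ∧
      IsLocalExtrOn (fun y : Fin n → ℝ => eval y φ) {y | y i = x i ∧ y ∈ V} x := by
  obtain ⟨i, φ, hφ, c, hc, hev⟩ := exists_eventually_ratio_eq (d := d) F f x hx h₁ h₂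
  refine ⟨i, φ, hφ, ?_⟩
  have hxeq := hev.self_of_nhds rfl
  have hsub : {y : Fin n → ℝ | y i = x i ∧ y ∈ V} ⊆ V := fun y hy => hy.2
  have hev' : ∀ᶠ y in 𝓝[{y : Fin n → ℝ | y i = x i ∧ y ∈ V}] x,
      max |eval y F| |eval y f| / ‖y‖ ^ d = c * eval y φ := by
    filter_upwards [hev.filter_mono nhdsWithin_le_nhds, self_mem_nhdsWithin] with y h1 h2
    exact h1 h2.1
  rcases hV with h | h
  · have h := IsMinFilter.filter_mono h (nhdsWithin_mono x hsub)
    rcases lt_or_gt_of_ne hc with h0 | h0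
    · right
      filter_upwards [h, hev'] with y h1 h2
      simp only [h2, hxeq] at h1
      exact (mul_le_mul_left_of_neg h0).1 h1
    · left
      filter_upwards [h, hev'] with y h1 h2
      simp only [h2, hxeq] at h1
      exact (mul_le_mul_iff_right₀ h0).1 h1
  · have h := IsMaxFilter.filter_mono h (nhdsWithin_mono x hsub)
    rcases lt_or_gt_of_ne hc with h0 | h0
    · left
      filter_upwards [h, hev'] with y h1 h2
      simp only [h2, hxeq] at h1
      exact (mul_le_mul_left_of_neg h0).1 h1
    · right
      filter_upwards [h, hev'] with y h1 h2
      simp only [h2, hxeq] at h1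
      exact (mul_le_mul_iff_right₀ h0).1 h1

/-! ### Degrees of the covariants. -/

/-- A determinant whose `(i, j)` entry is homogeneous of degree `ρ i + κ j` is homogeneous. -/
theorem isHomogeneous_det {σ R ι : Type*} [CommRing R] [Fintype ι] [DecidableEq ι]
    (M : Matrix ι ι (MvPolynomial σ R)) (ρ κ : ι → ℕ)
    (h : ∀ i j, (M i j).IsHomogeneous (ρ i + κ j)) :
    M.det.IsHomogeneous (∑ i, (ρ i + κ i)) := by
  rw [Matrix.det_apply]
  refine IsHomogeneous.sum _ _ _ fun e _ => ?_
  have h1 : (∏ i, M (e i) i).IsHomogeneous (∑ i, (ρ (e i) + κ i)) :=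
    IsHomogeneous.prod _ _ _ fun i _ => h _ _
  have h2 : ∑ i, (ρ (e i) + κ i) = ∑ i, (ρ i + κ i) := by
    rw [Finset.sum_add_distrib, Finset.sum_add_distrib, Equiv.sum_comp e ρ]
  rw [h2] at h1
  rcases Int.units_eq_one_or (Equiv.Perm.sign e) with h | h
  · rw [h, one_smul]; exact h1
  · rw [h, Units.neg_smul, one_smul]; exact h1.neg

namespace BinaryQuartic

variable {P Q : MvPolynomial (Fin 2) ℝ}

theorem isHomogeneous_g (hP : P.IsHomogeneous 2) (hQ : Q.IsHomogeneous 4) :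
    (g P Q).IsHomogeneous 4 :=
  ((hP.pow 2).C_mul _).add hQ

theorem isHomogeneous_h (hP : P.IsHomogeneous 2) (hQ : Q.IsHomogeneous 4) :
    (h P Q).IsHomogeneous 4 := by
  have hg := isHomogeneous_g hP hQ
  have h2 : ∀ i j, (pderiv i (pderiv j (g P Q))).IsHomogeneous 2 := fun i j =>
    (hg.pderiv (i := j)).pderiv
  exact ((((h2 0 1).pow 2)).sub ((h2 0 0).mul (h2 1 1))).C_mul _

theorem isHomogeneous_F (hP : P.IsHomogeneous 2) (hQ : Q.IsHomogeneous 4) :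
    (F P Q).IsHomogeneous 4 :=
  (hP.pow 2).add (hQ.C_mul 4)

theorem isHomogeneous_G (hP : P.IsHomogeneous 2) (hQ : Q.IsHomogeneous 4) :
    (G P Q).IsHomogeneous 4 :=
  ((isHomogeneous_h hP hQ).sub ((isHomogeneous_g hP hQ).C_mul _)).C_mul _

end BinaryQuartic

namespace TernaryCubic

variable {U : MvPolynomial (Fin 3) ℝ}

theorem isHomogeneous_hessianMatrix (hU : U.IsHomogeneous 3) (i j : Fin 3) :
    (hessianMatrix U i j).IsHomogeneous 1 :=
  (hU.pderiv (i := j)).pderiv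

theorem isHomogeneous_H (hU : U.IsHomogeneous 3) : (H U).IsHomogeneous 3 :=
  (isHomogeneous_det (hessianMatrix U) 1 0 (isHomogeneous_hessianMatrix hU)).C_mul _

theorem isHomogeneous_Θ (hU : U.IsHomogeneous 3) : (Θ U).IsHomogeneous 6 := by
  have hH : ∀ i, (pderiv i (H U)).IsHomogeneous 2 := fun i => (isHomogeneous_H hU).pderiv
  refine (isHomogeneous_det _ (Sum.elim 1 2) (Sum.elim 0 1) ?_).C_mul _
  rintro (i | i) (j | j)
  · exact isHomogeneous_hessianMatrix hU i j
  · exact hH i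
  · exact hH j
  · exact isHomogeneous_zero _ _ _

theorem isHomogeneous_Z (hU : U.IsHomogeneous 3) : (Z U).IsHomogeneous 3 :=
  ((isHomogeneous_H hU).add (hU.C_mul _)).C_mul _

theorem isHomogeneous_F (hU : U.IsHomogeneous 3) : (F U).IsHomogeneous 6 :=
  (isHomogeneous_Z hU).pow 2

theorem isHomogeneous_G (hU : U.IsHomogeneous 3) : (G U).IsHomogeneous 6 := by
  have hZ := isHomogeneous_Z hU
  exact ((((isHomogeneous_Θ hU).sub ((hZ.pow 2).C_mul _)).sub ((hZ.C_mul _).mul hU)).add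
    ((hU.pow 2).C_mul _)).C_mul _

end TernaryCubic

namespace QuadricIntersection

theorem isHomogeneous_T (q q' : MvPolynomial (Fin 4) ℝ) : (T q q').IsHomogeneous 2 := by
  refine IsHomogeneous.sum _ _ _ fun i _ => IsHomogeneous.sum _ _ _ fun j _ =>
    IsHomogeneous.sum _ _ _ fun r _ => IsHomogeneous.sum _ _ _ fun s _ => ?_
  exact (isHomogeneous_C_mul_X _ i).mul (isHomogeneous_X ℝ j)

theorem isHomogeneous_pencil (Q₁ Q₂ : MvPolynomial (Fin 4) ℝ) (i j : Fin 4) :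
    (pencil Q₁ Q₂ i j).IsHomogeneous 1 :=
  (isHomogeneous_C_mul_X _ _).add (isHomogeneous_C_mul_X _ _)

theorem isHomogeneous_P (Q₁ Q₂ : MvPolynomial (Fin 4) ℝ) : (P Q₁ Q₂).IsHomogeneous 2 := by
  have h := isHomogeneous_pencil Q₁ Q₂
  exact (((h 0 1).mul (h 2 3)).add ((h 0 2).mul (h 1 3))).add ((h 0 3).mul (h 1 2))

theorem isHomogeneous_Q (Q₁ Q₂ : MvPolynomial (Fin 4) ℝ) : (Q Q₁ Q₂).IsHomogeneous 4 :=
  ((isHomogeneous_det (pencil Q₁ Q₂) 1 0 (isHomogeneous_pencil Q₁ Q₂)).sub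
    ((isHomogeneous_P Q₁ Q₂).pow 2)).C_mul _

theorem isHomogeneous_bind₁_T (q q' : MvPolynomial (Fin 4) ℝ) {f : MvPolynomial (Fin 2) ℝ}
    (hf : f.IsHomogeneous 4) : (bind₁ ![T q q', -T q' q] f).IsHomogeneous 8 := by
  refine hf.aeval (n := 2) _ fun i => ?_
  fin_cases i
  · exact isHomogeneous_T q q'
  · exact (isHomogeneous_T q' q).neg

end QuadricIntersection

/-! ### The cone over the real curve and the extremal points. -/

namespace GenusOneModel

variable {n : ℕ}

theorem isHomogeneous_F : ∀ {n : ℕ} (Φ : GenusOneModel n), Φ.F.IsHomogeneous (2 * n)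
  | _, quartic _ _ hP hQ => BinaryQuartic.isHomogeneous_F hP hQ
  | _, cubic _ hU => TernaryCubic.isHomogeneous_F hU
  | _, quadrics Q₁ Q₂ _ _ => QuadricIntersection.isHomogeneous_bind₁_T _ _
      (BinaryQuartic.isHomogeneous_F (QuadricIntersection.isHomogeneous_P Q₁ Q₂)
        (QuadricIntersection.isHomogeneous_Q Q₁ Q₂))

theorem isHomogeneous_G : ∀ {n : ℕ} (Φ : GenusOneModel n), Φ.G.IsHomogeneous (2 * n)
  | _, quartic _ _ hP hQ => BinaryQuartic.isHomogeneous_G hP hQ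
  | _, cubic _ hU => TernaryCubic.isHomogeneous_G hU
  | _, quadrics Q₁ Q₂ _ _ => QuadricIntersection.isHomogeneous_bind₁_T _ _
      (BinaryQuartic.isHomogeneous_G (QuadricIntersection.isHomogeneous_P Q₁ Q₂)
        (QuadricIntersection.isHomogeneous_Q Q₁ Q₂))

theorem isHomogeneous_shifted (Φ : GenusOneModel n) (r : ℝ) :
    (Φ.shifted r).IsHomogeneous (2 * n) :=
  (Φ.isHomogeneous_F.C_mul r).add Φ.isHomogeneous_G

/-- The cone in `ℝⁿ` over the image of `C_Φ(ℝ)` in projective space. -/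
def realCone : {n : ℕ} → GenusOneModel n → Set (Fin n → ℝ)
  | _, quartic P Q _ _ => {x | 0 ≤ eval x (BinaryQuartic.F P Q)}
  | _, cubic U _ => {x | eval x U = 0}
  | _, quadrics Q₁ Q₂ _ _ => {x | eval x Q₁ = 0 ∧ eval x Q₂ = 0}

theorem isClosed_realCone : ∀ {n : ℕ} (Φ : GenusOneModel n), IsClosed Φ.realCone
  | _, quartic _ _ _ _ => isClosed_le continuous_const (MvPolynomial.continuous_eval _)
  | _, cubic _ _ => isClosed_eq (MvPolynomial.continuous_eval _) continuous_const
  | _, quadrics _ _ _ _ => (isClosed_eq (MvPolynomial.continuous_eval _) continuous_const).inter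
      (isClosed_eq (MvPolynomial.continuous_eval _) continuous_const)

theorem smul_mem_realCone (Φ : GenusOneModel n) (t : ℝ) {x : Fin n → ℝ} (hx : x ∈ Φ.realCone) :
    t • x ∈ Φ.realCone := by
  cases Φ with
  | quartic P Q hP hQ =>
    have hx : 0 ≤ eval x (BinaryQuartic.F P Q) := hx
    change 0 ≤ eval (t • x) (BinaryQuartic.F P Q)
    rw [eval_smul_of_isHomogeneous (BinaryQuartic.isHomogeneous_F hP hQ)]
    positivity
  | cubic U hU =>
    have hx : eval x U = 0 := hx
    change eval (t • x) U = 0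
    rw [eval_smul_of_isHomogeneous hU, hx, mul_zero]
  | quadrics Q₁ Q₂ h₁ h₂ =>
    have hx : eval x Q₁ = 0 ∧ eval x Q₂ = 0 := hx
    change eval (t • x) Q₁ = 0 ∧ eval (t • x) Q₂ = 0
    rw [eval_smul_of_isHomogeneous h₁, eval_smul_of_isHomogeneous h₂, hx.1, hx.2]
    simp

theorem coords_ne_zero : ∀ {n : ℕ} (Φ : GenusOneModel n) (p : Φ.RealPoint), Φ.coords p ≠ 0
  | _, quartic _ _ _ _, p => (Quotient.out p).x_ne_zero
  | _, cubic _ _, p => p.1.rep_nonzero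
  | _, quadrics _ _ _ _, p => p.1.rep_nonzero

/-- For `n = 2`, `F₂ = P² + 4Q` is the discriminant of `y² + P y - Q` in `y`, so at a real solution
it is the square of `2y + P`. -/
theorem coords_mem_realCone : ∀ {n : ℕ} (Φ : GenusOneModel n) (p : Φ.RealPoint),
    Φ.coords p ∈ Φ.realCone
  | _, quartic P Q _ _, p => by
    have h := (Quotient.out p).equation
    change 0 ≤ eval (Quotient.out p).x (P ^ 2 + 4 * Q)
    have : eval (Quotient.out p).x (P ^ 2 + 4 * Q) =
        (2 * (Quotient.out p).y + eval (Quotient.out p).x P) ^ 2 := by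
      simp only [map_add, map_pow, map_mul, map_ofNat]
      linear_combination (-4) * h
    rw [this]
    positivity
  | _, cubic _ _, p => p.2
  | _, quadrics _ _ _ _, p => p.2

/-- Conversely, for `n = 2` a nonnegative discriminant gives a real `y` by the quadratic formula.
The factor `t` accounts for the arbitrary choice of representatives in `coords`. -/
theorem exists_coords_eq_smul : ∀ {n : ℕ} (Φ : GenusOneModel n) {x : Fin n → ℝ}, x ≠ 0 →
    x ∈ Φ.realCone → ∃ (p : Φ.RealPoint) (t : ℝ), t ≠ 0 ∧ Φ.coords p = t • x
  | _, quartic P Q _ _, x, hx, h => by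
    have h : 0 ≤ eval x (BinaryQuartic.F P Q) := h
    have hF : eval x (BinaryQuartic.F P Q) = eval x P ^ 2 + 4 * eval x Q := by
      simp [BinaryQuartic.F]
    let s : BinaryQuartic.Solution P Q :=
      { x := x
        y := (Real.sqrt (eval x (BinaryQuartic.F P Q)) - eval x P) / 2
        x_ne_zero := hx
        equation := by
          have := Real.sq_sqrt h
          linear_combination (1 / 4) * this + (1 / 4) * hF }
    obtain ⟨t, ht, h1, -⟩ := Setoid.symm (Quotient.mk_out s)
    exact ⟨Quotient.mk _ s, t, ht, h1⟩
  | _, cubic U hU, x, hx, h => by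
    have h : eval x U = 0 := h
    obtain ⟨a, ha⟩ := Projectivization.exists_smul_eq_mk_rep ℝ x hx
    refine ⟨⟨Projectivization.mk ℝ x hx, ?_⟩, a, a.ne_zero, ha.symm⟩
    rw [← ha, Units.smul_def, eval_smul_of_isHomogeneous hU, h, mul_zero]
  | _, quadrics Q₁ Q₂ h₁ h₂, x, hx, h => by
    have h : eval x Q₁ = 0 ∧ eval x Q₂ = 0 := h
    obtain ⟨a, ha⟩ := Projectivization.exists_smul_eq_mk_rep ℝ x hx
    refine ⟨⟨Projectivization.mk ℝ x hx, ?_⟩, a, a.ne_zero, ha.symm⟩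
    rw [← ha, Units.smul_def, eval_smul_of_isHomogeneous h₁, eval_smul_of_isHomogeneous h₂, h.1,
      h.2]
    simp

/-- The function on `ℝⁿ` that induces `ratio`. -/
noncomputable def ratioFun (Φ : GenusOneModel n) (r : ℝ) (x : Fin n → ℝ) : ℝ :=
  max |eval x Φ.F| |eval x (Φ.shifted r)| / ‖x‖ ^ (2 * n)

theorem ratioFun_smul (Φ : GenusOneModel n) (r : ℝ) {t : ℝ} (ht : t ≠ 0) (x : Fin n → ℝ) :
    Φ.ratioFun r (t • x) = Φ.ratioFun r x := by
  have h : (0 : ℝ) < |t| ^ (2 * n) := pow_pos (abs_pos.2 ht) _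
  rw [ratioFun, ratioFun, eval_smul_of_isHomogeneous Φ.isHomogeneous_F,
    eval_smul_of_isHomogeneous (Φ.isHomogeneous_shifted r), abs_mul, abs_mul, abs_pow,
    ← mul_max_of_nonneg _ _ h.le, norm_smul, Real.norm_eq_abs, mul_pow,
    mul_div_mul_left _ _ h.ne']

theorem exists_ratio_eq (Φ : GenusOneModel n) (r : ℝ) {x : Fin n → ℝ} (hx : x ≠ 0)
    (h : x ∈ Φ.realCone) : ∃ p, Φ.ratio r p = Φ.ratioFun r x := by
  obtain ⟨p, t, ht, hp⟩ := Φ.exists_coords_eq_smul hx h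
  exact ⟨p, by rw [← Φ.ratioFun_smul r ht, ← hp]; rfl⟩

/-- Scale invariance replaces the curve by the compact intersection of its cone with the unit
sphere, on which the ratio is continuous. -/
theorem exists_extremal (Φ : GenusOneModel n) (hne : Nonempty Φ.RealPoint) (r : ℝ) :
    (∃ p, ∀ q, Φ.ratio r q ≤ Φ.ratio r p) ∧ ∃ p, ∀ q, Φ.ratio r p ≤ Φ.ratio r q := by
  have hK : IsCompact (Φ.realCone ∩ Metric.sphere 0 1) :=
    (isCompact_sphere _ _).inter_left Φ.isClosed_realCone
  have hnormalize : ∀ q, ∃ x ∈ Φ.realCone ∩ Metric.sphere 0 1,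
      Φ.ratio r q = Φ.ratioFun r x := by
    intro q
    have h0 := norm_ne_zero_iff.2 (Φ.coords_ne_zero q)
    refine ⟨‖Φ.coords q‖⁻¹ • Φ.coords q,
      ⟨Φ.smul_mem_realCone _ (Φ.coords_mem_realCone q), ?_⟩, ?_⟩
    · rw [mem_sphere_zero_iff_norm, norm_smul, norm_inv, norm_norm, inv_mul_cancel₀ h0]
    · rw [Φ.ratioFun_smul r (inv_ne_zero h0)]; rfl
  have hKne : (Φ.realCone ∩ Metric.sphere 0 1).Nonempty :=
    let ⟨x, hx, _⟩ := hnormalize hne.some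
    ⟨x, hx⟩
  have hne0 : ∀ x ∈ Φ.realCone ∩ Metric.sphere 0 1, x ≠ 0 := fun x hx => by
    rw [← norm_ne_zero_iff, mem_sphere_zero_iff_norm.1 hx.2]
    exact one_ne_zero
  have hcont : ContinuousOn (Φ.ratioFun r) (Φ.realCone ∩ Metric.sphere 0 1) := by
    refine ContinuousOn.div ?_ (by fun_prop) fun x hx =>
      pow_ne_zero _ (norm_ne_zero_iff.2 (hne0 x hx))
    exact (((MvPolynomial.continuous_eval _).abs).max
      ((MvPolynomial.continuous_eval _).abs)).continuousOn
  constructor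
  · obtain ⟨x, hx, hmax⟩ := hK.exists_isMaxOn hKne hcont
    obtain ⟨p, hp⟩ := Φ.exists_ratio_eq r (hne0 x hx) hx.1
    refine ⟨p, fun q => ?_⟩
    obtain ⟨y, hy, hq⟩ := hnormalize q
    rw [hp, hq]
    exact hmax hy
  · obtain ⟨x, hx, hmin⟩ := hK.exists_isMinOn hKne hcont
    obtain ⟨p, hp⟩ := Φ.exists_ratio_eq r (hne0 x hx) hx.1
    refine ⟨p, fun q => ?_⟩
    obtain ⟨y, hy, hq⟩ := hnormalize q
    rw [hp, hq]
    exact hmin hy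

theorem mem_candidates_of_isLocalExtrOn (Φ : GenusOneModel n) (r : ℝ) (p : Φ.RealPoint)
    (hp : IsLocalExtrOn (Φ.ratioFun r) Φ.realCone (Φ.coords p)) : p ∈ Φ.candidates r := by
  by_contra hc
  simp only [candidates, Set.mem_ofPred_eq, not_or, not_exists, not_and] at hc
  obtain ⟨h1, h2, h3, h4⟩ := hc
  obtain ⟨i, φ, hφ, hext⟩ := exists_isLocalExtrOn_slice Φ.F (Φ.shifted r) (Φ.coords p)
    (Φ.coords_ne_zero p) h1 h2 Φ.realCone hp
  have hcrit : ¬ Φ.IsCritical φ (Φ.coords p) := by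
    rcases hφ with rfl | rfl
    exacts [h4.1, h4.2]
  apply hcrit
  cases Φ with
  | quartic P Q hP hQ =>
    have hmem := coords_mem_realCone _ p
    have h3 := h3 rfl
    set x := (quartic P Q hP hQ).coords p
    obtain ⟨j, hj⟩ : ∃ j : Fin 2, j ≠ i := exists_ne i
    -- Excluding `F₂ = 0` puts the point in the interior of the cone, so that the extremum is free
    -- on the slice.
    have hV : (quartic P Q hP hQ).realCone ∈ 𝓝 x := by
      have hpos : 0 < eval x (BinaryQuartic.F P Q) := lt_of_le_of_ne hmem (Ne.symm h3)
      filter_upwards [continuousAt_const.eventually_lt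
        (MvPolynomial.continuous_eval (BinaryQuartic.F P Q)).continuousAt hpos] with y hy
      exact hy.le
    have hext' : IsLocalExtrOn (fun y : Fin 2 → ℝ => eval y φ) {y | y i = x i} x := by
      have : 𝓝[{y | y i = x i ∧ y ∈ (quartic P Q hP hQ).realCone}] x = 𝓝[{y | y i = x i}] x :=
        nhdsWithin_inter_of_mem' (mem_nhdsWithin_of_mem_nhds hV)
      rw [IsLocalExtrOn, this] at hext
      exact hext
    have := eval_jacobianDet_eq_zero_of_isLocalExtrOn ![φ] x i ![j] (by simpa using hj)
      (by simpa using hext')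
    refine ⟨j, ?_⟩
    simpa [jacobianDet] using this
  | cubic U hU =>
    have hmem : eval (coords _ p) U = 0 := coords_mem_realCone _ p
    set x := (cubic U hU).coords p
    obtain ⟨j, k, hjk, hj, hk⟩ : ∃ j k : Fin 3, j ≠ k ∧ j ≠ i ∧ k ≠ i := by
      clear * -
      revert i; decide
    refine ⟨j, k, hjk, eval_jacobianDet_eq_zero_of_isLocalExtrOn ![U, φ] x i ![j, k]
      (by simp [Fin.forall_fin_two, hj, hk]) ?_⟩
    simpa [hmem, realCone] using hext
  | quadrics Q₁ Q₂ hQ₁ hQ₂ =>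
    have hmem : eval (coords _ p) Q₁ = 0 ∧ eval (coords _ p) Q₂ = 0 := coords_mem_realCone _ p
    set x := (quadrics Q₁ Q₂ hQ₁ hQ₂).coords p
    obtain ⟨j, k, l, hjk, hjl, hkl, hj, hk, hl⟩ : ∃ j k l : Fin 4, j ≠ k ∧ j ≠ l ∧ k ≠ l ∧
        j ≠ i ∧ k ≠ i ∧ l ≠ i := by
      clear * -
      revert i; decide
    refine ⟨j, k, l, hjk, hjl, hkl, eval_jacobianDet_eq_zero_of_isLocalExtrOn ![Q₁, Q₂, φ] x i
      ![j, k, l] (by simp [Fin.forall_fin_succ, hj, hk, hl]) ?_⟩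
    simpa [hmem, Fin.forall_fin_two, realCone] using hext

/-- The extremal values are taken at the candidates. -/
theorem exists_extremal_candidates (Φ : GenusOneModel n) (hne : Nonempty Φ.RealPoint) (r : ℝ) :
    (∃ p ∈ Φ.candidates r, ∀ q, Φ.ratio r q ≤ Φ.ratio r p) ∧
      ∃ p ∈ Φ.candidates r, ∀ q, Φ.ratio r p ≤ Φ.ratio r q := by
  have hev : ∀ p : Φ.RealPoint, ∀ᶠ y in 𝓝[Φ.realCone] (Φ.coords p),
      ∃ q, Φ.ratio r q = Φ.ratioFun r y := by
    intro p
    filter_upwards [mem_nhdsWithin_of_mem_nhds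
      (isOpen_ne.mem_nhds (Φ.coords_ne_zero p)), self_mem_nhdsWithin] with y hy0 hy
    exact Φ.exists_ratio_eq r hy0 hy
  obtain ⟨⟨p, hp⟩, p', hp'⟩ := Φ.exists_extremal hne r
  refine ⟨⟨p, Φ.mem_candidates_of_isLocalExtrOn r p (Or.inr ?_), hp⟩,
    p', Φ.mem_candidates_of_isLocalExtrOn r p' (Or.inl ?_), hp'⟩
  · filter_upwards [hev p] with y ⟨q, hq⟩
    rw [← hq]
    exact hp q
  · filter_upwards [hev p'] with y ⟨q, hq⟩
    rw [← hq]
    exact hp' q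

end GenusOneModel

/-! ### Explicit binary forms and dehomogenization. -/

/-- Euler's identity as a decomposition of a form of positive degree. -/
theorem exists_eq_sum_X_mul {n d : ℕ} {f : MvPolynomial (Fin n) ℝ} (hf : f.IsHomogeneous (d + 1)) :
    ∃ g : Fin n → MvPolynomial (Fin n) ℝ, (∀ i, (g i).IsHomogeneous d) ∧ f = ∑ i, X i * g i := by
  refine ⟨fun i => C ((d + 1 : ℝ)⁻¹) * pderiv i f, fun i => (hf.pderiv (i := i)).C_mul _, ?_⟩
  have h := hf.sum_X_mul_pderiv
  have hd : (d + 1 : ℝ) ≠ 0 := by positivity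
  calc f = C ((d + 1 : ℝ)⁻¹) * ((d + 1) • f) := by
        rw [nsmul_eq_mul, ← mul_assoc]
        have : ((d + 1 : ℕ) : MvPolynomial (Fin n) ℝ) = C (d + 1 : ℝ) := by simp
        rw [this, ← C_mul, inv_mul_cancel₀ hd, C_1, one_mul]
    _ = _ := by
        rw [← h, Finset.mul_sum]
        exact Finset.sum_congr rfl fun i _ => by ring

theorem exists_eq_C_of_isHomogeneous_zero {n : ℕ} {f : MvPolynomial (Fin n) ℝ}
    (hf : f.IsHomogeneous 0) : ∃ a, f = C a :=
  ⟨_, (totalDegree_eq_zero_iff_eq_C).1 ((totalDegree_zero_iff_isHomogeneous _).2 hf)⟩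

section BinaryForms

theorem binary_linear {f : MvPolynomial (Fin 2) ℝ} (hf : f.IsHomogeneous 1) :
    ∃ a b, f = C a * X 0 + C b * X 1 := by
  obtain ⟨g, hg, rfl⟩ := exists_eq_sum_X_mul (d := 0) hf
  choose c hc using fun i => exists_eq_C_of_isHomogeneous_zero (hg i)
  exact ⟨c 0, c 1, by simp [Fin.sum_univ_succ, hc]; ring⟩

theorem binary_quadratic {f : MvPolynomial (Fin 2) ℝ} (hf : f.IsHomogeneous 2) :
    ∃ a b c, f = C a * X 0 ^ 2 + C b * X 0 * X 1 + C c * X 1 ^ 2 := by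
  obtain ⟨g, hg, rfl⟩ := exists_eq_sum_X_mul (d := 1) hf
  choose a b h using fun i => binary_linear (hg i)
  exact ⟨a 0, b 0 + a 1, b 1, by simp [Fin.sum_univ_succ, h]; ring⟩

theorem binary_cubic {f : MvPolynomial (Fin 2) ℝ} (hf : f.IsHomogeneous 3) :
    ∃ a b c d, f = C a * X 0 ^ 3 + C b * X 0 ^ 2 * X 1 + C c * X 0 * X 1 ^ 2 + C d * X 1 ^ 3 := by
  obtain ⟨g, hg, rfl⟩ := exists_eq_sum_X_mul (d := 2) hf
  choose a b c h using fun i => binary_quadratic (hg i)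
  exact ⟨a 0, b 0 + a 1, c 0 + b 1, c 1, by simp [Fin.sum_univ_succ, h]; ring⟩

theorem binary_quartic {f : MvPolynomial (Fin 2) ℝ} (hf : f.IsHomogeneous 4) :
    ∃ a b c d e, f = C a * X 0 ^ 4 + C b * X 0 ^ 3 * X 1 + C c * X 0 ^ 2 * X 1 ^ 2 +
      C d * X 0 * X 1 ^ 3 + C e * X 1 ^ 4 := by
  obtain ⟨g, hg, rfl⟩ := exists_eq_sum_X_mul (d := 3) hf
  choose a b c d h using fun i => binary_cubic (hg i)
  exact ⟨a 0, b 0 + a 1, c 0 + b 1, d 0 + c 1, d 1, by simp [Fin.sum_univ_succ, h]; ring⟩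

theorem eval_aeval_X_one {K : Type*} [Field K] (d : MvPolynomial (Fin 2) K) (t : K) :
    Polynomial.eval t (aeval ![(Polynomial.X : Polynomial K), 1] d) = eval ![t, 1] d := by
  induction d using MvPolynomial.induction_on with
  | C a => simp
  | add p q hp hq => simp [hp, hq]
  | mul_X p i hp => fin_cases i <;> simp [hp]

/-- The dehomogenized form determines the form where `x₁ ≠ 0` (indices from `0`); multiplying by `X
1` makes the remaining points harmless. -/
theorem aeval_X_one_ne_zero {K : Type*} [Field K] [Infinite K] {d : MvPolynomial (Fin 2) K} {m : ℕ}
    (hd : d.IsHomogeneous m) (h0 : d ≠ 0) :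
    aeval ![(Polynomial.X : Polynomial K), 1] d ≠ 0 := by
  intro h
  have hz : ∀ t : K, eval ![t, 1] d = 0 := by
    intro t
    rw [← eval_aeval_X_one, h, Polynomial.eval_zero]
  have : X 1 * d = 0 := by
    apply MvPolynomial.funext
    intro x
    rw [map_mul, eval_X, map_zero, mul_eq_zero]
    by_cases h1 : x 1 = 0
    · exact Or.inl h1
    · right
      have : x = x 1 • ![x 0 / x 1, 1] := by
        ext i
        fin_cases i <;> simp [mul_div_cancel₀, h1]
      rw [this, eval_smul_of_isHomogeneous hd, hz, mul_zero]
  exact h0 ((mul_eq_zero.1 this).resolve_left (X_ne_zero _))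

end BinaryForms

/-! ### Finiteness for binary quartics. -/

/-- A quartic `g` such that `s g + κ h` is a multiple of the fourth power of a variable has a
multiple root. -/
theorem exists_double_root {a b c d e s κ : ℝ} (hsκ : s ≠ 0 ∨ κ ≠ 0)
    (h₄ : s * a + κ * (3 * b ^ 2 - 8 * a * c) = 0)
    (h₃ : s * b + κ * (4 * b * c - 24 * a * d) = 0)
    (h₂ : s * c + κ * (4 * c ^ 2 - 6 * b * d - 48 * a * e) = 0)
    (h₁ : s * d + κ * (4 * c * d - 24 * b * e) = 0) :
    ∃ x z : ℂ, (x ≠ 0 ∨ z ≠ 0) ∧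
      4 * a * x ^ 3 + 3 * b * x ^ 2 * z + 2 * c * x * z ^ 2 + d * z ^ 3 = 0 ∧
      b * x ^ 3 + 2 * c * x ^ 2 * z + 3 * d * x * z ^ 2 + 4 * e * z ^ 3 = 0 := by
  by_cases hκ : κ = 0
  · subst hκ
    have hs : s ≠ 0 := by simpa using hsκ
    simp only [zero_mul, add_zero, mul_eq_zero, hs, false_or] at h₁ h₂ h₃ h₄
    subst h₁ h₂ h₃ h₄
    exact ⟨1, 0, by simp, by simp, by simp⟩
  obtain ⟨t, rfl⟩ : ∃ t, s = t * κ := ⟨s / κ, by field_simp⟩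
  have h₄ : t * a + (3 * b ^ 2 - 8 * a * c) = 0 := mul_left_cancel₀ hκ (by linear_combination h₄)
  have h₃ : t * b + (4 * b * c - 24 * a * d) = 0 := mul_left_cancel₀ hκ (by linear_combination h₃)
  have h₂ : t * c + (4 * c ^ 2 - 6 * b * d - 48 * a * e) = 0 :=
    mul_left_cancel₀ hκ (by linear_combination h₂)
  -- If `a = 0` then `b = 0` too, and `z²` divides the quartic.
  by_cases ha : a = 0
  · subst ha
    have hb : b = 0 := by
      have : b ^ 2 = 0 := by linear_combination h₄ / 3
      exact pow_eq_zero_iff two_ne_zero |>.1 this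
    subst hb
    exact ⟨1, 0, by simp, by simp, by simp⟩
  -- These parameters match the first three coefficients with those of `a (x² + βxz + Kz²)²`. The
  -- equations then force `d` and `e` to agree as well, so the roots of the quadratic are multiple
  -- roots of the quartic.
  · obtain ⟨β, rfl⟩ : ∃ β, b = 2 * a * β := ⟨b / (2 * a), by field_simp⟩
    obtain ⟨K, rfl⟩ : ∃ K, c = a * (β ^ 2 + 2 * K) := ⟨(c / a - β ^ 2) / 2, by field_simp; ring⟩
    obtain rfl : t = 8 * (a * (β ^ 2 + 2 * K)) - 12 * a * β ^ 2 :=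
      mul_left_cancel₀ ha (by linear_combination h₄)
    obtain rfl : d = 2 * a * β * K := by
      apply mul_left_cancel₀ (mul_ne_zero (by norm_num : (-24 : ℝ) ≠ 0) ha)
      linear_combination h₃
    obtain rfl : e = a * K ^ 2 := by
      apply mul_left_cancel₀ (mul_ne_zero (by norm_num : (-48 : ℝ) ≠ 0) ha)
      linear_combination h₂
    obtain ⟨w, hw⟩ := IsAlgClosed.exists_pow_nat_eq ((β : ℂ) ^ 2 - 4 * K) (n := 2) (by norm_num)
    have hq : ((w - β) / 2) ^ 2 + β * ((w - β) / 2) + K = 0 := by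
      linear_combination hw / 4
    refine ⟨(w - β) / 2, 1, by simp, ?_, ?_⟩
    · push_cast
      linear_combination (2 * a * (2 * ((w - β) / 2) + β)) * hq
    · push_cast
      linear_combination (2 * a * (β * ((w - β) / 2) + 2 * K)) * hq

namespace BinaryQuartic

variable {P Q : MvPolynomial (Fin 2) ℝ}

/-- For a nonsingular model the quartic `g` has no multiple root. -/
theorem not_multiple_root {hP : P.IsHomogeneous 2} {hQ : Q.IsHomogeneous 4}
    (hΦ : (GenusOneModel.quartic P Q hP hQ).IsNonsingular) {x : Fin 2 → ℂ} (hx : x ≠ 0) :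
    ¬ ∀ i, aeval x (pderiv i (g P Q)) = 0 := by
  intro h
  have hpd : ∀ i, aeval x (pderiv i (g P Q)) =
      1 / 2 * aeval x P * aeval x (pderiv i P) + aeval x (pderiv i Q) := by
    intro i
    simp [g]
    ring
  have hg : aeval x (g P Q) = 0 := by
    have h1 := congrArg (aeval x) (isHomogeneous_g hP hQ).sum_X_mul_pderiv
    simpa [h] using h1
  have hg' : aeval x (g P Q) = 1 / 4 * aeval x P ^ 2 + aeval x Q := by
    simp [g]
  refine hΦ x (-(aeval x P) / 2) hx ?_ ⟨by ring, fun i => ?_⟩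
  · linear_combination hg' - hg
  · linear_combination hpd i - h i

theorem h_eq {a b c d e : ℝ} (hg : g P Q = C a * X 0 ^ 4 + C b * X 0 ^ 3 * X 1 +
      C c * X 0 ^ 2 * X 1 ^ 2 + C d * X 0 * X 1 ^ 3 + C e * X 1 ^ 4) :
    h P Q = C (3 * b ^ 2 - 8 * a * c) * X 0 ^ 4 + C (4 * b * c - 24 * a * d) * X 0 ^ 3 * X 1 +
      C (4 * c ^ 2 - 6 * b * d - 48 * a * e) * X 0 ^ 2 * X 1 ^ 2 +
      C (4 * c * d - 24 * b * e) * X 0 * X 1 ^ 3 + C (3 * d ^ 2 - 8 * c * e) * X 1 ^ 4 := by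
  apply MvPolynomial.funext
  intro x
  simp [h, hg, pderiv_X, -Nat.cast_ofNat]
  push_cast
  ring

/-- A quartic form killed by `∂/∂x_i` is a multiple of the fourth power of the other variable. As
the combination is one of `g` and `h`, `exists_double_root` then contradicts nonsingularity. -/
theorem pderiv_ne_zero {hP : P.IsHomogeneous 2} {hQ : Q.IsHomogeneous 4}
    (hΦ : (GenusOneModel.quartic P Q hP hQ).IsNonsingular) {s κ : ℝ} (hsκ : s ≠ 0 ∨ κ ≠ 0)
    (i : Fin 2) : pderiv i (C s * F P Q + C κ * G P Q) ≠ 0 := by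
  intro h0
  obtain ⟨a, b, c, d, e, hg⟩ := binary_quartic (isHomogeneous_g hP hQ)
  have hh := h_eq hg
  have hφ : C s * F P Q + C κ * G P Q =
      C (4 * s - κ / 3 * b₂ P Q) * g P Q + C (κ / 3) * h P Q := by
    apply MvPolynomial.funext
    intro x
    simp [F, G, g]
    ring
  have hsκ' : 4 * s - κ / 3 * b₂ P Q ≠ 0 ∨ κ / 3 ≠ 0 := by
    by_contra hcon
    push Not at hcon
    have hκ : κ = 0 := by linarith [hcon.2]
    have hs := hcon.1
    rw [hκ] at hs
    have : s = 0 := by linarith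
    rcases hsκ with h | h
    exacts [h this, h hκ]
  rw [hφ, hg, hh] at h0
  generalize 4 * s - κ / 3 * b₂ P Q = s' at *
  generalize κ / 3 = κ' at *
  have key : ∀ x : Fin 2 → ℝ, _ := fun x => congrArg (eval x) h0
  have hroot : ∃ x z : ℂ, (x ≠ 0 ∨ z ≠ 0) ∧
      4 * a * x ^ 3 + 3 * b * x ^ 2 * z + 2 * c * x * z ^ 2 + d * z ^ 3 = 0 ∧
      b * x ^ 3 + 2 * c * x ^ 2 * z + 3 * d * x * z ^ 2 + 4 * e * z ^ 3 = 0 := by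
    fin_cases i
    · simp [pderiv_X] at key
      -- The derivative is a binary cubic; its values at a few points give linear equations that
      -- make its four coefficients vanish.
      have e1 := key ![1, 0]
      have e2 := key ![0, 1]
      have e3 := key ![1, 1]
      have e4 := key ![-1, 1]
      have e5 := key ![2, 1]
      simp at e1 e2 e3 e4 e5
      exact exists_double_root hsκ' (by linarith) (by linarith) (by linarith) (by linarith)
    · simp [pderiv_X] at key
      have e1 := key ![1, 0]
      have e2 := key ![0, 1]
      have e3 := key ![1, 1]
      have e4 := key ![-1, 1]
      have e5 := key ![2, 1]
      simp at e1 e2 e3 e4 e5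
      -- Exchanging the variables reverses the coefficients of `g` and `h`.
      obtain ⟨x, z, h1, h2, h3⟩ := exists_double_root (a := e) (b := d) (c := c) (d := b) (e := a)
        hsκ' (by linarith) (by linarith) (by linarith) (by linarith)
      exact ⟨z, x, h1.symm, by linear_combination h3, by linear_combination h2⟩
  obtain ⟨x, z, hne, h1, h2⟩ := hroot
  refine not_multiple_root hΦ (x := ![x, z]) ?_ fun j => ?_
  · intro hxz
    have hx := congrFun hxz 0
    have hz := congrFun hxz 1
    simp at hx hz
    simp [hx, hz] at hne
  · rw [hg]
    fin_cases j
    · simp [pderiv_X]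
      linear_combination h1
    · simp [pderiv_X]
      linear_combination h2

theorem form_ne_zero {hP : P.IsHomogeneous 2} {hQ : Q.IsHomogeneous 4}
    (hΦ : (GenusOneModel.quartic P Q hP hQ).IsNonsingular) {s κ : ℝ} (hsκ : s ≠ 0 ∨ κ ≠ 0) :
    C s * F P Q + C κ * G P Q ≠ 0 := fun h =>
  pderiv_ne_zero hΦ hsκ 0 (by rw [h, map_zero])

/-- A nonzero form vanishes at only finitely many real points. -/
theorem finite_setOf_eval_eq_zero {hP : P.IsHomogeneous 2} {hQ : Q.IsHomogeneous 4}
    {d : MvPolynomial (Fin 2) ℝ} {m : ℕ} (hd : d.IsHomogeneous m) (h0 : d ≠ 0) :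
    {p : (GenusOneModel.quartic P Q hP hQ).RealPoint |
      eval (GenusOneModel.coords _ p) d = 0}.Finite := by
  -- Normalized representatives `(1, 0)` and `(t, 1)` of the zeros; `(1, 0)` is included whether or
  -- not it is a zero.
  set A : Set (Fin 2 → ℝ) :=
    insert ![1, 0] ((fun t => ![t, 1]) '' {t : ℝ | eval ![t, 1] d = 0}) with hA
  have hfinA : A.Finite := by
    refine Set.Finite.insert _ (Set.Finite.image _ ?_)
    refine ((aeval ![(Polynomial.X : Polynomial ℝ), 1] d).roots.toFinset.finite_toSet).subset ?_
    intro t ht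
    simp only [Finset.mem_coe, Multiset.mem_toFinset,
      Polynomial.mem_roots (aeval_X_one_ne_zero hd h0), Polynomial.IsRoot]
    rw [eval_aeval_X_one]
    exact ht
  have hfinB : {s : Solution P Q | s.x ∈ A}.Finite := by
    have : (⋃ x ∈ A, (fun y => (x, y)) '' {y : ℝ | y ^ 2 + eval x P * y = eval x Q}).Finite := by
      refine hfinA.biUnion fun x _ => Set.Finite.image _ ?_
      have hp : (Polynomial.X ^ 2 + Polynomial.C (eval x P) * Polynomial.X -
          Polynomial.C (eval x Q)).Monic := by monicity!
      refine ((Polynomial.X ^ 2 + Polynomial.C (eval x P) * Polynomial.X -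
          Polynomial.C (eval x Q)).roots.toFinset.finite_toSet).subset fun y hy => ?_
      have hy : y ^ 2 + eval x P * y = eval x Q := hy
      simp [Polynomial.mem_roots hp.ne_zero, hy]
    refine Set.Finite.of_finite_image (f := fun s : Solution P Q => (s.x, s.y))
      (this.subset ?_) ?_
    · rintro _ ⟨s, hs, rfl⟩
      exact Set.mem_biUnion hs ⟨s.y, s.equation, rfl⟩
    · intro s _ s' _ h
      cases s
      cases s'
      simpa using h
  refine (hfinB.image (Quotient.mk (scaling P Q))).subset fun p hp => ?_
  have hp : eval (Quotient.out p).x d = 0 := hp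
  rw [← Quotient.out_eq p]
  have key : ∀ s : Solution P Q, eval s.x d = 0 →
      Quotient.mk (scaling P Q) s ∈ Quotient.mk (scaling P Q) '' {s | s.x ∈ A} := by
    intro s hs
    obtain ⟨t, ht, hA'⟩ : ∃ t : ℝ, t ≠ 0 ∧ t • s.x ∈ A := by
      by_cases h1 : s.x 1 = 0
      · have h2 : s.x 0 ≠ 0 := fun h2 => s.x_ne_zero (by ext i; fin_cases i <;> simp [h1, h2])
        refine ⟨(s.x 0)⁻¹, inv_ne_zero h2, Or.inl ?_⟩
        ext i; fin_cases i <;> simp [h1, h2]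
      · have hv : (s.x 1)⁻¹ • s.x = ![(s.x 1)⁻¹ * s.x 0, 1] := by
          ext i; fin_cases i <;> simp [h1]
        refine ⟨(s.x 1)⁻¹, inv_ne_zero h1, Or.inr ⟨(s.x 1)⁻¹ * s.x 0, ?_, hv.symm⟩⟩
        change eval _ d = 0
        rw [← hv, eval_smul_of_isHomogeneous hd, hs, mul_zero]
    refine ⟨⟨t • s.x, t ^ 2 * s.y, smul_ne_zero ht s.x_ne_zero, ?_⟩, hA', Quotient.sound ?_⟩
    · rw [eval_smul_of_isHomogeneous hP, eval_smul_of_isHomogeneous hQ, ← s.equation]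
      ring
    · exact Setoid.symm ⟨t, ht, rfl, rfl⟩
  exact key _ hp

/-- Every condition is the vanishing of a nonzero form: `x_i ± x_j`, the combinations `(1 - r)F - G`
and `(1 + r)F + G`, `F` itself, or a partial derivative of `F` or `rF + G`. -/
theorem finite_candidates (hP : P.IsHomogeneous 2) (hQ : Q.IsHomogeneous 4)
    (hΦ : (GenusOneModel.quartic P Q hP hQ).IsNonsingular) (r : ℝ) :
    ((GenusOneModel.quartic P Q hP hQ).candidates r).Finite := by
  have hform : ∀ s κ : ℝ, (C s * F P Q + C κ * G P Q).IsHomogeneous 4 := fun s κ =>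
    ((isHomogeneous_F hP hQ).C_mul s).add ((isHomogeneous_G hP hQ).C_mul κ)
  have hlin : ∀ (i j : Fin 2) (c : ℝ), i ≠ j → (X i + C c * X j : MvPolynomial (Fin 2) ℝ) ≠ 0 := by
    intro i j c hij h
    have := congrArg (eval (Pi.single i 1)) h
    simp [hij.symm] at this
  have hlin' : ∀ (i j : Fin 2) (c : ℝ), (X i + C c * X j : MvPolynomial (Fin 2) ℝ).IsHomogeneous 1 :=
    fun i j c => (isHomogeneous_X _ _).add (isHomogeneous_C_mul_X _ _)
  have hfin := fun {d : MvPolynomial (Fin 2) ℝ} {m : ℕ} (hd : d.IsHomogeneous m) (h0 : d ≠ 0) =>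
    finite_setOf_eval_eq_zero (hP := hP) (hQ := hQ) hd h0
  have hF : F P Q = C 1 * F P Q + C 0 * G P Q := by simp
  have hS : C r * F P Q + G P Q = C r * F P Q + C 1 * G P Q := by simp
  refine Set.Finite.subset (((Set.finite_iUnion fun i : Fin 2 => Set.finite_iUnion fun j : Fin 2 =>
    Set.Finite.union (s := {p | i ≠ j ∧ eval (GenusOneModel.coords _ p) (X i + C (-1) * X j) = 0})
      (t := {p | i ≠ j ∧ eval (GenusOneModel.coords _ p) (X i + C 1 * X j) = 0}) ?_ ?_).union
    (((hfin (hform (1 - r) (-1)) (form_ne_zero hΦ (by simp)))).union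
    (hfin (hform (1 + r) 1) (form_ne_zero hΦ (by simp))))).union
    ((hfin (hform 1 0) (form_ne_zero hΦ (by simp))).union
    ((Set.finite_iUnion fun i => hfin ((hform 1 0).pderiv (i := i))
      (pderiv_ne_zero hΦ (by simp) i)).union
    (Set.finite_iUnion fun i => hfin ((hform r 1).pderiv (i := i))
      (pderiv_ne_zero hΦ (by simp) i))))) ?_
  · by_cases hij : i = j
    · simp [hij]
    · simpa only [ne_eq, hij, not_false_eq_true, true_and] using hfin (hlin' i j (-1)) (hlin i j _ hij)
  · by_cases hij : i = j
    · simp [hij]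
    · simpa only [ne_eq, hij, not_false_eq_true, true_and] using hfin (hlin' i j 1) (hlin i j _ hij)
  · rintro p (⟨i, j, hij, h | h⟩ | (h | h) | ⟨-, h⟩ | ⟨i, h⟩ | ⟨i, h⟩)
    · refine Or.inl (Or.inl (Set.mem_iUnion₂.2 ⟨i, j, Or.inl ⟨hij, ?_⟩⟩))
      simp [h]
    · refine Or.inl (Or.inl (Set.mem_iUnion₂.2 ⟨i, j, Or.inr ⟨hij, ?_⟩⟩))
      simp [h]
    · refine Or.inl (Or.inr (Or.inl ?_))
      simp [GenusOneModel.F, GenusOneModel.G, GenusOneModel.shifted] at h ⊢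
      linear_combination h
    · refine Or.inl (Or.inr (Or.inr ?_))
      simp [GenusOneModel.F, GenusOneModel.G, GenusOneModel.shifted] at h ⊢
      linear_combination h
    · refine Or.inr (Or.inl ?_)
      rw [← hF]; exact h
    · refine Or.inr (Or.inr (Or.inl (Set.mem_iUnion.2 ⟨i, ?_⟩)))
      rw [← hF]; exact h
    · refine Or.inr (Or.inr (Or.inr (Set.mem_iUnion.2 ⟨i, ?_⟩)))
      rw [← hS]; exact h

end BinaryQuartic

/-! ### A finiteness criterion for real projective points. -/

/-- Real points whose complexified coordinates are multiples of finitely many vectors form a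
finite set. -/
theorem finite_of_rep_eq_smul {n : ℕ} (S : Set (Projectivization ℝ (Fin n → ℝ)))
    (Y : Set (Fin n → ℂ)) (hY : Y.Finite)
    (h : ∀ p ∈ S, ∃ y ∈ Y, ∃ c : ℂ, (fun i => (p.rep i : ℂ)) = c • y) : S.Finite := by
  choose! y hy c hc using h
  refine Set.Finite.of_finite_image (f := y) (hY.subset ?_) ?_
  · rintro _ ⟨p, hp, rfl⟩
    exact hy p hp
  · intro p hp q hq hpq
    have hp' := hc p hp
    have hq' := hc q hq
    change y p = y q at hpq
    rw [← hpq] at hq'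
    obtain ⟨i, hi⟩ : ∃ i, p.rep i ≠ 0 := by
      by_contra hcon
      push Not at hcon
      exact p.rep_nonzero (funext hcon)
    have hcp : c p ≠ 0 := by
      intro h0
      have := congrFun hp' i
      simp [h0] at this
      exact hi this
    have key : ∀ j, (q.rep j : ℂ) * p.rep i = q.rep i * p.rep j := by
      intro j
      have e1 := congrFun hp' i
      have e2 := congrFun hp' j
      have e3 := congrFun hq' i
      have e4 := congrFun hq' j
      simp only [Pi.smul_apply, smul_eq_mul] at e1 e2 e3 e4
      rw [e1, e2, e3, e4]
      ring
    have key' : ∀ j, q.rep j * p.rep i = q.rep i * p.rep j := fun j => by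
      have := key j
      exact_mod_cast this
    rw [← p.mk_rep, ← q.mk_rep, Projectivization.mk_eq_mk_iff']
    have hqi : q.rep i ≠ 0 := by
      intro h0
      apply q.rep_nonzero
      ext j
      have := key' j
      rw [h0, zero_mul] at this
      simpa [hi] using this
    refine ⟨p.rep i / q.rep i, ?_⟩
    ext j
    have := key' j
    simp only [Pi.smul_apply, smul_eq_mul]
    field_simp
    linear_combination this

/-! ### Linear independence of square roots of linear polynomials. -/

section SquareRoots

/-- If `B` were nonzero, `θ` would be a root of even multiplicity on the left and of odd
multiplicity on the right. -/
theorem eq_zero_of_sq_eq_sq_mul {A B v : Polynomial ℂ} {θ : ℂ} (hv : v.eval θ ≠ 0)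
    (h : A ^ 2 = B ^ 2 * ((Polynomial.X - Polynomial.C θ) * v)) : B = 0 := by
  by_contra hB
  have hv0 : v ≠ 0 := fun h0 => by simp [h0] at hv
  have hX : (Polynomial.X - Polynomial.C θ : Polynomial ℂ) ≠ 0 := Polynomial.X_sub_C_ne_zero θ
  have hA : A ≠ 0 := by
    rintro rfl
    rw [zero_pow two_ne_zero, eq_comm] at h
    simp [hB, hv0, hX] at h
  have h1 := congrArg (Polynomial.rootMultiplicity θ) h
  rw [Polynomial.rootMultiplicity_mul (by simp [hB, hv0, hX]),
    Polynomial.rootMultiplicity_mul (by simp [hv0, hX]), Polynomial.rootMultiplicity_X_sub_C_self,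
    Polynomial.rootMultiplicity_eq_zero hv, pow_two, pow_two,
    Polynomial.rootMultiplicity_mul (by simp [hA]),
    Polynomial.rootMultiplicity_mul (by simp [hB])] at h1
  omega

/-- Square roots, on an infinite set of parameters, of four linear polynomials of which no two are
proportional. -/
structure SquareRoots where
  α : Fin 4 → ℂ
  β : Fin 4 → ℂ
  indep : ∀ i j, i ≠ j → α i * β j - α j * β i ≠ 0
  Z : Set ℂ
  infinite : Z.Infinite
  y : Fin 4 → ℂ → ℂ
  sq : ∀ i, ∀ t ∈ Z, y i t ^ 2 = α i * t + β i

namespace SquareRoots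

variable (R : SquareRoots)

/-- The linear polynomial whose square root is taken. -/
noncomputable def s (i : Fin 4) : Polynomial ℂ := Polynomial.C (R.α i) * Polynomial.X + Polynomial.C (R.β i)

theorem sq' (i : Fin 4) {t : ℂ} (ht : t ∈ R.Z) : R.y i t ^ 2 = (R.s i).eval t := by
  rw [R.sq i t ht]
  simp [s]

theorem s_eq {i : Fin 4} (hi : R.α i ≠ 0) :
    R.s i = (Polynomial.X - Polynomial.C (-R.β i / R.α i)) * Polynomial.C (R.α i) := by
  have : Polynomial.C (R.β i) = Polynomial.C (R.β i / R.α i) * Polynomial.C (R.α i) := by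
    rw [← Polynomial.C_mul, div_mul_cancel₀ _ hi]
  rw [s, neg_div, Polynomial.C_neg, this]
  ring

theorem eval_s_ne_zero {i j : Fin 4} (hij : i ≠ j) (hi : R.α i ≠ 0) :
    (R.s j).eval (-R.β i / R.α i) ≠ 0 := by
  have := R.indep i j hij
  contrapose! this
  simp only [s, Polynomial.eval_add, Polynomial.eval_mul, Polynomial.eval_C, Polynomial.eval_X] at this
  field_simp at this
  linear_combination this

/-- At most one of the linear polynomials is constant; the root of a nonconstant one is a simple
root of the product. The case of four factors below is the same. -/
theorem eq_zero_of_sq_eq_mul_two {i j : Fin 4} (hij : i ≠ j) {A B : Polynomial ℂ}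
    (h : A ^ 2 = B ^ 2 * (R.s i * R.s j)) : B = 0 := by
  by_cases hi : R.α i = 0
  · have hj : R.α j ≠ 0 := by
      intro hj
      exact R.indep i j hij (by simp [hi, hj])
    refine eq_zero_of_sq_eq_sq_mul (A := A) (v := Polynomial.C (R.α j) * R.s i)
      (θ := -R.β j / R.α j) ?_ ?_
    · simp [hj, R.eval_s_ne_zero hij.symm hj]
    · rw [h, R.s_eq hj]; ring
  · refine eq_zero_of_sq_eq_sq_mul (A := A) (v := Polynomial.C (R.α i) * R.s j)
      (θ := -R.β i / R.α i) ?_ ?_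
    · simp [hi, R.eval_s_ne_zero hij hi]
    · rw [h, R.s_eq hi]; ring

theorem eq_zero_of_sq_eq_mul_four {A B : Polynomial ℂ}
    (h : A ^ 2 = B ^ 2 * (R.s 0 * R.s 1 * R.s 2 * R.s 3)) : B = 0 := by
  by_cases h0 : R.α 0 = 0
  · have h1 : R.α 1 ≠ 0 := by
      intro h1
      exact R.indep 0 1 (by decide) (by simp [h0, h1])
    refine eq_zero_of_sq_eq_sq_mul (A := A) (v := Polynomial.C (R.α 1) * (R.s 0 * R.s 2 * R.s 3))
      (θ := -R.β 1 / R.α 1) ?_ ?_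
    · simp only [Polynomial.eval_mul, Polynomial.eval_C]
      exact mul_ne_zero h1 (mul_ne_zero (mul_ne_zero (R.eval_s_ne_zero (by decide) h1)
        (R.eval_s_ne_zero (by decide) h1)) (R.eval_s_ne_zero (by decide) h1))
    · rw [h, R.s_eq h1]; ring
  · refine eq_zero_of_sq_eq_sq_mul (A := A) (v := Polynomial.C (R.α 0) * (R.s 1 * R.s 2 * R.s 3))
      (θ := -R.β 0 / R.α 0) ?_ ?_
    · simp only [Polynomial.eval_mul, Polynomial.eval_C]
      exact mul_ne_zero h0 (mul_ne_zero (mul_ne_zero (R.eval_s_ne_zero (by decide) h0)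
        (R.eval_s_ne_zero (by decide) h0)) (R.eval_s_ne_zero (by decide) h0))
    · rw [h, R.s_eq h0]; ring

theorem eq_of_eval_eq {A B : Polynomial ℂ} (h : ∀ t ∈ R.Z, A.eval t = B.eval t) : A = B :=
  Polynomial.eq_of_infinite_eval_eq A B (R.infinite.mono h)

/-- Multiplying by the conjugate expression gives `p² s_i = q² s_j`, so `s_i s_j` would be a square
up to square factors. -/
theorem linear_two {i j : Fin 4} (hij : i ≠ j) {p q : Polynomial ℂ}
    (h : ∀ t ∈ R.Z, p.eval t * R.y i t + q.eval t * R.y j t = 0) : p = 0 ∧ q = 0 := by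
  have h1 : p ^ 2 * R.s i = q ^ 2 * R.s j := R.eq_of_eval_eq fun t ht => by
    simp only [Polynomial.eval_mul, Polynomial.eval_pow, ← R.sq' _ ht]
    linear_combination (p.eval t * R.y i t - q.eval t * R.y j t) * h t ht
  constructor
  · refine R.eq_zero_of_sq_eq_mul_two hij (A := q * R.s j) ?_
    linear_combination (-R.s j) * h1
  · refine R.eq_zero_of_sq_eq_mul_two hij (A := p * R.s i) ?_
    linear_combination R.s i * h1

theorem linear_three {i j k : Fin 4} (hij : i ≠ j) (hik : i ≠ k) (hjk : j ≠ k) {p q r : Polynomial ℂ}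
    (h : ∀ t ∈ R.Z, p.eval t * R.y i t + q.eval t * R.y j t + r.eval t * R.y k t = 0) :
    p = 0 ∧ q = 0 ∧ r = 0 := by
  -- Squaring `r y_k = -(p y_i + q y_j)` leaves `2pq y_i y_j` as the only irrational term; squaring
  -- once more removes it.
  have h1 : (p ^ 2 * R.s i + q ^ 2 * R.s j - r ^ 2 * R.s k) ^ 2 =
      (2 * (p * q)) ^ 2 * (R.s i * R.s j) := R.eq_of_eval_eq fun t ht => by
    simp only [Polynomial.eval_mul, Polynomial.eval_pow, Polynomial.eval_add, Polynomial.eval_sub, ← R.sq' _ ht, Polynomial.eval_ofNat]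
    have e : r.eval t * R.y k t = -(p.eval t * R.y i t + q.eval t * R.y j t) := by
      linear_combination h t ht
    have e' : r.eval t ^ 2 * R.y k t ^ 2 = (p.eval t * R.y i t + q.eval t * R.y j t) ^ 2 := by
      rw [← mul_pow, e]; ring
    rw [e']
    ring
  have h2 := R.eq_zero_of_sq_eq_mul_two hij h1
  rcases mul_eq_zero.1 ((mul_eq_zero.1 h2).resolve_left two_ne_zero) with rfl | rfl
  · obtain ⟨hq, hr⟩ := R.linear_two hjk (p := q) (q := r) fun t ht => by simpa using h t ht
    exact ⟨rfl, hq, hr⟩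
  · obtain ⟨hp, hr⟩ := R.linear_two hik (p := p) (q := r) fun t ht => by simpa using h t ht
    exact ⟨hp, rfl, hr⟩

/-- The square roots are linearly independent over the polynomials. -/
theorem linear_four {p : Fin 4 → Polynomial ℂ}
    (h : ∀ t ∈ R.Z, ∑ i, (p i).eval t * R.y i t = 0) : p = 0 := by
  have h' : ∀ t ∈ R.Z, (p 0).eval t * R.y 0 t + (p 1).eval t * R.y 1 t +
      (p 2).eval t * R.y 2 t + (p 3).eval t * R.y 3 t = 0 := fun t ht => by
    simpa [Fin.sum_univ_four] using h t ht
  -- With `z_i = p_i y_i`, squaring `z_0 + z_1 = -(z_2 + z_3)` gives `z_0² + z_1² - z_2² - z_3² =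
  -- 2(z_2 z_3 - z_0 z_1)`. The square of this has only `-8 z_0 z_1 z_2 z_3` as irrational term, and
  -- a last squaring leaves a polynomial identity.
  have h1 : ((p 0 ^ 2 * R.s 0 + p 1 ^ 2 * R.s 1 - p 2 ^ 2 * R.s 2 - p 3 ^ 2 * R.s 3) ^ 2
      - 4 * (p 0 ^ 2 * R.s 0 * (p 1 ^ 2 * R.s 1)) - 4 * (p 2 ^ 2 * R.s 2 * (p 3 ^ 2 * R.s 3))) ^ 2 =
      (8 * (p 0 * p 1 * p 2 * p 3)) ^ 2 * (R.s 0 * R.s 1 * R.s 2 * R.s 3) :=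
    R.eq_of_eval_eq fun t ht => by
      simp only [Polynomial.eval_mul, Polynomial.eval_pow, Polynomial.eval_add, Polynomial.eval_sub, ← R.sq' _ ht, Polynomial.eval_ofNat]
      have e : (p 3).eval t * R.y 3 t = -((p 0).eval t * R.y 0 t + (p 1).eval t * R.y 1 t +
          (p 2).eval t * R.y 2 t) := by
        linear_combination h' t ht
      have e' : (p 3).eval t ^ 2 * R.y 3 t ^ 2 = ((p 0).eval t * R.y 0 t + (p 1).eval t * R.y 1 t +
          (p 2).eval t * R.y 2 t) ^ 2 := by
        rw [← mul_pow, e]; ring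
      have e'' : (8 * ((p 0).eval t * (p 1).eval t * (p 2).eval t * (p 3).eval t)) ^ 2 *
          (R.y 0 t ^ 2 * R.y 1 t ^ 2 * R.y 2 t ^ 2 * R.y 3 t ^ 2) =
          64 * ((p 0).eval t ^ 2 * R.y 0 t ^ 2) * ((p 1).eval t ^ 2 * R.y 1 t ^ 2) *
          ((p 2).eval t ^ 2 * R.y 2 t ^ 2) * ((p 3).eval t ^ 2 * R.y 3 t ^ 2) := by ring
      rw [e'', e']
      ring
  have h2 := R.eq_zero_of_sq_eq_mul_four h1
  have h3 := (mul_eq_zero.1 h2).resolve_left (by norm_num)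
  simp only [mul_eq_zero] at h3
  ext1 i
  rcases h3 with ((h0 | h0) | h0) | h0
  · obtain ⟨e1, e2, e3⟩ := R.linear_three (i := 1) (j := 2) (k := 3) (by decide) (by decide)
      (by decide) (p := p 1) (q := p 2) (r := p 3) fun t ht => by simpa [h0] using h' t ht
    fin_cases i <;> assumption
  · obtain ⟨e1, e2, e3⟩ := R.linear_three (i := 0) (j := 2) (k := 3) (by decide) (by decide)
      (by decide) (p := p 0) (q := p 2) (r := p 3) fun t ht => by simpa [h0] using h' t ht
    fin_cases i <;> assumption
  · obtain ⟨e1, e2, e3⟩ := R.linear_three (i := 0) (j := 1) (k := 3) (by decide) (by decide)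
      (by decide) (p := p 0) (q := p 1) (r := p 3) fun t ht => by simpa [h0] using h' t ht
    fin_cases i <;> assumption
  · obtain ⟨e1, e2, e3⟩ := R.linear_three (i := 0) (j := 1) (k := 2) (by decide) (by decide)
      (by decide) (p := p 0) (q := p 1) (r := p 2) fun t ht => by simpa [h0] using h' t ht
    fin_cases i <;> assumption

end SquareRoots

/-- On an infinite set of such `t`, a choice of roots would contradict their linear independence.
The branches of the roots may be chosen arbitrarily at each `t`. -/
theorem finite_setOf_sum_mul_sqrt_eq_zero {α β : Fin 4 → ℂ}
    (hαβ : ∀ i j, i ≠ j → α i * β j - α j * β i ≠ 0) {p : Fin 4 → Polynomial ℂ} (hp : p ≠ 0) :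
    {t : ℂ | ∃ y : Fin 4 → ℂ, (∀ i, y i ^ 2 = α i * t + β i) ∧
      ∑ i, (p i).eval t * y i = 0}.Finite := by
  by_contra hinf
  have hmem : ∀ t ∈ {t : ℂ | ∃ y : Fin 4 → ℂ, (∀ i, y i ^ 2 = α i * t + β i) ∧
      ∑ i, (p i).eval t * y i = 0}, ∃ y : Fin 4 → ℂ, (∀ i, y i ^ 2 = α i * t + β i) ∧
      ∑ i, (p i).eval t * y i = 0 := fun t ht => ht
  choose! y hy hy' using hmem
  let R : SquareRoots :=
    { α := α, β := β, indep := hαβ, Z := _, infinite := hinf, y := fun i t => y t i,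
      sq := fun i t ht => hy t ht i }
  exact hp (R.linear_four fun t ht => hy' t ht)

end SquareRoots

/-! ### Simultaneous diagonalization of two quadratic forms. -/

section Diagonalization

open Matrix

variable {n : ℕ} {A B : Matrix (Fin n) (Fin n) ℂ}

theorem dotProduct_mulVec_comm_of_isSymm (hA : A.IsSymm) (v w : Fin n → ℂ) :
    v ⬝ᵥ A *ᵥ w = w ⬝ᵥ A *ᵥ v := by
  rw [dotProduct_mulVec, ← mulVec_transpose, hA.eq, dotProduct_comm]

/-- A pencil of quadrics with smooth base locus contains a nondegenerate quadric. -/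
theorem exists_det_add_smul_ne_zero (hA : A.IsSymm)
    (hns : ∀ v : Fin n → ℂ, v ≠ 0 → v ⬝ᵥ A *ᵥ v = 0 → v ⬝ᵥ B *ᵥ v = 0 →
      ∀ s t : ℂ, s • A *ᵥ v + t • B *ᵥ v = 0 → s = 0 ∧ t = 0) :
    ∃ t : ℂ, (A + t • B).det ≠ 0 := by
  by_contra hcon
  push Not at hcon
  set M : Matrix (Fin n) (Fin n) (Polynomial ℂ) :=
    A.map Polynomial.C + (Polynomial.X : Polynomial ℂ) • B.map Polynomial.C with hM
  have hdet : M.det = 0 := by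
    apply Polynomial.funext
    intro t
    rw [Polynomial.eval_zero, ← hcon t, ← Polynomial.coe_evalRingHom, RingHom.map_det]
    congr 1
    ext i j
    simp [hM]
    ring
  -- A pencil that is degenerate throughout has a polynomial kernel vector `v = ∑ w_k X^k`. Its
  -- lowest nonzero coefficient is in the kernel of `A`, and `B w_m = -A w_{m+1}` makes it isotropic
  -- for `B`: it is a singular point of the base locus.
  obtain ⟨v, hv0, hv⟩ := Matrix.exists_mulVec_eq_zero_iff.2 hdet
  let w : ℕ → Fin n → ℂ := fun k i => (v i).coeff k
  have hex : ∃ k, w k ≠ 0 := by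
    by_contra h
    push Not at h
    apply hv0
    ext i k
    exact congrFun (h k) i
  have hrow : ∀ i, ∑ j, (Polynomial.C (A i j) * v j + Polynomial.X * (Polynomial.C (B i j) * v j))
      = 0 := by
    intro i
    calc _ = (M *ᵥ v) i := by
          simp only [hM, mulVec, dotProduct, Matrix.add_apply, Matrix.smul_apply, Matrix.map_apply,
            smul_eq_mul]
          exact Finset.sum_congr rfl fun j _ => by ring
      _ = 0 := by rw [hv]; rfl
  have hzero : A *ᵥ w 0 = 0 := by
    ext i
    have := congrArg (fun p => Polynomial.coeff p 0) (hrow i)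
    simpa [Polynomial.finsetSum_coeff, mulVec, dotProduct, w] using this
  have hsucc : ∀ k, A *ᵥ w (k + 1) + B *ᵥ w k = 0 := by
    intro k
    ext i
    have := congrArg (fun p => Polynomial.coeff p (k + 1)) (hrow i)
    simpa [Polynomial.finsetSum_coeff, mulVec, dotProduct, w, Finset.sum_add_distrib] using this
  classical
  have hm := Nat.find_spec hex
  have hlt : ∀ k, k < Nat.find hex → w k = 0 := fun k hk => not_not.1 (Nat.find_min hex hk)
  generalize Nat.find hex = m at hm hlt
  have hAm : A *ᵥ w m = 0 := by
    cases m with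
    | zero => exact hzero
    | succ k => simpa [hlt k (Nat.lt_succ_self k)] using hsucc k
  have hBm : w m ⬝ᵥ B *ᵥ w m = 0 := by
    have h1 : B *ᵥ w m = -(A *ᵥ w (m + 1)) := by
      rw [eq_neg_iff_add_eq_zero, add_comm]; exact hsucc m
    rw [h1, dotProduct_neg, dotProduct_mulVec_comm_of_isSymm hA, hAm]
    simp
  have := hns (w m) hm (by simp [hAm]) hBm 1 0 (by simp [hAm])
  exact one_ne_zero this.1

/-- Two symmetric matrices whose quadrics intersect transversally are simultaneously
diagonalizable, with pairwise distinct ratios of the diagonal entries. -/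
theorem exists_simultaneous_diagonalization (hA : A.IsSymm) (hB : B.IsSymm)
    (hns : ∀ v : Fin n → ℂ, v ≠ 0 → v ⬝ᵥ A *ᵥ v = 0 → v ⬝ᵥ B *ᵥ v = 0 →
      ∀ s t : ℂ, s • A *ᵥ v + t • B *ᵥ v = 0 → s = 0 ∧ t = 0) :
    ∃ (V : Matrix (Fin n) (Fin n) ℂ) (a b : Fin n → ℂ), V.det ≠ 0 ∧
      Vᵀ * A * V = diagonal a ∧ Vᵀ * B * V = diagonal b ∧
      ∀ i j, i ≠ j → a i * b j - a j * b i ≠ 0 := by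
  obtain ⟨t, ht⟩ := exists_det_add_smul_ne_zero hA hns
  set N := A + t • B with hN
  have hNs : N.IsSymm := hA.add (hB.smul t)
  have hNu : IsUnit N.det := isUnit_iff_ne_zero.2 ht
  have hNe : ∀ v, N *ᵥ v = A *ᵥ v + t • B *ᵥ v := fun v => by
    rw [hN, add_mulVec, smul_mulVec]
  set K := N⁻¹ * B with hK
  have hNK : ∀ v, N *ᵥ (K *ᵥ v) = B *ᵥ v := fun v => by
    rw [hK, mulVec_mulVec, ← Matrix.mul_assoc, Matrix.mul_nonsing_inv _ hNu, Matrix.one_mul]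
  set f : Module.End ℂ (Fin n → ℂ) := Matrix.toLin' K with hf
  have hfK : ∀ v, f v = K *ᵥ v := fun v => by rw [hf, Matrix.toLin'_apply]
  have hfN : ∀ v, N *ᵥ f v = B *ᵥ v := fun v => by rw [hfK, hNK]
  -- `f = N⁻¹B` is self-adjoint for the nondegenerate form `N`; its eigenvectors will diagonalize
  -- the pencil.
  have hadj : ∀ v w, f v ⬝ᵥ N *ᵥ w = v ⬝ᵥ N *ᵥ f w := fun v w => by
    rw [dotProduct_mulVec_comm_of_isSymm hNs, hfN, hfN, dotProduct_mulVec_comm_of_isSymm hB]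
  have hiso : ∀ (μ : ℂ) (v : Fin n → ℂ), f v = μ • v → v ⬝ᵥ N *ᵥ v = 0 → v = 0 := by
    intro μ v hv h0
    by_contra hv0
    have hBv : B *ᵥ v = μ • N *ᵥ v := by rw [← hfN, hv, mulVec_smul]
    have hB0 : v ⬝ᵥ B *ᵥ v = 0 := by rw [hBv, dotProduct_smul, h0, smul_zero]
    have hA0 : v ⬝ᵥ A *ᵥ v = 0 := by
      have := h0
      rw [hNe, dotProduct_add, dotProduct_smul, hB0, smul_zero, add_zero] at this
      exact this
    -- An isotropic eigenvector lies on both quadrics, and `Bv = μNv` is a dependency of their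
    -- gradients. The coefficients `-μ` and `1 - μt` cannot both vanish.
    have := hns v hv0 hA0 hB0 (-μ) (1 - μ * t) (by
      calc -μ • A *ᵥ v + (1 - μ * t) • B *ᵥ v = B *ᵥ v - μ • (A *ᵥ v + t • B *ᵥ v) := by module
        _ = 0 := by rw [← hNe, ← hBv, sub_self])
    obtain ⟨h1, h2⟩ := this
    have hμ : μ = 0 := by simpa using h1
    simp [hμ] at h2
  have hker : ∀ (μ : ℂ), LinearMap.ker ((f - algebraMap ℂ _ μ) ^ 1) =
      LinearMap.ker ((f - algebraMap ℂ _ μ) ^ (Nat.succ 1)) := by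
    intro μ
    apply le_antisymm
    · intro w hw
      rw [LinearMap.mem_ker, pow_one] at hw
      rw [LinearMap.mem_ker, pow_succ', pow_one, Module.End.mul_apply, hw, map_zero]
    · intro w hw
      rw [LinearMap.mem_ker, pow_succ', pow_one, Module.End.mul_apply] at hw
      rw [LinearMap.mem_ker, pow_one]
      obtain ⟨v, hv⟩ : ∃ v, v = (f - algebraMap ℂ (Module.End ℂ (Fin n → ℂ)) μ) w := ⟨_, rfl⟩
      have hv1 : v = f w - μ • w := by
        rw [hv, LinearMap.sub_apply, Module.algebraMap_end_apply]
      rw [← hv] at hw ⊢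
      have hw' : f v = μ • v := by
        rw [LinearMap.sub_apply, Module.algebraMap_end_apply, sub_eq_zero] at hw
        exact hw
      -- No Jordan blocks: an eigenvector `v = (f - μ)w` satisfies `v · Nv = w · N(f - μ)v = 0` by
      -- self-adjointness.
      refine hiso μ v hw' ?_
      nth_rewrite 1 [hv1]
      rw [sub_dotProduct, hadj, hw', mulVec_smul, smul_dotProduct, dotProduct_smul, sub_self]
  have hdim : ∀ μ : ℂ, Polynomial.rootMultiplicity μ f.charpoly ≤ 1 := by
    intro μ
    rw [← LinearMap.finrank_maxGenEigenspace_eq]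
    have hmax : ∀ w ∈ f.maxGenEigenspace μ, f w = μ • w := by
      intro w hw
      obtain ⟨k, hk⟩ := (Module.End.mem_maxGenEigenspace f μ w).1 hw
      have hk' : w ∈ LinearMap.ker ((f - algebraMap ℂ _ μ) ^ (1 + k)) := by
        rw [LinearMap.mem_ker, pow_add, Module.End.mul_apply]
        have : ((f - algebraMap ℂ _ μ) ^ k) w = 0 := hk
        rw [this, map_zero]
      rw [← Module.End.ker_pow_constant (hker μ) k, LinearMap.mem_ker, pow_one,
        LinearMap.sub_apply, Module.algebraMap_end_apply, sub_eq_zero] at hk'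
      exact hk'
    by_cases hbot : f.maxGenEigenspace μ = ⊥
    · rw [hbot, finrank_bot]; exact zero_le_one
    obtain ⟨v, hv, hv0⟩ := Submodule.exists_mem_ne_zero_of_ne_bot hbot
    refine finrank_le_one ⟨v, hv⟩ ?_
    rintro ⟨w, hw⟩
    have hvv : v ⬝ᵥ N *ᵥ v ≠ 0 := fun h => hv0 (hiso μ v (hmax v hv) h)
    -- Two independent eigenvectors `v`, `w` for the same eigenvalue would span an isotropic vector
    -- `cv + w`. Here `c` solves the quadratic equation `(cv + w) · N(cv + w) = 0`, and `z` is a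
    -- square root of a quarter of its discriminant.
    obtain ⟨z, hz⟩ := IsAlgClosed.exists_pow_nat_eq
      ((v ⬝ᵥ N *ᵥ w) ^ 2 - (v ⬝ᵥ N *ᵥ v) * (w ⬝ᵥ N *ᵥ w)) (n := 2) (by norm_num)
    set c := (z - v ⬝ᵥ N *ᵥ w) / (v ⬝ᵥ N *ᵥ v) with hc
    have hzero : c • v + w = 0 := by
      refine hiso μ _ ?_ ?_
      · rw [map_add, map_smul, hmax v hv, hmax w hw]; module
      · rw [mulVec_add, mulVec_smul, add_dotProduct, smul_dotProduct, dotProduct_add,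
          dotProduct_add, dotProduct_smul, dotProduct_smul,
          dotProduct_mulVec_comm_of_isSymm hNs w v]
        simp only [smul_eq_mul]
        have hcz : c * (v ⬝ᵥ N *ᵥ v) = z - v ⬝ᵥ N *ᵥ w := by rw [hc, div_mul_cancel₀ _ hvv]
        apply mul_right_cancel₀ hvv
        linear_combination (c * (v ⬝ᵥ N *ᵥ v) + z - v ⬝ᵥ N *ᵥ w + 2 * (v ⬝ᵥ N *ᵥ w)) * hcz + hz
    refine ⟨-c, ?_⟩
    ext1
    change -c • v = w
    rw [neg_smul, neg_eq_iff_add_eq_zero]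
    exact hzero
  have hnodup : f.charpoly.roots.Nodup := by
    rw [Multiset.nodup_iff_count_le_one]
    intro μ
    rw [Polynomial.count_roots]
    exact hdim μ
  -- Semisimplicity and one-dimensional eigenspaces give `n` distinct eigenvalues, hence an
  -- `N`-orthogonal eigenbasis.
  have hcard : f.charpoly.roots.toFinset.card = n := by
    rw [Multiset.toFinset_card_of_nodup hnodup, ← (IsAlgClosed.splits f.charpoly).natDegree_eq_card_roots,
      LinearMap.charpoly_natDegree]
    simp
  let e := (Finset.equivFinOfCardEq hcard).symm
  have hev : ∀ i, ∃ v, f v = (e i : ℂ) • v ∧ v ≠ 0 := by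
    intro i
    have hroot : (e i : ℂ) ∈ f.charpoly.roots := Multiset.mem_toFinset.1 (e i).2
    rw [Polynomial.mem_roots f.charpoly_monic.ne_zero] at hroot
    have := Module.End.hasEigenvalue_iff_isRoot_charpoly f (e i : ℂ) |>.2 hroot
    obtain ⟨v, hv⟩ := this.exists_hasEigenvector
    exact ⟨v, hv.apply_eq_smul, hv.2⟩
  choose v hv hv0 using hev
  have hinj : ∀ i j, i ≠ j → (e i : ℂ) - e j ≠ 0 := fun i j hij h =>
    hij (e.injective (Subtype.ext (sub_eq_zero.1 h)))
  have horth : ∀ i j, i ≠ j → v i ⬝ᵥ N *ᵥ v j = 0 := by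
    intro i j hij
    have h := hadj (v i) (v j)
    rw [hv, hv, mulVec_smul, smul_dotProduct, dotProduct_smul, smul_eq_mul, smul_eq_mul] at h
    exact (mul_eq_zero.1 (show ((e i : ℂ) - e j) * (v i ⬝ᵥ N *ᵥ v j) = 0 by
      linear_combination h)).resolve_left (hinj i j hij)
  set V : Matrix (Fin n) (Fin n) ℂ := Matrix.of fun i j => v j i with hV
  have hentry : ∀ (M : Matrix (Fin n) (Fin n) ℂ) i j, (Vᵀ * M * V) i j = v i ⬝ᵥ M *ᵥ v j := by
    intro M i j
    rw [Matrix.mul_assoc]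
    simp [Matrix.mul_apply, dotProduct, mulVec, hV]
  set ν : Fin n → ℂ := fun i => v i ⬝ᵥ N *ᵥ v i with hν
  have hν0 : ∀ i, ν i ≠ 0 := fun i h => hv0 i (hiso _ _ (hv i) h)
  have hVN : Vᵀ * N * V = diagonal ν := by
    ext i j
    rw [hentry]
    by_cases hij : i = j
    · subst hij; simp [hν]
    · rw [horth i j hij, diagonal_apply_ne _ hij]
  have hVB : Vᵀ * B * V = diagonal fun i => (e i : ℂ) * ν i := by
    ext i j
    rw [hentry, ← hfN, hv, mulVec_smul, dotProduct_smul, smul_eq_mul]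
    by_cases hij : i = j
    · subst hij; simp [hν]
    · rw [horth i j hij, diagonal_apply_ne _ hij, mul_zero]
  have hVA : Vᵀ * A * V = diagonal fun i => ν i - t * ((e i : ℂ) * ν i) := by
    have hAN : A = N - t • B := by rw [hN, add_sub_cancel_right]
    rw [hAN, Matrix.mul_sub, Matrix.sub_mul, Matrix.mul_smul, Matrix.smul_mul, hVN, hVB]
    ext i j
    by_cases hij : i = j
    · subst hij; simp
    · simp [hij]
  refine ⟨V, _, _, ?_, hVA, hVB, fun i j hij => ?_⟩
  · intro h0
    have := congrArg Matrix.det hVN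
    rw [det_mul, h0, mul_zero, det_diagonal] at this
    exact (Finset.prod_ne_zero_iff.2 fun i _ => hν0 i) this.symm
  · have : (ν i - t * ((e i : ℂ) * ν i)) * ((e j : ℂ) * ν j) -
        (ν j - t * ((e j : ℂ) * ν j)) * ((e i : ℂ) * ν i) = ((e j : ℂ) - e i) * (ν i * ν j) := by
      ring
    rw [this]
    exact mul_ne_zero (hinj j i hij.symm) (mul_ne_zero (hν0 i) (hν0 j))

end Diagonalization

/-! ### The covariants `T₁`, `T₂` in matrix form. -/

theorem pderiv_comm_apply {n : ℕ} (i j : Fin n) (f : MvPolynomial (Fin n) ℝ) :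
    pderiv i (pderiv j f) = pderiv j (pderiv i f) := by
  induction f using MvPolynomial.induction_on with
  | C a => simp
  | add p q hp hq => simp [hp, hq]
  | mul_X p k hp =>
    have hpi : ∀ a b c : Fin n, pderiv a ((Pi.single b 1 : Fin n → MvPolynomial (Fin n) ℝ) c) = 0 := by
      intro a b c
      rw [Pi.single_apply]
      split_ifs
      exacts [pderiv_one, map_zero _]
    simp only [pderiv_mul, map_add, hp, pderiv_X, hpi]
    ring

theorem pderiv_bind₁ {m n : ℕ} (g : Fin m → MvPolynomial (Fin n) ℝ) (f : MvPolynomial (Fin m) ℝ)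
    (k : Fin n) : pderiv k (bind₁ g f) = ∑ i, bind₁ g (pderiv i f) * pderiv k (g i) := by
  induction f using MvPolynomial.induction_on with
  | C a => simp
  | add p q hp hq => simp [hp, hq, add_mul, Finset.sum_add_distrib]
  | mul_X p j hp =>
    simp only [map_mul, pderiv_mul, bind₁_X_right, hp, map_add, add_mul, Finset.sum_add_distrib,
      pderiv_X, Finset.sum_mul]
    congr 1
    · exact Finset.sum_congr rfl fun i _ => by ring
    · rw [Finset.sum_eq_single j]
      · simp
      · intro i _ hij
        simp [hij.symm]
      · simp

theorem euler_aeval {n d : ℕ} {f : MvPolynomial (Fin n) ℝ} (hf : f.IsHomogeneous d)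
    (x : Fin n → ℂ) : ∑ i, x i * aeval x (pderiv i f) = d * aeval x f := by
  have h := congrArg (aeval x) hf.sum_X_mul_pderiv
  simpa using h

theorem aeval_ofReal {n : ℕ} (f : MvPolynomial (Fin n) ℝ) (x : Fin n → ℝ) :
    aeval (fun i => (x i : ℂ)) f = (eval x f : ℂ) := by
  induction f using MvPolynomial.induction_on with
  | C a => simp
  | add p q hp hq => simp [hp, hq]
  | mul_X p k hp => simp [hp]

namespace QuadricIntersection

open Matrix

variable {q q' : MvPolynomial (Fin 4) ℝ}

theorem pderiv_pderiv_eq_C (hq : q.IsHomogeneous 2) (i j : Fin 4) :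
    pderiv i (pderiv j q) = C (mat q i j) := by
  obtain ⟨a, ha⟩ := exists_eq_C_of_isHomogeneous_zero ((hq.pderiv (i := j)).pderiv (i := i))
  rw [mat, Matrix.of_apply, ha, constantCoeff_C]

theorem mat_comm (q : MvPolynomial (Fin 4) ℝ) (i j : Fin 4) : mat q i j = mat q j i := by
  simp only [mat, Matrix.of_apply]
  rw [pderiv_comm_apply]

theorem isSymm_mat (q : MvPolynomial (Fin 4) ℝ) : (mat q).IsSymm :=
  Matrix.IsSymm.ext fun i j => mat_comm q j i

theorem isSymm_adjugate_mat (q : MvPolynomial (Fin 4) ℝ) : (mat q).adjugate.IsSymm := by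
  rw [Matrix.IsSymm, Matrix.adjugate_transpose, (isSymm_mat q).eq]

theorem pderiv_eq_sum (hq : q.IsHomogeneous 2) (i : Fin 4) :
    pderiv i q = ∑ j, C (mat q i j) * X j := by
  have h := (hq.pderiv (i := i)).sum_X_mul_pderiv
  simp only [pderiv_pderiv_eq_C hq] at h
  rw [show (2 - 1 : ℕ) = 1 from rfl, one_smul] at h
  rw [← h]
  exact Finset.sum_congr rfl fun j _ => by rw [mat_comm, mul_comm]

/-- The coefficients of a quadratic form are its second derivatives off the diagonal and half of
them on it, so a sum over `r ≤ s` is half of the full symmetric sum. -/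
theorem sum_Ici_eq (S m : Fin 4 → Fin 4 → ℝ) (hS : ∀ i j, S i j = S j i)
    (hm : ∀ i j, m i j = m j i) :
    ∑ r, ∑ s ∈ Finset.Ici r, (if r = s then S r r / 2 else S r s) * m r s =
      1 / 2 * ∑ r, ∑ s, S r s * m r s := by
  have e0 : Finset.Ici (0 : Fin 4) = {0, 1, 2, 3} := by decide
  have e1 : Finset.Ici (1 : Fin 4) = {1, 2, 3} := by decide
  have e2 : Finset.Ici (2 : Fin 4) = {2, 3} := by decide
  have e3 : Finset.Ici (3 : Fin 4) = {3} := by decide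
  simp only [Fin.sum_univ_four, e0, e1, e2, e3]
  simp
  rw [hS 1 0, hS 2 0, hS 3 0, hS 2 1, hS 3 1, hS 3 2, hm 1 0, hm 2 0, hm 3 0, hm 2 1, hm 3 1,
    hm 3 2]
  ring

/-- The trace of `adj B · A`. -/
noncomputable def traceTerm (q q' : MvPolynomial (Fin 4) ℝ) : ℝ :=
  ∑ r, ∑ s, (mat q').adjugate r s * mat q r s

/-- The terms `A_ij A_rs` contribute the trace of `adj B · A` times `q`, because `∑ A_ij x_i x_j =
2q`. The terms `A_is A_jr` contribute the dual quadratic form evaluated at the gradient of `q`. Only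
the latter survives on the curve. -/
theorem T_eq (hq : q.IsHomogeneous 2) :
    T q q' = C (traceTerm q q') * q -
      C (1 / 2) * ∑ k, ∑ l, C ((mat q').adjugate k l) * pderiv k q * pderiv l q := by
  apply MvPolynomial.funext
  intro x
  set y : Fin 4 → ℝ := fun i => ∑ j, mat q i j * x j with hy
  have hpd : ∀ i, eval x (pderiv i q) = y i := fun i => by
    rw [pderiv_eq_sum hq]; simp [hy]
  have hq2 : eval x q = 1 / 2 * ∑ i, x i * y i := by
    have h := congrArg (eval x) hq.sum_X_mul_pderiv
    simp [hpd] at h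
    linear_combination (-1 / 2) * h
  have hS : ∀ i j, (mat q').adjugate i j = (mat q').adjugate j i := fun i j =>
    (isSymm_adjugate_mat q').apply j i
  have h1 := sum_Ici_eq _ (mat q) hS (mat_comm q)
  have h2 := sum_Ici_eq _ (fun r s => y r * y s) hS (fun i j => mul_comm _ _)
  have hT : eval x (T q q') = (∑ r, ∑ s ∈ Finset.Ici r, dualCoeff q' r s * mat q r s) *
      (∑ i, x i * y i) - ∑ r, ∑ s ∈ Finset.Ici r, dualCoeff q' r s * (y r * y s) := by
    have hx : ∑ i, x i * y i = ∑ i, ∑ j, mat q i j * x i * x j := by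
      refine Finset.sum_congr rfl fun i _ => ?_
      rw [hy, Finset.mul_sum]
      exact Finset.sum_congr rfl fun j _ => by ring
    have hyy : ∀ r s, y r * y s = ∑ i, ∑ j, mat q i s * mat q j r * x i * x j := by
      intro r s
      rw [mul_comm, hy, Finset.sum_mul_sum]
      refine Finset.sum_congr rfl fun i _ => Finset.sum_congr rfl fun j _ => ?_
      rw [mat_comm q s i, mat_comm q r j]
      ring
    have hswap : ∀ (φ : Fin 4 → Fin 4 → Fin 4 → Fin 4 → ℝ),
        ∑ r, ∑ s ∈ Finset.Ici r, ∑ i, ∑ j, φ i j r s =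
          ∑ i, ∑ j, ∑ r, ∑ s ∈ Finset.Ici r, φ i j r s := by
      intro φ
      calc ∑ r, ∑ s ∈ Finset.Ici r, ∑ i, ∑ j, φ i j r s
          = ∑ r, ∑ i, ∑ s ∈ Finset.Ici r, ∑ j, φ i j r s :=
            Finset.sum_congr rfl fun r _ => Finset.sum_comm
        _ = ∑ i, ∑ r, ∑ s ∈ Finset.Ici r, ∑ j, φ i j r s := Finset.sum_comm
        _ = ∑ i, ∑ r, ∑ j, ∑ s ∈ Finset.Ici r, φ i j r s :=
            Finset.sum_congr rfl fun i _ => Finset.sum_congr rfl fun r _ => Finset.sum_comm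
        _ = _ := Finset.sum_congr rfl fun i _ => Finset.sum_comm
    simp only [hx, hyy, Finset.sum_mul, Finset.mul_sum]
    rw [hswap]
    simp only [T, map_sum, map_mul, eval_C, eval_X, ← Finset.sum_sub_distrib]
    refine Finset.sum_congr rfl fun i _ => Finset.sum_congr rfl fun j _ =>
      Finset.sum_congr rfl fun r _ => Finset.sum_congr rfl fun s _ => ?_
    ring
  rw [hT]
  simp only [dualCoeff]
  rw [h1, h2]
  simp only [map_sub, map_mul, map_sum, eval_C, hpd, hq2, traceTerm]
  have : ∀ r s, (mat q').adjugate r s * (y r * y s) = (mat q').adjugate r s * y r * y s :=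
    fun r s => by ring
  simp only [this]
  ring

/-- The Gram matrix over the complex numbers. -/
noncomputable def cmat (q : MvPolynomial (Fin 4) ℝ) : Matrix (Fin 4) (Fin 4) ℂ :=
  (mat q).map (algebraMap ℝ ℂ)

theorem isSymm_cmat (q : MvPolynomial (Fin 4) ℝ) : (cmat q).IsSymm := (isSymm_mat q).map _

theorem adjugate_cmat (q : MvPolynomial (Fin 4) ℝ) :
    (cmat q).adjugate = (mat q).adjugate.map (algebraMap ℝ ℂ) :=
  ((algebraMap ℝ ℂ).map_adjugate (mat q)).symm

theorem aeval_pderiv (hq : q.IsHomogeneous 2) (x : Fin 4 → ℂ) (i : Fin 4) :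
    aeval x (pderiv i q) = (cmat q *ᵥ x) i := by
  rw [pderiv_eq_sum hq]
  simp [cmat, mulVec, dotProduct]

theorem two_mul_aeval (hq : q.IsHomogeneous 2) (x : Fin 4 → ℂ) :
    2 * aeval x q = x ⬝ᵥ cmat q *ᵥ x := by
  have h := euler_aeval hq x
  simp only [aeval_pderiv hq] at h
  exact_mod_cast h.symm

theorem aeval_T (hq : q.IsHomogeneous 2) (x : Fin 4 → ℂ) :
    aeval x (T q q') = traceTerm q q' * aeval x q -
      1 / 2 * (cmat q *ᵥ x ⬝ᵥ (cmat q').adjugate *ᵥ (cmat q *ᵥ x)) := by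
  rw [T_eq hq]
  simp only [map_sub, map_mul, map_sum, aeval_pderiv hq, aeval_C]
  generalize cmat q *ᵥ x = y
  rw [adjugate_cmat]
  simp only [dotProduct, mulVec, Matrix.map_apply, Finset.mul_sum]
  congr 1
  refine Finset.sum_congr rfl fun k _ => Finset.sum_congr rfl fun l _ => ?_
  simp only [Complex.coe_algebraMap]
  push_cast
  ring

theorem pderiv_T (hq : q.IsHomogeneous 2) (i : Fin 4) :
    pderiv i (T q q') = C (traceTerm q q') * pderiv i q -
      ∑ k, ∑ l, C ((mat q').adjugate k l * mat q i k) * pderiv l q := by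
  have hS : ∀ i j, (mat q').adjugate i j = (mat q').adjugate j i := fun i j =>
    (isSymm_adjugate_mat q').apply j i
  rw [T_eq hq]
  simp only [map_sub, pderiv_C_mul, map_sum, mul_assoc]
  simp only [pderiv_mul, pderiv_pderiv_eq_C hq]
  congr 1
  have key : ∀ k l : Fin 4, C ((mat q').adjugate k l) *
      (C (mat q i k) * pderiv l q + pderiv k q * C (mat q i l)) =
      C ((mat q').adjugate k l * mat q i k) * pderiv l q +
      C ((mat q').adjugate l k * mat q i l) * pderiv k q := by
    intro k l
    rw [hS l k, C_mul, C_mul]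
    ring
  rw [Finset.sum_congr rfl fun k _ => Finset.sum_congr rfl fun l _ => key k l]
  simp only [Finset.sum_add_distrib]
  rw [Finset.sum_comm (f := fun k l : Fin 4 => C ((mat q').adjugate l k * mat q i l) * pderiv k q),
    ← two_mul, ← mul_assoc]
  have h2 : (C (1 / 2 : ℝ) * 2 : MvPolynomial (Fin 4) ℝ) = 1 := by
    rw [show (2 : MvPolynomial (Fin 4) ℝ) = C 2 from (map_ofNat C 2).symm, ← C_mul]
    norm_num
  rw [h2, one_mul]

theorem sum_mul_aeval_pderiv_T (hq : q.IsHomogeneous 2) (x w : Fin 4 → ℂ) :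
    ∑ i, aeval x (pderiv i (T q q')) * w i = traceTerm q q' * (w ⬝ᵥ cmat q *ᵥ x) -
      cmat q *ᵥ w ⬝ᵥ (cmat q').adjugate *ᵥ (cmat q *ᵥ x) := by
  simp only [pderiv_T hq, map_sub, map_mul, map_sum, aeval_pderiv hq, aeval_C, sub_mul,
    Finset.sum_sub_distrib]
  congr 1
  · rw [dotProduct, Finset.mul_sum]
    refine Finset.sum_congr rfl fun i _ => ?_
    simp only [Complex.coe_algebraMap]
    ring
  · have h1 : ∀ k, (cmat q *ᵥ w) k = ∑ i, algebraMap ℝ ℂ (mat q i k) * w i := by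
      intro k
      simp only [mulVec, dotProduct, cmat, Matrix.map_apply]
      exact Finset.sum_congr rfl fun i _ => by rw [mat_comm]
    rw [dotProduct]
    simp only [h1, Finset.sum_mul]
    rw [Finset.sum_comm]
    refine Finset.sum_congr rfl fun k _ => Finset.sum_congr rfl fun i _ => ?_
    generalize cmat q *ᵥ x = y
    rw [adjugate_cmat]
    simp only [mulVec, dotProduct, Matrix.map_apply, Finset.mul_sum]
    refine Finset.sum_congr rfl fun l _ => ?_
    ring

end QuadricIntersection

/-! ### Binary quartics that split into distinct linear factors. -/

namespace BinaryQuartic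

variable {P Q : MvPolynomial (Fin 2) ℝ}

/-- The combination `s F₂ + κ G₂` in terms of `g` and `h`. -/
theorem combination_eq (s κ : ℝ) :
    C s * F P Q + C κ * G P Q = C (4 * s - κ / 3 * b₂ P Q) * g P Q + C (κ / 3) * h P Q := by
  apply MvPolynomial.funext
  intro x
  simp [F, G, g]
  ring

theorem combination_coeff_ne_zero (b : ℝ) {s κ : ℝ} (hsκ : s ≠ 0 ∨ κ ≠ 0) :
    4 * s - κ / 3 * b ≠ 0 ∨ κ / 3 ≠ 0 := by
  by_contra hcon
  push Not at hcon
  have hκ : κ = 0 := by linarith [hcon.2]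
  have hs := hcon.1
  rw [hκ] at hs
  have : s = 0 := by linarith
  rcases hsκ with h | h
  exacts [h this, h hκ]

theorem F_eq : F P Q = C 4 * g P Q := by
  apply MvPolynomial.funext
  intro x
  simp [F, g]
  ring

/-- At a common zero of `g` and `h` both partial derivatives of `g` vanish. -/
theorem pderiv_g_eq_zero (hP : P.IsHomogeneous 2) (hQ : Q.IsHomogeneous 4) {w : Fin 2 → ℂ}
    (hg : aeval w (g P Q) = 0) (hh : aeval w (h P Q) = 0) (i : Fin 2) :
    aeval w (pderiv i (g P Q)) = 0 := by
  have hG := isHomogeneous_g hP hQ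
  have e := euler_aeval hG w
  have e0 := euler_aeval (hG.pderiv (i := 0)) w
  have e1 := euler_aeval (hG.pderiv (i := 1)) w
  simp only [Fin.sum_univ_two, hg, mul_zero] at e e0 e1
  rw [pderiv_comm_apply 1 0] at e0
  have hh' : aeval w (pderiv 0 (pderiv 1 (g P Q))) ^ 2 -
      aeval w (pderiv 0 (pderiv 0 (g P Q))) * aeval w (pderiv 1 (pderiv 1 (g P Q))) = 0 := by
    simpa [h] using hh
  generalize aeval w (pderiv 0 (pderiv 1 (g P Q))) = g01 at *
  generalize aeval w (pderiv 0 (pderiv 0 (g P Q))) = g00 at *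
  generalize aeval w (pderiv 1 (pderiv 1 (g P Q))) = g11 at *
  generalize hg0 : aeval w (pderiv 0 (g P Q)) = g0 at *
  generalize hg1 : aeval w (pderiv 1 (g P Q)) = g1 at *
  push_cast at e0 e1
  -- At a zero of `g`, Euler's identities for `g` and its partial derivatives give `(3 g_1)² = w_0²
  -- (g_01² - g_00 g_11)`, and similarly for `g_0`.
  have k1 : g1 ^ 2 = 0 := by
    have : (3 * g1) ^ 2 - w 0 ^ 2 * (g01 ^ 2 - g00 * g11) = 0 := by
      linear_combination (-(3 * g1) - w 0 * g01 - w 1 * g11) * e1 +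
        g11 * (w 0 * e0 + w 1 * e1 + 3 * e)
    rw [hh', mul_zero, sub_zero] at this
    linear_combination this / 9
  have k0 : g0 ^ 2 = 0 := by
    have : (3 * g0) ^ 2 - w 1 ^ 2 * (g01 ^ 2 - g00 * g11) = 0 := by
      linear_combination (-(3 * g0) - w 0 * g00 - w 1 * g01) * e0 +
        g00 * (w 0 * e0 + w 1 * e1 + 3 * e)
    rw [hh', mul_zero, sub_zero] at this
    linear_combination this / 9
  fin_cases i
  · exact hg0.trans (pow_eq_zero_iff two_ne_zero |>.1 k0)
  · exact hg1.trans (pow_eq_zero_iff two_ne_zero |>.1 k1)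

/-- The partial derivatives of a quartic that splits into linear factors, at a root. -/
theorem exists_pderiv_F_eq {a b : Fin 4 → ℂ} {ε : ℂ} (hε : ε ≠ 0)
    (hab : ∀ i j, i ≠ j → a i * b j - a j * b i ≠ 0)
    (hF : ∀ w : Fin 2 → ℂ, aeval w (F P Q) = ε * ∏ i, (a i * w 0 + b i * w 1)) (j : Fin 4) :
    ∃ ρ : ℂ, ρ ≠ 0 ∧ aeval ![b j, -a j] (pderiv 0 (F P Q)) = a j * ρ ∧
      aeval ![b j, -a j] (pderiv 1 (F P Q)) = b j * ρ := by
  have hmap : map (algebraMap ℝ ℂ) (F P Q) = C ε * ((C (a 0) * X 0 + C (b 0) * X 1) *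
      (C (a 1) * X 0 + C (b 1) * X 1) * (C (a 2) * X 0 + C (b 2) * X 1) *
      (C (a 3) * X 0 + C (b 3) * X 1)) := by
    apply MvPolynomial.funext
    intro w
    rw [eval_map, ← aeval_def, hF]
    simp [Fin.prod_univ_four]
  have hpd : ∀ (w : Fin 2 → ℂ) (k : Fin 2), aeval w (pderiv k (F P Q)) =
      eval w (pderiv k (map (algebraMap ℝ ℂ) (F P Q))) := by
    intro w k
    rw [pderiv_map, eval_map, ← aeval_def]
  simp only [hpd, hmap]
  have d01 := hab 0 1 (by decide)
  have d02 := hab 0 2 (by decide)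
  have d03 := hab 0 3 (by decide)
  have d12 := hab 1 2 (by decide)
  have d13 := hab 1 3 (by decide)
  have d23 := hab 2 3 (by decide)
  fin_cases j
  · refine ⟨-ε * ((a 0 * b 1 - a 1 * b 0) * (a 0 * b 2 - a 2 * b 0) * (a 0 * b 3 - a 3 * b 0)),
      by simp [hε, d01, d02, d03], ?_, ?_⟩ <;> simp [pderiv_X] <;> ring
  · refine ⟨ε * ((a 0 * b 1 - a 1 * b 0) * (a 1 * b 2 - a 2 * b 1) * (a 1 * b 3 - a 3 * b 1)),
      by simp [hε, d01, d12, d13], ?_, ?_⟩ <;> simp [pderiv_X] <;> ring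
  · refine ⟨-ε * ((a 0 * b 2 - a 2 * b 0) * (a 1 * b 2 - a 2 * b 1) * (a 2 * b 3 - a 3 * b 2)),
      by simp [hε, d02, d12, d23], ?_, ?_⟩ <;> simp [pderiv_X] <;> ring
  · refine ⟨ε * ((a 0 * b 3 - a 3 * b 0) * (a 1 * b 3 - a 3 * b 1) * (a 2 * b 3 - a 3 * b 2)),
      by simp [hε, d03, d13, d23], ?_, ?_⟩ <;> simp [pderiv_X] <;> ring

/-- No combination of the covariants is a multiple of the fourth power of a linear factor of
`F₂`. -/
theorem exists_directional_derivative_ne_zero (hP : P.IsHomogeneous 2) (hQ : Q.IsHomogeneous 4)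
    {a b : Fin 4 → ℂ} {ε : ℂ} (hε : ε ≠ 0)
    (hab : ∀ i j, i ≠ j → a i * b j - a j * b i ≠ 0)
    (hF : ∀ w : Fin 2 → ℂ, aeval w (F P Q) = ε * ∏ i, (a i * w 0 + b i * w 1))
    {s κ : ℝ} (hsκ : s ≠ 0 ∨ κ ≠ 0) (i : Fin 4) :
    ∃ w : Fin 2 → ℂ, b i * aeval w (pderiv 0 (C s * F P Q + C κ * G P Q)) -
      a i * aeval w (pderiv 1 (C s * F P Q + C κ * G P Q)) ≠ 0 := by
  by_contra hcon
  push Not at hcon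
  rw [combination_eq] at hcon
  have hsκ' := combination_coeff_ne_zero (b₂ P Q) hsκ
  generalize 4 * s - κ / 3 * b₂ P Q = s' at *
  generalize κ / 3 = κ' at *
  have hgF : ∀ (w : Fin 2 → ℂ) k, aeval w (pderiv k (F P Q)) =
      4 * aeval w (pderiv k (g P Q)) := by
    intro w k
    rw [F_eq, pderiv_C_mul, map_mul, aeval_C]
    simp
  obtain ⟨j, hij⟩ := exists_ne i
  have hφ : (C s' * g P Q + C κ' * h P Q).IsHomogeneous 4 :=
    ((isHomogeneous_g hP hQ).C_mul _).add ((isHomogeneous_h hP hQ).C_mul _)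
  by_cases hκ : κ' = 0
  -- A multiple of `g` alone: at the root of another factor `j` the gradient is proportional to
  -- `(a_j, b_j)`, and its product with `(b_i, -a_i)` is nonzero.
  · have hs : s' ≠ 0 := by simpa [hκ] using hsκ'
    obtain ⟨ρ, hρ, h0, h1⟩ := exists_pderiv_F_eq hε hab hF j
    rw [hgF] at h0 h1
    have h2 := hcon ![b j, -a j]
    simp only [hκ, C_0, zero_mul, add_zero, pderiv_C_mul, map_mul, aeval_C] at h2
    have h3 : (s' : ℂ) * ρ * (a j * b i - a i * b j) = 0 := by
      simp only [Complex.coe_algebraMap] at h2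
      linear_combination 4 * h2 - s' * b i * h0 + s' * a i * h1
    simp [hs, hρ, hab j i hij] at h3
  -- At the root `(b_i, -a_i)` itself, the directional derivative is four times the value of the
  -- form by Euler's identity. So `h` vanishes there with `g`, and the gradient of `g` would vanish
  -- at a simple root.
  · obtain ⟨ρ, hρ, h0, h1⟩ := exists_pderiv_F_eq hε hab hF i
    rw [hgF] at h0 h1
    have hFw : aeval ![b i, -a i] (F P Q) = 0 := by
      rw [hF, Finset.prod_eq_zero (Finset.mem_univ i), mul_zero]
      simp
      ring
    have hgw : aeval ![b i, -a i] (g P Q) = 0 := by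
      rw [F_eq] at hFw
      simpa using hFw
    have heul := euler_aeval hφ ![b i, -a i]
    have h2 := hcon ![b i, -a i]
    have hhw : aeval ![b i, -a i] (h P Q) = 0 := by
      have h3 : aeval ![b i, -a i] (C s' * g P Q + C κ' * h P Q) = 0 := by
        simp only [Fin.sum_univ_two, Matrix.cons_val_zero, Matrix.cons_val_one] at heul
        push_cast at heul
        linear_combination (-1 / 4) * heul + (1 / 4) * h2
      simpa [hgw, hκ] using h3
    rw [pderiv_g_eq_zero hP hQ hgw hhw, mul_zero, eq_comm, mul_eq_zero] at h0 h1
    have ha := h0.resolve_right hρ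
    have hb := h1.resolve_right hρ
    exact hab j i hij (by simp [ha, hb])

end BinaryQuartic

/-! ### Polynomial identities in diagonal coordinates. -/

section DiagonalIdentities

theorem erase_univ_fin_four :
    (Finset.univ.erase (0 : Fin 4) = {1, 2, 3}) ∧ (Finset.univ.erase (1 : Fin 4) = {0, 2, 3}) ∧
    (Finset.univ.erase (2 : Fin 4) = {0, 1, 3}) ∧ (Finset.univ.erase (3 : Fin 4) = {0, 1, 2}) := by
  decide

theorem prod_erase_fin_four (f : Fin 4 → ℂ) :
    (∏ j ∈ Finset.univ.erase 0, f j = f 1 * f 2 * f 3) ∧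
    (∏ j ∈ Finset.univ.erase 1, f j = f 0 * f 2 * f 3) ∧
    (∏ j ∈ Finset.univ.erase 2, f j = f 0 * f 1 * f 3) ∧
    (∏ j ∈ Finset.univ.erase 3, f j = f 0 * f 1 * f 2) := by
  obtain ⟨h0, h1, h2, h3⟩ := erase_univ_fin_four
  rw [h0, h1, h2, h3]
  simp [mul_assoc]

/-- Modulo the two linear relations only `Y i` survives. The multipliers of the relations are `a_i
b_i` times the symmetric sums of `a_j b_k b_l` and of `b_j a_k a_l` over the other three indices.
For `Y = y²` this is what makes the linear factors of `F₂(T₁, -T₂)` multiples of squares. -/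
theorem diagonal_covariant_identity (a b Y : Fin 4 → ℂ) (h₁ : ∑ j, a j * Y j = 0)
    (h₂ : ∑ j, b j * Y j = 0) (i : Fin 4) :
    a i * ∑ j, (∏ k ∈ Finset.univ.erase j, b k) * (a j ^ 2 * Y j) -
      b i * ∑ j, (∏ k ∈ Finset.univ.erase j, a k) * (b j ^ 2 * Y j) =
      (∏ j ∈ Finset.univ.erase i, (a i * b j - a j * b i)) * Y i := by
  simp only [Fin.sum_univ_four] at h₁ h₂ ⊢
  obtain ⟨a0, a1, a2, a3⟩ := prod_erase_fin_four a
  obtain ⟨b0, b1, b2, b3⟩ := prod_erase_fin_four b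
  obtain ⟨c0, c1, c2, c3⟩ := prod_erase_fin_four fun j => a i * b j - a j * b i
  rw [a0, a1, a2, a3, b0, b1, b2, b3]
  fin_cases i
  · simp only [Fin.zero_eta] at c0 ⊢
    rw [c0]
    linear_combination a 0 * b 0 * ((a 1 * b 2 * b 3 + a 2 * b 1 * b 3 + a 3 * b 1 * b 2) * h₁ -
      (b 1 * a 2 * a 3 + b 2 * a 1 * a 3 + b 3 * a 1 * a 2) * h₂)
  · simp only [Fin.mk_one] at c1 ⊢
    rw [c1]
    linear_combination a 1 * b 1 * ((a 0 * b 2 * b 3 + a 2 * b 0 * b 3 + a 3 * b 0 * b 2) * h₁ -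
      (b 0 * a 2 * a 3 + b 2 * a 0 * a 3 + b 3 * a 0 * a 2) * h₂)
  · simp only [Fin.reduceFinMk] at c2 ⊢
    rw [c2]
    linear_combination a 2 * b 2 * ((a 1 * b 0 * b 3 + a 0 * b 1 * b 3 + a 3 * b 1 * b 0) * h₁ -
      (b 1 * a 0 * a 3 + b 0 * a 1 * a 3 + b 3 * a 1 * a 0) * h₂)
  · simp only [Fin.reduceFinMk] at c3 ⊢
    rw [c3]
    linear_combination a 3 * b 3 * ((a 1 * b 2 * b 0 + a 2 * b 1 * b 0 + a 0 * b 1 * b 2) * h₁ -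
      (b 1 * a 2 * a 0 + b 2 * a 1 * a 0 + b 0 * a 1 * a 2) * h₂)

/-- The `τ` terms in the last row are combinations of the middle rows. In the cofactor of `l i`, the
last row carries a common factor `b_i` in its `u`-part and `a_i` in its `v`-part, and what is left
is a homogeneous Vandermonde determinant. So `κ i` is `±ε` times the three differences `a_j b_k -
a_k b_j` that avoid `i`. -/
theorem diagonal_jacobian_identity {a b : Fin 4 → ℂ} {ε : ℂ} (hε : ε ≠ 0)
    (hab : ∀ i j, i ≠ j → a i * b j - a j * b i ≠ 0) :
    ∃ κ : Fin 4 → ℂ, (∀ i, κ i ≠ 0) ∧ ∀ (l y : Fin 4 → ℂ) (u v τ₁ τ₂ : ℂ),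
      (Matrix.of ![l, fun i => a i * y i, fun i => b i * y i, fun i =>
        u * (τ₁ * (a i * y i) - ε * ((∏ k ∈ Finset.univ.erase i, b k) * (a i ^ 2 * y i))) -
        v * (τ₂ * (b i * y i) - ε * ((∏ k ∈ Finset.univ.erase i, a k) * (b i ^ 2 * y i)))]).det =
      ∑ i, κ i * l i * (b i * u - a i * v) * ∏ j ∈ Finset.univ.erase i, y j := by
  have d01 := hab 0 1 (by decide)
  have d02 := hab 0 2 (by decide)
  have d03 := hab 0 3 (by decide)
  have d12 := hab 1 2 (by decide)
  have d13 := hab 1 3 (by decide)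
  have d23 := hab 2 3 (by decide)
  refine ⟨![-ε * ((a 1 * b 2 - a 2 * b 1) * (a 1 * b 3 - a 3 * b 1) * (a 2 * b 3 - a 3 * b 2)),
    ε * ((a 0 * b 2 - a 2 * b 0) * (a 0 * b 3 - a 3 * b 0) * (a 2 * b 3 - a 3 * b 2)),
    -ε * ((a 0 * b 1 - a 1 * b 0) * (a 0 * b 3 - a 3 * b 0) * (a 1 * b 3 - a 3 * b 1)),
    ε * ((a 0 * b 1 - a 1 * b 0) * (a 0 * b 2 - a 2 * b 0) * (a 1 * b 2 - a 2 * b 1))], ?_, ?_⟩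
  · intro i
    fin_cases i <;> simp [hε, d01, d02, d03, d12, d13, d23]
  · intro l y u v τ₁ τ₂
    obtain ⟨a0, a1, a2, a3⟩ := prod_erase_fin_four a
    obtain ⟨b0, b1, b2, b3⟩ := prod_erase_fin_four b
    obtain ⟨y0, y1, y2, y3⟩ := prod_erase_fin_four y
    rw [Fin.sum_univ_four, y0, y1, y2, y3, Matrix.det_succ_row_zero]
    simp only [Fin.sum_univ_four, Matrix.det_fin_three, Matrix.submatrix_apply, Matrix.of_apply]
    simp [Fin.succAbove, a0, a1, a2, a3, b0, b1, b2, b3]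
    ring

end DiagonalIdentities

/-! ### The quadric intersection in diagonal coordinates. -/

namespace QuadricIntersection

open Matrix

/-- A simultaneous diagonalization, over the complex numbers, of two quadratic forms. -/
structure Diagonalization (Q₁ Q₂ : MvPolynomial (Fin 4) ℝ) where
  h₁ : Q₁.IsHomogeneous 2
  h₂ : Q₂.IsHomogeneous 2
  V : Matrix (Fin 4) (Fin 4) ℂ
  a : Fin 4 → ℂ
  b : Fin 4 → ℂ
  det_ne_zero : V.det ≠ 0
  hA : Vᵀ * cmat Q₁ * V = diagonal a
  hB : Vᵀ * cmat Q₂ * V = diagonal b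
  hab : ∀ i j, i ≠ j → a i * b j - a j * b i ≠ 0

theorem exists_diagonalization {Q₁ Q₂ : MvPolynomial (Fin 4) ℝ} {h₁ : Q₁.IsHomogeneous 2}
    {h₂ : Q₂.IsHomogeneous 2} (hΦ : (GenusOneModel.quadrics Q₁ Q₂ h₁ h₂).IsNonsingular) :
    Nonempty (Diagonalization Q₁ Q₂) := by
  obtain ⟨V, a, b, hV, hA, hB, hab⟩ := exists_simultaneous_diagonalization (isSymm_cmat Q₁)
    (isSymm_cmat Q₂) fun v hv e1 e2 s t hst => by
      have h := hΦ v hv (by linear_combination (1 / 2) * two_mul_aeval h₁ v + (1 / 2) * e1)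
        (by linear_combination (1 / 2) * two_mul_aeval h₂ v + (1 / 2) * e2)
      rw [LinearIndependent.pair_iff] at h
      refine h s t ?_
      simp only [aeval_pderiv h₁, aeval_pderiv h₂]
      exact hst
  exact ⟨⟨h₁, h₂, V, a, b, hV, hA, hB, hab⟩⟩

namespace Diagonalization

variable {Q₁ Q₂ : MvPolynomial (Fin 4) ℝ} (D : Diagonalization Q₁ Q₂)

/-- Exchanging the two quadratic forms. -/
def swap : Diagonalization Q₂ Q₁ :=
  ⟨D.h₂, D.h₁, D.V, D.b, D.a, D.det_ne_zero, D.hB, D.hA, fun i j hij => by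
    have := D.hab i j hij
    contrapose! this
    linear_combination -this⟩

/-- The scaling factor `det V⁻²`. -/
noncomputable def ε : ℂ := (D.V.det ^ 2)⁻¹

theorem ε_ne_zero : D.ε ≠ 0 := inv_ne_zero (pow_ne_zero _ D.det_ne_zero)

theorem transpose_mulVec (y : Fin 4 → ℂ) :
    D.Vᵀ *ᵥ (cmat Q₁ *ᵥ (D.V *ᵥ y)) = fun i => D.a i * y i := by
  rw [mulVec_mulVec, mulVec_mulVec, D.hA]
  ext i
  rw [mulVec_diagonal]

theorem adjugate_eq : (cmat Q₂).adjugate =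
    D.ε • (D.V * diagonal (fun i => ∏ j ∈ Finset.univ.erase i, D.b j) * D.Vᵀ) := by
  have h := congrArg Matrix.adjugate D.hB
  rw [adjugate_diagonal, adjugate_mul_distrib, adjugate_mul_distrib] at h
  rw [← h]
  have h1 : D.V * (D.V.adjugate * ((cmat Q₂).adjugate * D.Vᵀ.adjugate)) * D.Vᵀ =
      (D.V * D.V.adjugate) * (cmat Q₂).adjugate * (D.Vᵀ.adjugate * D.Vᵀ) := by
    simp only [Matrix.mul_assoc]
  rw [h1, mul_adjugate, adjugate_mul, det_transpose, Matrix.smul_mul, Matrix.one_mul,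
    Matrix.smul_mul, Matrix.mul_smul, Matrix.mul_one, smul_smul, smul_smul, ε]
  have : (D.V.det ^ 2)⁻¹ * D.V.det * D.V.det = 1 := by
    rw [mul_assoc, ← pow_two, inv_mul_cancel₀ (pow_ne_zero _ D.det_ne_zero)]
  rw [this, one_smul]

theorem dotProduct_adjugate (p q : Fin 4 → ℂ) : p ⬝ᵥ (cmat Q₂).adjugate *ᵥ q =
    D.ε * ∑ i, (D.Vᵀ *ᵥ p) i * ((∏ j ∈ Finset.univ.erase i, D.b j) * (D.Vᵀ *ᵥ q) i) := by
  rw [D.adjugate_eq, smul_mulVec, dotProduct_smul, smul_eq_mul, ← mulVec_mulVec, ← mulVec_mulVec,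
    dotProduct_mulVec, ← mulVec_transpose, dotProduct]
  simp only [mulVec_diagonal]

theorem two_mul_aeval_eq (y : Fin 4 → ℂ) :
    2 * aeval (D.V *ᵥ y) Q₁ = ∑ i, D.a i * y i ^ 2 := by
  rw [two_mul_aeval D.h₁, dotProduct_comm, dotProduct_mulVec, ← mulVec_transpose,
    D.transpose_mulVec, dotProduct]
  exact Finset.sum_congr rfl fun i _ => by ring

theorem aeval_T_eq (y : Fin 4 → ℂ) (h : aeval (D.V *ᵥ y) Q₁ = 0) :
    aeval (D.V *ᵥ y) (T Q₁ Q₂) =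
      -(1 / 2) * D.ε * ∑ i, (∏ j ∈ Finset.univ.erase i, D.b j) * (D.a i ^ 2 * y i ^ 2) := by
  rw [aeval_T D.h₁, h, D.dotProduct_adjugate, D.transpose_mulVec, mul_zero, zero_sub,
    ← neg_mul, mul_assoc]
  congr 2
  exact Finset.sum_congr rfl fun i _ => by ring

theorem transpose_mulVec_col (m : Fin 4) :
    D.Vᵀ *ᵥ (cmat Q₁ *ᵥ fun k => D.V k m) = fun i => D.a i * (Pi.single m 1 : Fin 4 → ℂ) i := by
  rw [← D.transpose_mulVec, mulVec_single_one]
  rfl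

theorem sum_pderiv_mul (y : Fin 4 → ℂ) (m : Fin 4) :
    ∑ k, aeval (D.V *ᵥ y) (pderiv k Q₁) * D.V k m = D.a m * y m := by
  simp only [aeval_pderiv D.h₁]
  have := congrFun (D.transpose_mulVec y) m
  rw [← this]
  simp only [mulVec, dotProduct, transpose_apply]
  exact Finset.sum_congr rfl fun i _ => mul_comm _ _

theorem sum_pderiv_T_mul (y : Fin 4 → ℂ) (m : Fin 4) :
    ∑ k, aeval (D.V *ᵥ y) (pderiv k (T Q₁ Q₂)) * D.V k m = traceTerm Q₁ Q₂ * (D.a m * y m) -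
      D.ε * ((∏ j ∈ Finset.univ.erase m, D.b j) * (D.a m ^ 2 * y m)) := by
  rw [sum_mul_aeval_pderiv_T D.h₁, D.dotProduct_adjugate, D.transpose_mulVec,
    D.transpose_mulVec_col, Finset.sum_eq_single m]
  · rw [← D.sum_pderiv_mul]
    simp only [aeval_pderiv D.h₁, dotProduct, Pi.single_eq_same]
    congr 1
    · congr 1
      exact Finset.sum_congr rfl fun i _ => mul_comm _ _
    · ring
  · intro i _ him
    simp [him]
  · simp

/-- By the definition of `Q`, `F₂ = P² + 4Q` is the determinant of the pencil, which the
diagonalization splits into linear factors. -/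
theorem aeval_F_eq (w : Fin 2 → ℂ) : aeval w (BinaryQuartic.F (P Q₁ Q₂) (Q Q₁ Q₂)) =
    D.ε * ∏ i, (D.a i * w 0 + D.b i * w 1) := by
  have h1 : BinaryQuartic.F (P Q₁ Q₂) (Q Q₁ Q₂) = (pencil Q₁ Q₂).det := by
    apply MvPolynomial.funext
    intro x
    simp only [BinaryQuartic.F, Q, map_add, map_mul, map_sub, map_pow, eval_C, map_ofNat]
    ring
  have h2 : aeval w (pencil Q₁ Q₂).det = (w 0 • cmat Q₁ + w 1 • cmat Q₂).det := by
    rw [AlgHom.map_det]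
    congr 1
    ext i j
    simp [pencil, cmat, mul_comm]
  have h3 := congrArg Matrix.det (show D.Vᵀ * (w 0 • cmat Q₁ + w 1 • cmat Q₂) * D.V =
      diagonal fun i => D.a i * w 0 + D.b i * w 1 by
    rw [Matrix.mul_add, Matrix.add_mul, Matrix.mul_smul, Matrix.mul_smul, Matrix.smul_mul,
      Matrix.smul_mul, D.hA, D.hB]
    ext i j
    by_cases hij : i = j
    · subst hij; simp [mul_comm]
    · simp [hij])
  rw [det_mul, det_mul, det_transpose, det_diagonal] at h3
  rw [h1, h2, ← h3, ε]
  have := D.det_ne_zero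
  field_simp

/-- The ratios `cᵢ` between the linear factors of `F₂` and the squares of the coordinates. -/
noncomputable def c (i : Fin 4) : ℂ :=
  -(1 / 2) * D.ε * ∏ j ∈ Finset.univ.erase i, (D.a i * D.b j - D.a j * D.b i)

theorem c_ne_zero (i : Fin 4) : D.c i ≠ 0 := by
  refine mul_ne_zero (mul_ne_zero (by norm_num) D.ε_ne_zero) (Finset.prod_ne_zero_iff.2 ?_)
  intro j hj
  exact D.hab i j (Finset.ne_of_mem_erase hj).symm

/-- The central relation for `n = 4`: on the curve the linear factors of `F₂`, taken at `(T₁, -T₂)`,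
are the squares of the diagonal coordinates up to nonzero constants. -/
theorem c_mul_sq (y : Fin 4 → ℂ) (e₁ : aeval (D.V *ᵥ y) Q₁ = 0) (e₂ : aeval (D.V *ᵥ y) Q₂ = 0)
    (i : Fin 4) : D.c i * y i ^ 2 = D.a i * aeval (D.V *ᵥ y) (T Q₁ Q₂) +
      D.b i * aeval (D.V *ᵥ y) (-T Q₂ Q₁) := by
  have h1 := D.two_mul_aeval_eq y
  have h2 := D.swap.two_mul_aeval_eq y
  have h3 := D.aeval_T_eq y e₁
  have h4 := D.swap.aeval_T_eq y e₂
  change 2 * aeval (D.V *ᵥ y) Q₂ = ∑ i, D.b i * y i ^ 2 at h2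
  change aeval (D.V *ᵥ y) (T Q₂ Q₁) = -(1 / 2) * D.ε *
    ∑ i, (∏ j ∈ Finset.univ.erase i, D.a j) * (D.b i ^ 2 * y i ^ 2) at h4
  rw [e₁, mul_zero] at h1
  rw [e₂, mul_zero] at h2
  have key := diagonal_covariant_identity D.a D.b (fun i => y i ^ 2) h1.symm h2.symm i
  rw [map_neg, h3, h4, c]
  linear_combination (1 / 2) * D.ε * key

/-- The diagonal coordinates of a real point. -/
noncomputable def y (x : Fin 4 → ℝ) : Fin 4 → ℂ := D.V⁻¹ *ᵥ fun i => (x i : ℂ)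

theorem V_mulVec_y (x : Fin 4 → ℝ) : D.V *ᵥ D.y x = fun i => (x i : ℂ) := by
  rw [y, mulVec_mulVec, Matrix.mul_nonsing_inv _ (isUnit_iff_ne_zero.2 D.det_ne_zero), one_mulVec]

/-- The value of `T₁` at a real point, as a complex number. -/
noncomputable def u (_ : Diagonalization Q₁ Q₂) (x : Fin 4 → ℝ) : ℂ := eval x (T Q₁ Q₂)

/-- The value of `-T₂` at a real point, as a complex number. -/
noncomputable def v (_ : Diagonalization Q₁ Q₂) (x : Fin 4 → ℝ) : ℂ := eval x (-T Q₂ Q₁)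

theorem c_mul_y_sq {x : Fin 4 → ℝ} (hx : eval x Q₁ = 0 ∧ eval x Q₂ = 0) (i : Fin 4) :
    D.c i * D.y x i ^ 2 = D.a i * D.u x + D.b i * D.v x := by
  have h := D.c_mul_sq (D.y x) (by rw [D.V_mulVec_y, aeval_ofReal, hx.1, Complex.ofReal_zero])
    (by rw [D.V_mulVec_y, aeval_ofReal, hx.2, Complex.ofReal_zero]) i
  rw [h, D.V_mulVec_y, aeval_ofReal, aeval_ofReal]
  rfl

variable (h₁ : Q₁.IsHomogeneous 2) (h₂ : Q₂.IsHomogeneous 2)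

/-- Only finitely many real points lie over finitely many values of `(T₁ : -T₂)`. -/
theorem finite_of_ratio_mem (S : Set (GenusOneModel.quadrics Q₁ Q₂ h₁ h₂).RealPoint) (τ : Set ℂ)
    (hτ : τ.Finite) (hS : ∀ p ∈ S, D.v (GenusOneModel.coords _ p) = 0 ∨
      D.u (GenusOneModel.coords _ p) / D.v (GenusOneModel.coords _ p) ∈ τ) : S.Finite := by
  have hroots : ∀ z : ℂ, {w : ℂ | w ^ 2 = z}.Finite := by
    intro z
    have hp : (Polynomial.X ^ 2 - Polynomial.C z).Monic := by monicity!
    refine ((Polynomial.X ^ 2 - Polynomial.C z).roots.toFinset.finite_toSet).subset fun w hw => ?_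
    have hw : w ^ 2 = z := hw
    simp [Polynomial.mem_roots hp.ne_zero, hw]
  have hpi : ∀ z : Fin 4 → ℂ, {y : Fin 4 → ℂ | ∀ i, y i ^ 2 = z i}.Finite := by
    intro z
    have := Set.Finite.pi' fun i => hroots (z i)
    exact this
  -- After division by `σ`, where `σ²` is `v`, or `u` if `v = 0`, the squares of the diagonal
  -- coordinates depend only on the ratio `u / v`. The inserted vector belongs to `v = 0`. Each
  -- prescribed vector of squares has finitely many roots.
  set W : Set (Fin 4 → ℂ) := insert (fun i => D.a i / D.c i)
    ((fun t i => (D.a i * t + D.b i) / D.c i) '' τ) with hW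
  have hWfin : W.Finite := (hτ.image _).insert _
  have hY : (⋃ z ∈ W, {y : Fin 4 → ℂ | ∀ i, y i ^ 2 = z i}).Finite :=
    hWfin.biUnion fun z _ => hpi z
  refine Set.Finite.of_finite_image (f := Subtype.val)
    (finite_of_rep_eq_smul _ _ (hY.image fun y => D.V *ᵥ y) ?_) Subtype.val_injective.injOn
  rintro _ ⟨p, hp, rfl⟩
  have hx : eval p.1.rep Q₁ = 0 ∧ eval p.1.rep Q₂ = 0 := p.2
  have hcy := D.c_mul_y_sq hx
  have key : ∀ (σ : ℂ), σ ≠ 0 → ∀ z ∈ W, (∀ i, D.a i * D.u p.1.rep + D.b i * D.v p.1.rep =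
      σ ^ 2 * (D.c i * z i)) → ∃ y ∈ (fun y => D.V *ᵥ y) '' ⋃ z ∈ W, {y : Fin 4 → ℂ | ∀ i, y i ^ 2 = z i},
      ∃ c : ℂ, (fun i => (p.1.rep i : ℂ)) = c • y := by
    intro σ hσ z hz hzi
    refine ⟨_, ⟨σ⁻¹ • D.y p.1.rep, Set.mem_biUnion hz fun i => ?_, rfl⟩, σ, ?_⟩
    · have h1 := hcy i
      rw [hzi i] at h1
      have hc := D.c_ne_zero i
      simp only [Pi.smul_apply, smul_eq_mul]
      field_simp
      apply mul_left_cancel₀ hc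
      linear_combination h1
    · change _ = σ • D.V *ᵥ (σ⁻¹ • D.y p.1.rep)
      rw [mulVec_smul, smul_smul, mul_inv_cancel₀ hσ, one_smul, D.V_mulVec_y]
  have hSp := hS p hp
  change D.v p.1.rep = 0 ∨ D.u p.1.rep / D.v p.1.rep ∈ τ at hSp
  by_cases hv : D.v p.1.rep = 0
  -- The covariants have no common zero on the curve, since all diagonal coordinates would vanish
  -- there.
  · have hu : D.u p.1.rep ≠ 0 := by
      intro hu
      have hy0 : D.y p.1.rep = 0 := by
        ext i
        have := hcy i
        rw [hu, hv, mul_zero, mul_zero, add_zero, mul_eq_zero] at this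
        exact pow_eq_zero_iff two_ne_zero |>.1 (this.resolve_left (D.c_ne_zero i))
      have h0 := D.V_mulVec_y p.1.rep
      rw [hy0, mulVec_zero] at h0
      apply p.1.rep_nonzero
      ext i
      have := congrFun h0 i
      simpa using this.symm
    obtain ⟨σ, hσ⟩ := IsAlgClosed.exists_pow_nat_eq (D.u p.1.rep) (n := 2) (by norm_num)
    have hσ0 : σ ≠ 0 := by
      rintro rfl
      exact hu (by rw [← hσ]; ring)
    refine key σ hσ0 _ (Set.mem_insert _ _) fun i => ?_
    have hc := D.c_ne_zero i
    rw [hσ, hv]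
    field_simp
    ring
  · obtain ⟨σ, hσ⟩ := IsAlgClosed.exists_pow_nat_eq (D.v p.1.rep) (n := 2) (by norm_num)
    have hσ0 : σ ≠ 0 := by
      rintro rfl
      exact hv (by rw [← hσ]; ring)
    refine key σ hσ0 _ (Set.mem_insert_of_mem _ ⟨_, hSp.resolve_left hv, rfl⟩) fun i => ?_
    have hc := D.c_ne_zero i
    rw [hσ]
    field_simp

/-- A nontrivial linear relation between the diagonal coordinates, with coefficients depending on
`(T₁ : -T₂)`, holds at only finitely many real points. -/
theorem finite_of_sum_eq_zero (S : Set (GenusOneModel.quadrics Q₁ Q₂ h₁ h₂).RealPoint)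
    {p : Fin 4 → Polynomial ℂ} (hp : p ≠ 0)
    (hS : ∀ P ∈ S, D.v (GenusOneModel.coords _ P) ≠ 0 → ∀ σ : ℂ,
      σ ^ 2 = D.v (GenusOneModel.coords _ P) → ∑ i, (p i).eval (D.u (GenusOneModel.coords _ P) /
        D.v (GenusOneModel.coords _ P)) * (σ⁻¹ * D.y (GenusOneModel.coords _ P) i) = 0) :
    S.Finite := by
  have hfin := finite_setOf_sum_mul_sqrt_eq_zero (α := fun i => D.a i / D.c i)
    (β := fun i => D.b i / D.c i) (fun i j hij => by
      have h1 := D.c_ne_zero i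
      have h2 := D.c_ne_zero j
      have h3 := D.hab i j hij
      have : D.a i / D.c i * (D.b j / D.c j) - D.a j / D.c j * (D.b i / D.c i) =
          (D.a i * D.b j - D.a j * D.b i) / (D.c i * D.c j) := by
        field_simp
      rw [this]
      exact div_ne_zero h3 (mul_ne_zero h1 h2)) hp
  refine D.finite_of_ratio_mem h₁ h₂ S _ hfin fun P hP => ?_
  by_cases hv : D.v (GenusOneModel.coords _ P) = 0
  · exact Or.inl hv
  · right
    obtain ⟨σ, hσ⟩ := IsAlgClosed.exists_pow_nat_eq (D.v (GenusOneModel.coords _ P)) (n := 2)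
      (by norm_num)
    refine ⟨fun i => σ⁻¹ * D.y (GenusOneModel.coords _ P) i, fun i => ?_, hS P hP hv σ hσ⟩
    have hcy := D.c_mul_y_sq (x := GenusOneModel.coords _ P) P.2 i
    have hc := D.c_ne_zero i
    have hσ0 : σ ≠ 0 := by
      rintro rfl
      exact hv (by rw [← hσ]; ring)
    rw [← hσ] at hcy hv ⊢
    field_simp
    linear_combination hcy

/-- A hyperplane contains finitely many real points. -/
theorem finite_of_linear (D : Diagonalization Q₁ Q₂) (h₁ : Q₁.IsHomogeneous 2)
    (h₂ : Q₂.IsHomogeneous 2) {ℓ : Fin 4 → ℝ} (hℓ : ℓ ≠ 0) :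
    {P : (GenusOneModel.quadrics Q₁ Q₂ h₁ h₂).RealPoint |
      ∑ i, ℓ i * GenusOneModel.coords _ P i = 0}.Finite := by
  refine D.finite_of_sum_eq_zero h₁ h₂ _
    (p := fun i => Polynomial.C (((fun k => (ℓ k : ℂ)) ᵥ* D.V) i)) ?_ ?_
  · intro h0
    have h1 : (fun k => (ℓ k : ℂ)) ᵥ* D.V = 0 := by
      ext i
      exact Polynomial.C_eq_zero.1 (congrFun h0 i)
    have h2 := Matrix.eq_zero_of_vecMul_eq_zero D.det_ne_zero h1
    apply hℓ
    ext i
    have := congrFun h2 i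
    simpa using this
  · intro P hP hv σ hσ
    have hP : ∑ i, ℓ i * GenusOneModel.coords _ P i = 0 := hP
    have h1 : (fun k => (ℓ k : ℂ)) ᵥ* D.V ⬝ᵥ D.y (GenusOneModel.coords _ P) = 0 := by
      rw [← dotProduct_mulVec, D.V_mulVec_y, dotProduct]
      exact_mod_cast hP
    simp only [Polynomial.eval_C]
    calc _ = σ⁻¹ * ((fun k => (ℓ k : ℂ)) ᵥ* D.V ⬝ᵥ D.y (GenusOneModel.coords _ P)) := by
          rw [dotProduct, Finset.mul_sum]
          exact Finset.sum_congr rfl fun i _ => by ring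
      _ = 0 := by rw [h1, mul_zero]

/-- A nonzero binary form in `T₁, -T₂` vanishes at finitely many real points. -/
theorem finite_of_bind₁ (D : Diagonalization Q₁ Q₂) (h₁ : Q₁.IsHomogeneous 2)
    (h₂ : Q₂.IsHomogeneous 2) {f : MvPolynomial (Fin 2) ℝ} {d : ℕ} (hf : f.IsHomogeneous d)
    (hf0 : f ≠ 0) : {P : (GenusOneModel.quadrics Q₁ Q₂ h₁ h₂).RealPoint |
      eval (GenusOneModel.coords _ P) (bind₁ ![T Q₁ Q₂, -T Q₂ Q₁] f) = 0}.Finite := by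
  have hm0 : map (algebraMap ℝ ℂ) f ≠ 0 := fun h =>
    hf0 (map_injective _ (algebraMap ℝ ℂ).injective (by rw [h, map_zero]))
  have hm := hf.map (algebraMap ℝ ℂ)
  refine D.finite_of_ratio_mem h₁ h₂ _ _
    ((aeval ![(Polynomial.X : Polynomial ℂ), 1] (map (algebraMap ℝ ℂ) f)).roots.toFinset.finite_toSet)
    fun P hP => ?_
  by_cases hv : D.v (GenusOneModel.coords _ P) = 0
  · exact Or.inl hv
  right
  set x := GenusOneModel.coords _ P with hx
  have hP : eval x (bind₁ ![T Q₁ Q₂, -T Q₂ Q₁] f) = 0 := hP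
  simp only [Finset.mem_coe, Multiset.mem_toFinset,
    Polynomial.mem_roots (aeval_X_one_ne_zero hm hm0), Polynomial.IsRoot, eval_aeval_X_one]
  have h1 : eval ![D.u x, D.v x] (map (algebraMap ℝ ℂ) f) = 0 := by
    have h2 := congrArg (fun z : ℝ => (z : ℂ)) hP
    simp only [Complex.ofReal_zero] at h2
    rw [← aeval_ofReal, aeval_bind₁] at h2
    rw [eval_map, ← aeval_def, ← h2]
    congr 2
    ext i
    fin_cases i
    · simp only [Fin.zero_eta, Matrix.cons_val_zero, aeval_ofReal]; rfl
    · simp only [Fin.mk_one, Matrix.cons_val_one, aeval_ofReal]; rfl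
  have h3 : ![D.u x, D.v x] = D.v x • ![D.u x / D.v x, 1] := by
    ext i
    fin_cases i <;> simp [mul_div_cancel₀, hv]
  rw [h3, eval_smul_of_isHomogeneous hm] at h1
  exact (mul_eq_zero.1 h1).resolve_left (pow_ne_zero _ hv)

end Diagonalization

end QuadricIntersection

/-! ### The Jacobian condition for quadric intersections. -/

namespace QuadricIntersection

open Matrix

/-- A vanishing maximal minor of a `3 × 4` matrix yields a vanishing determinant, on adjoining the
unit vector belonging to the remaining column. -/
theorem exists_det_eq_zero_of_minor (M : Fin 3 → Fin 4 → ℂ) {i j k : Fin 4} (hij : i ≠ j)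
    (hik : i ≠ k) (hjk : j ≠ k) (h : (Matrix.of fun a b => M a (![i, j, k] b)).det = 0) :
    ∃ l, (Matrix.of ![Pi.single l 1, M 0, M 1, M 2]).det = 0 := by
  obtain ⟨w, hw, hw0⟩ := exists_vecMul_eq_zero_iff.2 h
  have hl : ∃ l : Fin 4, ∀ m, m ≠ l → m = i ∨ m = j ∨ m = k := by
    clear * - hij hik hjk
    revert i j k
    decide
  obtain ⟨l, hl⟩ := hl
  -- A relation between the rows of the minor already holds in columns `i`, `j`, `k`; the
  -- coefficient of the unit row cancels what it leaves in column `l`.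
  refine ⟨l, exists_vecMul_eq_zero_iff.1
    ⟨![-∑ a, w a * M a l, w 0, w 1, w 2], fun h0 => hw ?_, ?_⟩⟩
  · ext a
    fin_cases a
    · exact congrFun h0 1
    · exact congrFun h0 2
    · exact congrFun h0 3
  · have h0 := congrFun hw0 0
    have h1 := congrFun hw0 1
    have h2 := congrFun hw0 2
    simp [vecMul, dotProduct, Fin.sum_univ_three] at h0 h1 h2
    ext m
    simp only [vecMul, dotProduct, Fin.sum_univ_four, Fin.sum_univ_three]
    by_cases hm : m = l
    · subst hm
      simp
      ring
    · rcases hl m hm with rfl | rfl | rfl <;> simp [hm, h0, h1, h2]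

namespace Diagonalization

variable {Q₁ Q₂ : MvPolynomial (Fin 4) ℝ} (D : Diagonalization Q₁ Q₂)

theorem aeval_pair_eq (f : MvPolynomial (Fin 2) ℝ) (x : Fin 4 → ℝ) :
    aeval (fun i => (x i : ℂ)) (bind₁ ![T Q₁ Q₂, -T Q₂ Q₁] f) = aeval ![D.u x, D.v x] f := by
  rw [aeval_bind₁]
  congr 2
  ext i
  fin_cases i
  · simp only [Fin.zero_eta, Matrix.cons_val_zero, aeval_ofReal]; rfl
  · simp only [Fin.mk_one, Matrix.cons_val_one, aeval_ofReal]; rfl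

theorem sum_pderiv_bind₁_mul (φ : MvPolynomial (Fin 2) ℝ) (x : Fin 4 → ℝ) (m : Fin 4) :
    ∑ k, aeval (fun i => (x i : ℂ)) (pderiv k (bind₁ ![T Q₁ Q₂, -T Q₂ Q₁] φ)) * D.V k m =
      aeval ![D.u x, D.v x] (pderiv 0 φ) * (traceTerm Q₁ Q₂ * (D.a m * D.y x m) -
        D.ε * ((∏ j ∈ Finset.univ.erase m, D.b j) * (D.a m ^ 2 * D.y x m))) -
      aeval ![D.u x, D.v x] (pderiv 1 φ) * (traceTerm Q₂ Q₁ * (D.b m * D.y x m) -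
        D.ε * ((∏ j ∈ Finset.univ.erase m, D.a j) * (D.b m ^ 2 * D.y x m))) := by
  have h1 := D.sum_pderiv_T_mul (D.y x) m
  have h2 := D.swap.sum_pderiv_T_mul (D.y x) m
  change ∑ k, aeval (D.V *ᵥ D.y x) (pderiv k (T Q₂ Q₁)) * D.V k m =
    traceTerm Q₂ Q₁ * (D.b m * D.y x m) -
      D.ε * ((∏ j ∈ Finset.univ.erase m, D.a j) * (D.b m ^ 2 * D.y x m)) at h2
  rw [V_mulVec_y] at h1 h2
  rw [← h1, ← h2, Finset.mul_sum, Finset.mul_sum, ← Finset.sum_sub_distrib]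
  refine Finset.sum_congr rfl fun k _ => ?_
  rw [pderiv_bind₁, Fin.sum_univ_two, map_add, map_mul, map_mul, D.aeval_pair_eq, D.aeval_pair_eq]
  simp only [Matrix.cons_val_zero, Matrix.cons_val_one, map_neg]
  ring

/-- The condition that the bordered Jacobian determinant vanishes, in diagonal coordinates. -/
theorem exists_sum_eq_zero_of_jacobian :
    ∃ κ : Fin 4 → ℂ, (∀ i, κ i ≠ 0) ∧ ∀ (φ : MvPolynomial (Fin 2) ℝ) (x : Fin 4 → ℝ)
      (i j k : Fin 4), i ≠ j → i ≠ k → j ≠ k →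
      eval x (jacobianDet ![Q₁, Q₂, bind₁ ![T Q₁ Q₂, -T Q₂ Q₁] φ] ![i, j, k]) = 0 →
      ∃ l, ∑ m, κ m * D.V l m * (D.b m * aeval ![D.u x, D.v x] (pderiv 0 φ) -
        D.a m * aeval ![D.u x, D.v x] (pderiv 1 φ)) * ∏ j ∈ Finset.univ.erase m, D.y x j = 0 := by
  obtain ⟨κ, hκ, hdet⟩ := diagonal_jacobian_identity D.ε_ne_zero D.hab
  refine ⟨κ, hκ, fun φ x i j k hij hik hjk h => ?_⟩
  set f := bind₁ ![T Q₁ Q₂, -T Q₂ Q₁] φ with hf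
  obtain ⟨l, hl⟩ := exists_det_eq_zero_of_minor
    (fun a b => aeval (fun i => (x i : ℂ)) (pderiv b (![Q₁, Q₂, f] a))) hij hik hjk (by
      have h1 := congrArg (fun z : ℝ => (z : ℂ)) h
      simp only [Complex.ofReal_zero, ← aeval_ofReal] at h1
      rw [jacobianDet, AlgHom.map_det] at h1
      exact h1)
  refine ⟨l, ?_⟩
  rw [← hdet _ _ _ _ (traceTerm Q₁ Q₂) (traceTerm Q₂ Q₁)]
  -- Multiplication by `V` turns partial derivatives into derivatives along the columns of `V`,
  -- which are explicit in diagonal coordinates, and the unit row into row `l` of `V`.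
  have hmul := congrArg (· * D.V.det) hl
  simp only [zero_mul] at hmul
  rw [← det_mul] at hmul
  rw [← hmul]
  congr 1
  have h1 := D.sum_pderiv_mul (D.y x)
  have h2 := D.swap.sum_pderiv_mul (D.y x)
  change ∀ m, ∑ k, aeval (D.V *ᵥ D.y x) (pderiv k Q₂) * D.V k m = D.b m * D.y x m at h2
  rw [V_mulVec_y] at h1 h2
  ext a m
  rw [Matrix.mul_apply]
  fin_cases a
  · simp [Pi.single_apply]
  · exact (h1 m).symm
  · exact (h2 m).symm
  · exact (D.sum_pderiv_bind₁_mul φ x m).symm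

/-- The coefficients of the relation between the diagonal coordinates at a critical point. -/
noncomputable def relation (κ : Fin 4 → ℂ) (φ : MvPolynomial (Fin 2) ℝ) (l i : Fin 4) :
    Polynomial ℂ :=
  Polynomial.C (κ i * D.V l i) * aeval ![(Polynomial.X : Polynomial ℂ), 1]
    (C (D.b i) * map (algebraMap ℝ ℂ) (pderiv 0 φ) - C (D.a i) * map (algebraMap ℝ ℂ) (pderiv 1 φ)) *
    ∏ j ∈ Finset.univ.erase i,
      (Polynomial.C (D.a j / D.c j) * Polynomial.X + Polynomial.C (D.b j / D.c j))

/-- Row `l` of the invertible matrix `V` has a nonzero entry, and the other factors of the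
corresponding coefficient are nonzero polynomials. -/
theorem relation_ne_zero {κ : Fin 4 → ℂ} (hκ : ∀ i, κ i ≠ 0) {φ : MvPolynomial (Fin 2) ℝ}
    (hφ : φ.IsHomogeneous 4)
    (h : ∀ i, ∃ w : Fin 2 → ℂ, D.b i * aeval w (pderiv 0 φ) - D.a i * aeval w (pderiv 1 φ) ≠ 0)
    (l : Fin 4) : D.relation κ φ l ≠ 0 := by
  obtain ⟨i, hi⟩ : ∃ i, D.V l i ≠ 0 := by
    by_contra hcon
    push Not at hcon
    exact D.det_ne_zero (Matrix.det_eq_zero_of_row_eq_zero l hcon)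
  intro h0
  refine mul_ne_zero (mul_ne_zero ?_ ?_) (Finset.prod_ne_zero_iff.2 fun j _ => ?_) (congrFun h0 i)
  · exact Polynomial.C_ne_zero.2 (mul_ne_zero (hκ i) hi)
  · refine aeval_X_one_ne_zero (m := 3) (((hφ.pderiv.map _).C_mul _).sub ((hφ.pderiv.map _).C_mul _)) ?_
    intro h1
    obtain ⟨w, hw⟩ := h i
    apply hw
    have := congrArg (eval w) h1
    simpa [eval_map, ← aeval_def] using this
  · intro h1
    have ha : D.a j / D.c j = 0 := by simpa using congrArg (Polynomial.coeff · 1) h1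
    have hb : D.b j / D.c j = 0 := by simpa using congrArg (Polynomial.coeff · 0) h1
    have ha := (div_eq_zero_iff.1 ha).resolve_right (D.c_ne_zero j)
    have hb := (div_eq_zero_iff.1 hb).resolve_right (D.c_ne_zero j)
    obtain ⟨k, hk⟩ := exists_ne j
    exact D.hab k j hk (by simp [ha, hb])

variable (h₁ : Q₁.IsHomogeneous 2) (h₂ : Q₂.IsHomogeneous 2)

/-- The determinant is a combination of the products of three of the `y_j`. Multiplied by `∏ y_j`,
each product becomes `y_m ∏_{j ≠ m} y_j²`, and the squares are linear in `t` after scaling. This is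
the nontrivial linear relation `relation` between the `y_m`. -/
theorem finite_of_isCritical {φ : MvPolynomial (Fin 2) ℝ} (hφ : φ.IsHomogeneous 4)
    (h : ∀ i, ∃ w : Fin 2 → ℂ, D.b i * aeval w (pderiv 0 φ) - D.a i * aeval w (pderiv 1 φ) ≠ 0) :
    {P : (GenusOneModel.quadrics Q₁ Q₂ h₁ h₂).RealPoint |
      GenusOneModel.IsCritical (GenusOneModel.quadrics Q₁ Q₂ h₁ h₂)
        (bind₁ ![T Q₁ Q₂, -T Q₂ Q₁] φ) (GenusOneModel.coords _ P)}.Finite := by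
  obtain ⟨κ, hκ, hrel⟩ := D.exists_sum_eq_zero_of_jacobian
  have hfin : (⋃ l, {P : (GenusOneModel.quadrics Q₁ Q₂ h₁ h₂).RealPoint |
      ∑ m, κ m * D.V l m *
        (D.b m * aeval ![D.u (GenusOneModel.coords _ P), D.v (GenusOneModel.coords _ P)] (pderiv 0 φ) -
        D.a m * aeval ![D.u (GenusOneModel.coords _ P), D.v (GenusOneModel.coords _ P)] (pderiv 1 φ)) *
        ∏ j ∈ Finset.univ.erase m, D.y (GenusOneModel.coords _ P) j = 0}).Finite := by
    refine Set.finite_iUnion fun l => ?_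
    refine D.finite_of_sum_eq_zero h₁ h₂ _ (D.relation_ne_zero hκ hφ h l) fun P hP hv σ hσ => ?_
    have hcy := D.c_mul_y_sq (x := GenusOneModel.coords _ P) P.2
    have hP : ∑ m, κ m * D.V l m *
        (D.b m * aeval ![D.u (GenusOneModel.coords _ P), D.v (GenusOneModel.coords _ P)] (pderiv 0 φ) -
        D.a m * aeval ![D.u (GenusOneModel.coords _ P), D.v (GenusOneModel.coords _ P)] (pderiv 1 φ)) *
        ∏ j ∈ Finset.univ.erase m, D.y (GenusOneModel.coords _ P) j = 0 := hP
    generalize GenusOneModel.coords _ P = x at *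
    have hσ0 : σ ≠ 0 := by
      rintro rfl
      exact hv (by rw [← hσ]; ring)
    set t := D.u x / D.v x with ht
    have huv : ![D.u x, D.v x] = D.v x • ![t, 1] := by
      ext i
      fin_cases i <;> simp [ht, mul_div_cancel₀, hv]
    have hpd : ∀ k, aeval ![D.u x, D.v x] (pderiv k φ) = σ ^ 6 * aeval ![t, 1] (pderiv k φ) := by
      intro k
      rw [huv, aeval_smul_of_isHomogeneous hφ.pderiv, ← hσ]
      ring
    have hprod : ∀ m, (∏ j ∈ Finset.univ.erase m,
        (D.a j / D.c j * t + D.b j / D.c j)) * (σ⁻¹ * D.y x m) =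
        (∏ j ∈ Finset.univ.erase m, D.y x j) * (∏ j, D.y x j) * (σ⁻¹) ^ 7 := by
      intro m
      have hj : ∀ j, D.a j / D.c j * t + D.b j / D.c j = σ⁻¹ ^ 2 * D.y x j ^ 2 := by
        intro j
        have hc := D.c_ne_zero j
        have := hcy j
        rw [ht]
        rw [← hσ] at this hv ⊢
        field_simp
        linear_combination -this
      rw [Finset.prod_congr rfl fun j _ => hj j, Finset.prod_mul_distrib, Finset.prod_const,
        Finset.card_erase_of_mem (Finset.mem_univ m), Finset.prod_pow,
        ← Finset.mul_prod_erase _ _ (Finset.mem_univ m), Finset.card_univ, Fintype.card_fin]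
      ring
    -- The power `13` collects `7` from the product of coordinates (`hprod`) and `6` from the cubic
    -- partial derivatives of `φ`, as `v = σ²`.
    calc _ = ∑ m, (κ m * D.V l m *
          (D.b m * aeval ![D.u x, D.v x] (pderiv 0 φ) - D.a m * aeval ![D.u x, D.v x] (pderiv 1 φ)) *
          ∏ j ∈ Finset.univ.erase m, D.y x j) * ((∏ j, D.y x j) * σ⁻¹ ^ 13) := by
          refine Finset.sum_congr rfl fun m _ => ?_
          have hrelm : (D.relation κ φ l m).eval t = κ m * D.V l m *
              (D.b m * aeval ![t, 1] (pderiv 0 φ) - D.a m * aeval ![t, 1] (pderiv 1 φ)) *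
              ∏ j ∈ Finset.univ.erase m, (D.a j / D.c j * t + D.b j / D.c j) := by
            simp [relation, Polynomial.eval_prod, eval_aeval_X_one, eval_map, ← aeval_def]
          rw [hrelm, hpd, hpd, mul_assoc, hprod]
          field_simp
      _ = 0 := by rw [← Finset.sum_mul, hP, zero_mul]
  refine hfin.subset ?_
  rintro P ⟨i, j, k, hij, hik, hjk, h0⟩
  exact Set.mem_iUnion.2 (hrel φ _ i j k hij hik hjk h0)

end Diagonalization

theorem finite_candidates {Q₁ Q₂ : MvPolynomial (Fin 4) ℝ} (h₁ : Q₁.IsHomogeneous 2)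
    (h₂ : Q₂.IsHomogeneous 2) (hΦ : (GenusOneModel.quadrics Q₁ Q₂ h₁ h₂).IsNonsingular) (r : ℝ) :
    ((GenusOneModel.quadrics Q₁ Q₂ h₁ h₂).candidates r).Finite := by
  obtain ⟨D⟩ := exists_diagonalization hΦ
  have hP := isHomogeneous_P Q₁ Q₂
  have hQ := isHomogeneous_Q Q₁ Q₂
  have hform : ∀ s κ : ℝ, (C s * BinaryQuartic.F (P Q₁ Q₂) (Q Q₁ Q₂) +
      C κ * BinaryQuartic.G (P Q₁ Q₂) (Q Q₁ Q₂)).IsHomogeneous 4 := fun s κ =>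
    ((BinaryQuartic.isHomogeneous_F hP hQ).C_mul s).add
      ((BinaryQuartic.isHomogeneous_G hP hQ).C_mul κ)
  have hder := fun {s κ : ℝ} (hsκ : s ≠ 0 ∨ κ ≠ 0) =>
    BinaryQuartic.exists_directional_derivative_ne_zero hP hQ D.ε_ne_zero D.hab D.aeval_F_eq hsκ
  have hne : ∀ {s κ : ℝ}, s ≠ 0 ∨ κ ≠ 0 → C s * BinaryQuartic.F (P Q₁ Q₂) (Q Q₁ Q₂) +
      C κ * BinaryQuartic.G (P Q₁ Q₂) (Q Q₁ Q₂) ≠ 0 := by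
    intro s κ hsκ h0
    obtain ⟨w, hw⟩ := hder hsκ 0
    exact hw (by rw [h0]; simp)
  have hlin : ∀ (i j : Fin 4) (c : ℝ), i ≠ j →
      {P : (GenusOneModel.quadrics Q₁ Q₂ h₁ h₂).RealPoint | GenusOneModel.coords _ P i =
        c * GenusOneModel.coords _ P j}.Finite := by
    intro i j c hij
    refine (D.finite_of_linear h₁ h₂ (ℓ := Pi.single i 1 - Pi.single j c) fun h0 => ?_).subset
      fun P hP => ?_
    · have := congrFun h0 i
      simp [hij] at this
    · have hP : GenusOneModel.coords _ P i = c * GenusOneModel.coords _ P j := hP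
      change ∑ k, _ = _
      simp [sub_mul, Finset.sum_sub_distrib, Pi.single_apply, hP]
  have hF : BinaryQuartic.F (P Q₁ Q₂) (Q Q₁ Q₂) = C 1 * BinaryQuartic.F (P Q₁ Q₂) (Q Q₁ Q₂) +
      C 0 * BinaryQuartic.G (P Q₁ Q₂) (Q Q₁ Q₂) := by simp
  have hS : (GenusOneModel.quadrics Q₁ Q₂ h₁ h₂).shifted r = bind₁ ![T Q₁ Q₂, -T Q₂ Q₁]
      (C r * BinaryQuartic.F (P Q₁ Q₂) (Q Q₁ Q₂) + C 1 * BinaryQuartic.G (P Q₁ Q₂) (Q Q₁ Q₂)) := by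
    simp [GenusOneModel.shifted, GenusOneModel.F, GenusOneModel.G, F, G]
  refine Set.Finite.subset ((Set.finite_iUnion fun i : Fin 4 => Set.finite_iUnion fun j : Fin 4 =>
    Set.Finite.union (s := {p | i ≠ j ∧ GenusOneModel.coords _ p i = 1 * GenusOneModel.coords _ p j})
      (t := {p | i ≠ j ∧ GenusOneModel.coords _ p i = (-1) * GenusOneModel.coords _ p j}) ?_ ?_).union
    (((D.finite_of_bind₁ h₁ h₂ (hform (1 - r) (-1)) (hne (by simp))).union
    (D.finite_of_bind₁ h₁ h₂ (hform (1 + r) 1) (hne (by simp)))).union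
    ((D.finite_of_isCritical h₁ h₂ (hform 1 0) (hder (by simp))).union
    (D.finite_of_isCritical h₁ h₂ (hform r 1) (hder (by simp)))))) ?_
  · by_cases hij : i = j
    · simp [hij]
    · simpa only [ne_eq, hij, not_false_eq_true, true_and] using hlin i j 1 hij
  · by_cases hij : i = j
    · simp [hij]
    · simpa only [ne_eq, hij, not_false_eq_true, true_and] using hlin i j (-1) hij
  · rintro p (⟨i, j, hij, h | h⟩ | (h | h) | ⟨h, -⟩ | h | h)
    · exact Or.inl (Set.mem_iUnion₂.2 ⟨i, j, Or.inl ⟨hij, by rw [h, one_mul]⟩⟩)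
    · exact Or.inl (Set.mem_iUnion₂.2 ⟨i, j, Or.inr ⟨hij, by rw [h, neg_one_mul]⟩⟩)
    · refine Or.inr (Or.inl (Or.inl ?_))
      simp [GenusOneModel.F, GenusOneModel.G, GenusOneModel.shifted, F, G] at h ⊢
      linear_combination h
    · refine Or.inr (Or.inl (Or.inr ?_))
      simp [GenusOneModel.F, GenusOneModel.G, GenusOneModel.shifted, F, G] at h ⊢
      linear_combination h
    · simp at h
    · refine Or.inr (Or.inr (Or.inl ?_))
      rw [← hF]; exact h
    · refine Or.inr (Or.inr (Or.inr ?_))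
      rw [hS] at h; exact h

end QuadricIntersection

/-! ### Common zeros of plane curves. -/

section PlaneCurves

/-- Among the products of components of `f` and `g`, only that of the two top ones reaches the
degree `f.totalDegree + g.totalDegree`. -/
theorem homogeneousComponent_mul_totalDegree {σ R : Type*} [CommRing R] (f g : MvPolynomial σ R) :
    homogeneousComponent (f.totalDegree + g.totalDegree) (f * g) =
      homogeneousComponent f.totalDegree f * homogeneousComponent g.totalDegree g := by
  have hc : ∀ i j, homogeneousComponent (f.totalDegree + g.totalDegree)
      (homogeneousComponent i f * homogeneousComponent j g) =
      if i + j = f.totalDegree + g.totalDegree then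
        homogeneousComponent i f * homogeneousComponent j g else 0 := fun i j =>
    (homogeneousComponent_of_mem ((homogeneousComponent_isHomogeneous i f).mul
      (homogeneousComponent_isHomogeneous j g))).trans (by simp only [eq_comm])
  have hfg : f * g = ∑ i ∈ Finset.range (f.totalDegree + 1), ∑ j ∈ Finset.range (g.totalDegree + 1),
      homogeneousComponent i f * homogeneousComponent j g := by
    rw [← Finset.sum_mul_sum, sum_homogeneousComponent, sum_homogeneousComponent]
  conv_lhs => rw [hfg]
  simp only [map_sum]
  rw [Finset.sum_eq_single f.totalDegree, Finset.sum_eq_single g.totalDegree, hc, if_pos rfl]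
  · intro j _ hj
    rw [hc, if_neg (by omega)]
  · simp
  · intro i hi hne
    refine Finset.sum_eq_zero fun j hj => ?_
    simp only [Finset.mem_range] at hi hj
    rw [hc, if_neg (by omega)]
  · simp

/-- A reducible form is a product of forms of positive degree. -/
theorem exists_homogeneous_factors {n d : ℕ} {U : MvPolynomial (Fin n) ℝ} (hU : U.IsHomogeneous d)
    (h0 : U ≠ 0) (hd : d ≠ 0) (hirr : ¬ Irreducible U) :
    ∃ (a b : ℕ) (V W : MvPolynomial (Fin n) ℝ), a ≠ 0 ∧ b ≠ 0 ∧ a + b = d ∧ V.IsHomogeneous a ∧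
      W.IsHomogeneous b ∧ U = V * W := by
  rw [irreducible_iff] at hirr
  push Not at hirr
  have hunit : ¬ IsUnit U := by
    rw [isUnit_iff_totalDegree_of_isReduced, hU.totalDegree h0]
    exact fun h => hd h.2
  obtain ⟨V, W, hVW, hV, hW⟩ := hirr hunit
  have hV0 : V ≠ 0 := by rintro rfl; simp [hVW] at h0
  have hW0 : W ≠ 0 := by rintro rfl; simp [hVW] at h0
  have hdeg := totalDegree_mul_of_isDomain hV0 hW0
  rw [← hVW, hU.totalDegree h0] at hdeg
  have hpos : ∀ {f : MvPolynomial (Fin n) ℝ}, f ≠ 0 → ¬ IsUnit f → f.totalDegree ≠ 0 := by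
    intro f hf hu h
    apply hu
    rw [totalDegree_eq_zero_iff_eq_C] at h
    rw [h] at hf ⊢
    exact (isUnit_iff_ne_zero.2 fun h => hf (by rw [h, C_0])).map C
  refine ⟨_, _, _, _, hpos hV0 hV, hpos hW0 hW, hdeg.symm, homogeneousComponent_isHomogeneous _ V,
    homogeneousComponent_isHomogeneous _ W, ?_⟩
  rw [← homogeneousComponent_mul_totalDegree, ← hdeg, ← hVW]
  exact ((homogeneousComponent_of_mem hU).trans (if_pos rfl)).symm

/-- Eliminating one variable from two equations. -/
theorem exists_elimination {n : ℕ} {U g : MvPolynomial (Fin (n + 1)) ℝ} (hU : Irreducible U)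
    (hg : ¬ U ∣ g) : ∃ d : MvPolynomial (Fin n) ℝ, d ≠ 0 ∧ ∀ x : Fin (n + 1) → ℝ,
      eval x U = 0 → eval x g = 0 → eval (Fin.tail x) d = 0 := by
  set u := finSuccEquiv ℝ n U with hu
  set v := finSuccEquiv ℝ n g with hv
  have hu_irr : Irreducible u := (MulEquiv.irreducible_iff (finSuccEquiv ℝ n)).2 hU
  have huv : ¬ u ∣ v := fun h => hg ((map_dvd_iff (finSuccEquiv ℝ n)).1 h)
  have hev : ∀ (x : Fin (n + 1) → ℝ) f, eval x f =
      Polynomial.eval (x 0) ((finSuccEquiv ℝ n f).map (eval (Fin.tail x))) := by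
    intro x f
    rw [← eval_eq_eval_mv_eval', Fin.cons_self_tail]
  -- If `U` does not involve the eliminated variable, it serves as `d` itself; otherwise `d` is the
  -- resultant.
  by_cases hdeg : u.natDegree = 0
  · rw [Polynomial.natDegree_eq_zero] at hdeg
    obtain ⟨d, hd⟩ := hdeg
    refine ⟨d, ?_, fun x hx _ => ?_⟩
    · rintro rfl
      exact hu_irr.ne_zero (by rw [← hd, map_zero])
    · rw [hev, ← hu, ← hd] at hx
      simpa using hx
  · let K := FractionRing (MvPolynomial (Fin n) ℝ)
    -- By Gauss's lemma `u` stays irreducible over the fraction field and still does not divide `v`;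
    -- the two are coprime there, so their resultant is nonzero.
    have hprim : u.IsPrimitive := hu_irr.isPrimitive hdeg
    let _ : NormalizedGCDMonoid (MvPolynomial (Fin n) ℝ) := Classical.choice inferInstance
    have hirrK : Irreducible (u.map (algebraMap _ K)) :=
      (hprim.irreducible_iff_irreducible_map_fraction_map (K := K)).1 hu_irr
    have hcop : IsCoprime (u.map (algebraMap _ K)) (v.map (algebraMap _ K)) :=
      hirrK.coprime_iff_not_dvd.2 fun h =>
        huv (hprim.dvd_of_fraction_map_dvd_fraction_map (K := K) h)
    have hinj : Function.Injective (algebraMap (MvPolynomial (Fin n) ℝ) K) :=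
      IsFractionRing.injective _ _
    obtain ⟨p, q, -, -, hpq⟩ := Polynomial.exists_mul_add_mul_eq_C_resultant u v le_rfl le_rfl
      (Or.inl hdeg)
    refine ⟨u.resultant v, fun h0 => ?_, fun x hxu hxg => ?_⟩
    · have h1 := congrArg (algebraMap _ K) h0
      rw [← Polynomial.resultant_map_map, map_zero] at h1
      have h2 := Polynomial.resultant_eq_zero_iff (f := u.map (algebraMap _ K))
        (g := v.map (algebraMap _ K))
      rw [Polynomial.natDegree_map_eq_of_injective hinj,
        Polynomial.natDegree_map_eq_of_injective hinj] at h2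
      exact (h2.1 h1).2 hcop
    · have h1 := congrArg (fun f => Polynomial.eval (x 0) (f.map (eval (Fin.tail x)))) hpq
      rw [hev, ← hu] at hxu
      rw [hev, ← hv] at hxg
      simp only [Polynomial.map_add, Polynomial.map_mul, Polynomial.eval_add, Polynomial.eval_mul,
        hxu, hxg, zero_mul, Polynomial.map_C, Polynomial.eval_C, add_zero] at h1
      exact h1.symm

/-- A polynomial that vanishes on a line through the origin vanishes there componentwise. -/
theorem eval_homogeneousComponent_eq_zero {σ : Type*} {d : MvPolynomial σ ℝ} {x : σ → ℝ}
    (h : ∀ c : ℝ, eval (c • x) d = 0) (m : ℕ) : eval x (homogeneousComponent m d) = 0 := by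
  set p : Polynomial ℝ := ∑ i ∈ Finset.range (d.totalDegree + 1),
    Polynomial.C (eval x (homogeneousComponent i d)) * Polynomial.X ^ i with hp
  have hp0 : p = 0 := by
    apply Polynomial.funext
    intro c
    rw [Polynomial.eval_zero, ← h c]
    conv_rhs => rw [← sum_homogeneousComponent d]
    rw [hp, Polynomial.eval_finsetSum, map_sum]
    refine Finset.sum_congr rfl fun i _ => ?_
    rw [eval_smul_of_isHomogeneous (homogeneousComponent_isHomogeneous i d)]
    rw [Polynomial.eval_mul, Polynomial.eval_C, Polynomial.eval_pow, Polynomial.eval_X, mul_comm]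
  by_cases hm : m < d.totalDegree + 1
  · have := congrArg (Polynomial.coeff · m) hp0
    simpa [hp, Polynomial.finsetSum_coeff, Polynomial.coeff_X_pow, hm] using this
  · rw [homogeneousComponent_eq_zero _ _ (by omega), map_zero]

/-- Two plane curves, one of them irreducible and not a component of the other one, meet in
finitely many points. -/
theorem finite_setOf_common_zero {U g : MvPolynomial (Fin 3) ℝ} {d e : ℕ} (hU : U.IsHomogeneous d)
    (hg : g.IsHomogeneous e) (hirr : Irreducible U) (hUg : ¬ U ∣ g) :
    {p : Projectivization ℝ (Fin 3 → ℝ) | eval p.rep U = 0 ∧ eval p.rep g = 0}.Finite := by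
  have hratio : ∀ i j : Fin 3, i ≠ j → ∃ T : Set ℝ, T.Finite ∧ ∀ x : Fin 3 → ℝ, eval x U = 0 →
      eval x g = 0 → x j ≠ 0 → x i / x j ∈ T := by
    intro i j hij
    -- The permutation makes the third coordinate the one to be eliminated, leaving an equation in
    -- `x i` and `x j`.
    obtain ⟨s, hsi, hsj⟩ : ∃ s : Equiv.Perm (Fin 3), s 1 = i ∧ s 2 = j := by
      clear * - hij
      revert i j
      decide
    have hinv : ∀ f : MvPolynomial (Fin 3) ℝ, ∀ x : Fin 3 → ℝ,
        eval (x ∘ s) (rename s.symm f) = eval x f := by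
      intro f x
      rw [eval_rename, Function.comp_assoc, Equiv.self_comp_symm, Function.comp_id]
    obtain ⟨D, hD0, hD⟩ := exists_elimination (U := rename s.symm U) (g := rename s.symm g)
      ((MulEquiv.irreducible_iff (renameEquiv ℝ s.symm)).2 hirr)
      (fun h => hUg ((map_dvd_iff (renameEquiv ℝ s.symm)).1 h))
    obtain ⟨m, hm⟩ : ∃ m, homogeneousComponent m D ≠ 0 := by
      by_contra hcon
      push Not at hcon
      exact hD0 (by rw [← sum_homogeneousComponent D, Finset.sum_eq_zero fun i _ => hcon i])
    have hmh := homogeneousComponent_isHomogeneous m D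
    refine ⟨_, (aeval ![(Polynomial.X : Polynomial ℝ), 1]
      (homogeneousComponent m D)).roots.toFinset.finite_toSet, fun x hxU hxg hxj => ?_⟩
    simp only [Finset.mem_coe, Multiset.mem_toFinset,
      Polynomial.mem_roots (aeval_X_one_ne_zero hmh hm), Polynomial.IsRoot, eval_aeval_X_one]
    -- The eliminant is not known to be homogeneous, but it vanishes on the whole line through `(x
    -- i, x j)`, hence so does each component.
    have h0 : eval ![x i, x j] (homogeneousComponent m D) = 0 := by
      refine eval_homogeneousComponent_eq_zero (fun c => ?_) m
      have h1 := hD ((c • x) ∘ s) (by rw [hinv, eval_smul_of_isHomogeneous hU, hxU, mul_zero])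
        (by rw [hinv, eval_smul_of_isHomogeneous hg, hxg, mul_zero])
      rw [← h1]
      congr 2
      ext k
      fin_cases k <;> simp [Fin.tail, hsi, hsj]
    have h3 : ![x i, x j] = x j • ![x i / x j, 1] := by
      ext k
      fin_cases k <;> simp [mul_div_cancel₀, hxj]
    rw [h3, eval_smul_of_isHomogeneous hmh] at h0
    exact (mul_eq_zero.1 h0).resolve_left (pow_ne_zero _ hxj)
  choose! T hTfin hT using hratio
  have hY : (⋃ k : Fin 3, {y : Fin 3 → ℝ | ∀ i, y i ∈ if i = k then {1} else T i k}).Finite :=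
    Set.finite_iUnion fun k => Set.Finite.pi' fun i => by
      split_ifs with hik
      · exact Set.finite_singleton _
      · exact hTfin i k hik
  refine finite_of_rep_eq_smul _ _ (hY.image fun y i => (y i : ℂ)) ?_
  rintro p ⟨hpU, hpg⟩
  obtain ⟨k, hk⟩ : ∃ k, p.rep k ≠ 0 := by
    by_contra hcon
    push Not at hcon
    exact p.rep_nonzero (funext hcon)
  refine ⟨_, ⟨(p.rep k)⁻¹ • p.rep, Set.mem_iUnion.2 ⟨k, fun i => ?_⟩, rfl⟩, p.rep k, ?_⟩
  · split_ifs with hik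
    · subst hik
      simp [hk]
    · have := hT i k hik p.rep hpU hpg hk
      rwa [div_eq_inv_mul] at this
  · ext i
    have : (p.rep k : ℂ) ≠ 0 := by exact_mod_cast hk
    simp [this]

end PlaneCurves

/-! ### Irreducibility of a nonsingular cubic. -/

namespace TernaryCubic

variable {U : MvPolynomial (Fin 3) ℝ}

theorem linear_form {n : ℕ} {f : MvPolynomial (Fin n) ℝ} (hf : f.IsHomogeneous 1) :
    ∃ a : Fin n → ℝ, f = ∑ i, C (a i) * X i := by
  obtain ⟨g, hg, rfl⟩ := exists_eq_sum_X_mul (d := 0) hf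
  choose c hc using fun i => exists_eq_C_of_isHomogeneous_zero (hg i)
  exact ⟨c, Finset.sum_congr rfl fun i _ => by rw [hc, mul_comm]⟩

/-- A line and a conic in the complex projective plane meet. -/
theorem exists_common_zero {V W : MvPolynomial (Fin 3) ℝ} (hV : V.IsHomogeneous 1)
    (hW : W.IsHomogeneous 2) : ∃ x : Fin 3 → ℂ, x ≠ 0 ∧ aeval x V = 0 ∧ aeval x W = 0 := by
  obtain ⟨a, rfl⟩ := linear_form hV
  obtain ⟨g, hg, rfl⟩ := exists_eq_sum_X_mul (d := 1) hW
  choose c hc using fun i => linear_form (hg i)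
  obtain ⟨e, f, he, hf, hef⟩ : ∃ e f : Fin 3 → ℂ, ∑ i, a i * e i = 0 ∧ ∑ i, a i * f i = 0 ∧
      ∀ s t : ℂ, (s ≠ 0 ∨ t ≠ 0) → s • e + t • f ≠ 0 := by
    by_cases h0 : a 0 = 0
    · by_cases h1 : a 1 = 0
      · refine ⟨![1, 0, 0], ![0, 1, 0], by simp [Fin.sum_univ_three, h0],
          by simp [Fin.sum_univ_three, h1], fun s t hst h => ?_⟩
        have e0 := congrFun h 0
        have e1 := congrFun h 1
        simp at e0 e1
        simp [e0, e1] at hst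
      · refine ⟨![1, 0, 0], ![0, -a 2, a 1], by simp [Fin.sum_univ_three, h0],
          by simp [Fin.sum_univ_three, h0]; ring, fun s t hst h => ?_⟩
        have e0 := congrFun h 0
        have e1 := congrFun h 2
        simp [h1] at e0 e1
        simp [e0, e1] at hst
    · refine ⟨![-a 1, a 0, 0], ![-a 2, 0, a 0], by simp [Fin.sum_univ_three]; ring,
          by simp [Fin.sum_univ_three]; ring, fun s t hst h => ?_⟩
      have e0 := congrFun h 1
      have e1 := congrFun h 2
      simp [h0] at e0 e1
      simp [e0, e1] at hst
  set q : (Fin 3 → ℂ) → ℂ := fun x => ∑ i, x i * ∑ j, c i j * x j with hq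
  have hqW : ∀ x : Fin 3 → ℂ, aeval x (∑ i, X i * g i) = q x := by
    intro x
    simp [hc, hq]
  have hV : ∀ s t : ℂ, aeval (s • e + t • f) (∑ i, C (a i) * X i) = 0 := by
    intro s t
    simp only [Fin.sum_univ_three] at he hf
    simp only [map_add, map_mul, aeval_C, aeval_X, Complex.coe_algebraMap, Pi.add_apply,
      Pi.smul_apply, smul_eq_mul, Fin.sum_univ_three]
    linear_combination s * he + t * hf
  by_cases hqe : q e = 0
  -- On the line spanned by `e` and `f` the conic is a binary quadratic form: either it vanishes at
  -- `e`, or it has a zero `s • e + f`.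
  · exact ⟨e, by simpa using hef 1 0 (by simp), by simpa using hV 1 0, by rw [hqW, hqe]⟩
  · obtain ⟨r, hr⟩ := IsAlgClosed.exists_pow_nat_eq
      (discrim (q e) (q (e + f) - q e - q f) (q f)) (n := 2) (by norm_num)
    obtain ⟨s, hs⟩ := exists_quadratic_eq_zero hqe ⟨r, by rw [← hr, pow_two]⟩
    refine ⟨s • e + (1 : ℂ) • f, hef s 1 (by simp), hV s 1, ?_⟩
    rw [hqW, ← hs]
    simp only [hq, Fin.sum_univ_three, Pi.add_apply, Pi.smul_apply, smul_eq_mul]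
    ring

theorem ne_zero_of_isNonsingular {hU : U.IsHomogeneous 3}
    (hΦ : (GenusOneModel.cubic U hU).IsNonsingular) : U ≠ 0 := by
  rintro rfl
  obtain ⟨i, hi⟩ := hΦ 1 one_ne_zero (map_zero _)
  simp at hi

/-- A factorization would consist of a line and a conic, and the gradient of the product vanishes at
a common complex point. -/
theorem irreducible {hU : U.IsHomogeneous 3} (hΦ : (GenusOneModel.cubic U hU).IsNonsingular) :
    Irreducible U := by
  by_contra hirr
  obtain ⟨a, b, V, W, ha, hb, hab, hV, hW, rfl⟩ :=
    exists_homogeneous_factors hU (ne_zero_of_isNonsingular hΦ) (by norm_num) hirr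
  have key : ∃ x : Fin 3 → ℂ, x ≠ 0 ∧ aeval x V = 0 ∧ aeval x W = 0 := by
    obtain ⟨rfl, rfl⟩ | ⟨rfl, rfl⟩ : (a = 1 ∧ b = 2) ∨ (a = 2 ∧ b = 1) := by omega
    · exact exists_common_zero hV hW
    · obtain ⟨x, hx, h1, h2⟩ := exists_common_zero hW hV
      exact ⟨x, hx, h2, h1⟩
  obtain ⟨x, hx, h1, h2⟩ := key
  obtain ⟨i, hi⟩ := hΦ x hx (by rw [map_mul, h1, zero_mul])
  rw [pderiv_mul, map_add, map_mul, map_mul, h1, h2, mul_zero, zero_mul, add_zero] at hi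
  exact hi rfl

end TernaryCubic

/-! ### Orders of vanishing along an arc. -/

section LocalExpansion

theorem derivative_aeval {n : ℕ} (γ : Fin n → Polynomial ℝ) (f : MvPolynomial (Fin n) ℝ) :
    Polynomial.derivative (aeval γ f) =
      ∑ i, aeval γ (pderiv i f) * Polynomial.derivative (γ i) := by
  induction f using MvPolynomial.induction_on with
  | C a => simp
  | add p q hp hq => simp only [map_add, hp, hq, add_mul, Finset.sum_add_distrib]
  | mul_X p j hp =>
    have h1 : ∀ i, aeval γ (pderiv i (p * X j)) * Polynomial.derivative (γ i) =
        aeval γ (pderiv i p) * Polynomial.derivative (γ i) * γ j +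
        if i = j then aeval γ p * Polynomial.derivative (γ j) else 0 := by
      intro i
      rw [pderiv_mul, map_add, map_mul, map_mul, aeval_X, add_mul]
      congr 1
      · ring
      · split_ifs with hij
        · rw [hij, pderiv_X_self, map_one, mul_one]
        · rw [pderiv_X_of_ne fun h => hij h.symm, map_zero, mul_zero, zero_mul]
    rw [map_mul, aeval_X, Polynomial.derivative_mul, hp, Finset.sum_congr rfl fun i _ => h1 i,
      Finset.sum_add_distrib, Finset.sum_mul, Finset.sum_ite_eq' Finset.univ j]
    simp

theorem aeval_euler {n d : ℕ} {f : MvPolynomial (Fin n) ℝ} (hf : f.IsHomogeneous d)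
    (γ : Fin n → Polynomial ℝ) :
    ∑ i, aeval γ (pderiv i f) * γ i = (d : Polynomial ℝ) * aeval γ f := by
  have h := congrArg (aeval γ) hf.sum_X_mul_pderiv
  simp only [map_sum, map_mul, aeval_X, nsmul_eq_mul, map_natCast] at h
  rw [← h]
  exact Finset.sum_congr rfl fun i _ => mul_comm _ _

theorem dvd_aeval_sub_aeval {n : ℕ} {γ δ : Fin n → Polynomial ℝ} {m : Polynomial ℝ}
    (h : ∀ i, m ∣ γ i - δ i) (f : MvPolynomial (Fin n) ℝ) : m ∣ aeval γ f - aeval δ f := by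
  induction f using MvPolynomial.induction_on with
  | C a => simp
  | add p q hp hq =>
    rw [map_add, map_add, add_sub_add_comm]
    exact dvd_add hp hq
  | mul_X p j hp =>
    have : aeval γ (p * X j) - aeval δ (p * X j) =
        (aeval γ p - aeval δ p) * γ j + aeval δ p * (γ j - δ j) := by
      simp only [map_mul, aeval_X]
      ring
    rw [this]
    exact dvd_add (hp.mul_right _) ((h j).mul_left _)

/-- A form of the Jacobian determinant restricted to an arc. -/
theorem jacobian_arc_identity {R : Type*} [CommRing R] (L u f g h : Fin 3 → R) :
    u 1 * ((∑ i, f i * g i) * (∑ i, L i * h i) - (∑ i, f i * h i) * ∑ i, L i * g i) =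
      (g 2 * h 0 - g 0 * h 2) * (Matrix.of ![L, u, f]).det +
      (L 0 * h 0 * f 1 - L 1 * (h 0 * f 0 + h 2 * f 2) + L 2 * h 2 * f 1) * (∑ i, u i * g i) -
      (L 0 * g 0 * f 1 - L 1 * (g 0 * f 0 + g 2 * f 2) + L 2 * g 2 * f 1) * ∑ i, u i * h i := by
  simp only [Fin.sum_univ_three, Matrix.det_fin_three, Matrix.of_apply, Matrix.cons_val_zero,
    Matrix.cons_val_one, Matrix.cons_val]
  ring

/-- Along an arc on a plane curve to high order, a form whose Jacobian determinant with the curve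
and a linear form `λ` vanishes satisfies `6 φ λ' = φ' λ` to high order. -/
theorem dvd_of_dvd_jacobian {U f : MvPolynomial (Fin 3) ℝ} {N m n : ℕ} (hU : U.IsHomogeneous m)
    (hf : f.IsHomogeneous n) {γ : Fin 3 → Polynomial ℝ} {L : Fin 3 → ℝ}
    (hγ : Polynomial.X ^ (N + 1) ∣ aeval γ U)
    (hy : (aeval γ (pderiv 1 U)).coeff 0 ≠ 0)
    (h : U ∣ (Matrix.of ![fun i => C (L i), fun i => pderiv i U, fun i => pderiv i f]).det) :
    Polynomial.X ^ N ∣ (n : Polynomial ℝ) * aeval γ f *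
      Polynomial.derivative (∑ i, Polynomial.C (L i) * γ i) -
      Polynomial.derivative (aeval γ f) * ∑ i, Polynomial.C (L i) * γ i := by
  have hγN : Polynomial.X ^ N ∣ aeval γ U := (pow_dvd_pow _ (Nat.le_succ N)).trans hγ
  have key := jacobian_arc_identity (fun i => Polynomial.C (L i)) (fun i => aeval γ (pderiv i U))
    (fun i => aeval γ (pderiv i f)) γ fun i => Polynomial.derivative (γ i)
  have hL : Polynomial.derivative (∑ i, Polynomial.C (L i) * γ i) =
      ∑ i, Polynomial.C (L i) * Polynomial.derivative (γ i) := by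
    rw [Polynomial.derivative_sum]
    exact Finset.sum_congr rfl fun i _ => by rw [Polynomial.derivative_C_mul]
  have hdet : (Matrix.of ![fun i => Polynomial.C (L i), fun i => aeval γ (pderiv i U),
      fun i => aeval γ (pderiv i f)]).det = aeval γ (Matrix.of ![fun i => C (L i),
        fun i => pderiv i U, fun i => pderiv i f]).det := by
    rw [AlgHom.map_det]
    congr 1
    refine Matrix.ext fun i j => ?_
    fin_cases i
    · exact (aeval_C γ (L j)).symm
    · rfl
    · rfl
  rw [aeval_euler hf, aeval_euler hU, ← derivative_aeval, ← derivative_aeval, ← hL, hdet] at key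
  -- Differentiation costs one order, which is why contact of order `N + 1` is assumed.
  have hN : Polynomial.X ^ N ∣ Polynomial.derivative (aeval γ U) := by
    have := Polynomial.pow_sub_one_dvd_derivative_of_pow_dvd hγ
    rwa [Nat.add_sub_cancel] at this
  have hdvd : Polynomial.X ^ N ∣ aeval γ (pderiv 1 U) * ((n : Polynomial ℝ) * aeval γ f *
      Polynomial.derivative (∑ i, Polynomial.C (L i) * γ i) -
      Polynomial.derivative (aeval γ f) * ∑ i, Polynomial.C (L i) * γ i) := by
    rw [key]
    refine dvd_sub (dvd_add ((hγN.trans (map_dvd _ h)).mul_left _)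
      ((hγN.mul_left _).mul_left _)) (hN.mul_left _)
  -- The factor `∂U/∂x_1` along the arc has nonzero constant term and cancels.
  refine Polynomial.prime_X.pow_dvd_of_dvd_mul_left _ ?_ hdvd
  rwa [Polynomial.X_dvd_iff]

/-- If `6 φ λ' = φ' λ` to high order and `λ` has small positive order, then `φ` vanishes to high
order. -/
theorem X_pow_three_dvd {φ μ : Polynomial ℝ} {o : ℕ} (hμ : μ.coeff 0 ≠ 0)
    (h : Polynomial.X ^ (o + 1 + 2) ∣ ((6 : ℕ) : Polynomial ℝ) * φ *
      Polynomial.derivative (Polynomial.X ^ (o + 1) * μ) -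
      Polynomial.derivative φ * (Polynomial.X ^ (o + 1) * μ)) :
    Polynomial.X ^ 3 ∣ φ := by
  set χ : Polynomial ℝ := Polynomial.C (6 * (o + 1 : ℝ)) * (φ * μ) +
    Polynomial.X * (Polynomial.C 6 * (φ * Polynomial.derivative μ) - Polynomial.derivative φ * μ)
    with hχ
  have h1 : ((6 : ℕ) : Polynomial ℝ) * φ *
      Polynomial.derivative (Polynomial.X ^ (o + 1) * μ) -
      Polynomial.derivative φ * (Polynomial.X ^ (o + 1) * μ) = Polynomial.X ^ o * χ := by
    rw [hχ, Polynomial.derivative_mul, Polynomial.derivative_X_pow]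
    simp only [Nat.add_sub_cancel, Polynomial.C_mul, Polynomial.C_add, map_natCast, map_ofNat,
      map_one, Nat.cast_add, Nat.cast_one, Nat.cast_ofNat]
    ring
  rw [h1, add_assoc, pow_add, mul_dvd_mul_iff_left (pow_ne_zero _ Polynomial.X_ne_zero),
    Polynomial.X_pow_dvd_iff] at h
  have c0 := h 0 (by norm_num)
  have c1 := h 1 (by norm_num)
  have c2 := h 2 (by norm_num)
  rw [hχ] at c0 c1 c2
  have ho : (0 : ℝ) ≤ o := Nat.cast_nonneg o
  have m2 : ∀ p q : Polynomial ℝ, (p * q).coeff 2 =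
      p.coeff 0 * q.coeff 2 + p.coeff 1 * q.coeff 1 + p.coeff 2 * q.coeff 0 := by
    intro p q
    rw [Polynomial.coeff_mul, show Finset.HasAntidiagonal.antidiagonal 2 = {(0, 2), (1, 1), (2, 0)} from rfl]
    simp [add_assoc]
  have x1 : ∀ p : Polynomial ℝ, (Polynomial.X * p).coeff 1 = p.coeff 0 := fun p =>
    Polynomial.coeff_X_mul p 0
  have x2 : ∀ p : Polynomial ℝ, (Polynomial.X * p).coeff 2 = p.coeff 1 := fun p =>
    Polynomial.coeff_X_mul p 1
  simp only [Polynomial.coeff_add, Polynomial.coeff_C_mul, Polynomial.coeff_X_mul_zero, x1, x2,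
    Polynomial.coeff_sub] at c0 c1 c2
  simp only [Polynomial.mul_coeff_zero, Polynomial.mul_coeff_one, m2,
    Polynomial.coeff_derivative] at c0 c1 c2
  -- Once the lower coefficients of `φ` vanish, the coefficient of `χ` in degree `k ≤ 2` is `(6(o +
  -- 1) - k) μ_0 φ_k` with a positive integer factor.
  have p0 : φ.coeff 0 = 0 := by
    have : (6 * (o + 1 : ℝ)) * μ.coeff 0 * φ.coeff 0 = 0 := by linear_combination c0
    exact (mul_eq_zero.1 this).resolve_left (mul_ne_zero (by positivity) hμ)
  rw [p0] at c1 c2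
  have p1 : φ.coeff 1 = 0 := by
    have : (6 * (o : ℝ) + 5) * μ.coeff 0 * φ.coeff 1 = 0 := by
      push_cast at c1
      linear_combination c1
    exact (mul_eq_zero.1 this).resolve_left (mul_ne_zero (by positivity) hμ)
  rw [p1] at c2
  have p2 : φ.coeff 2 = 0 := by
    have : (6 * (o : ℝ) + 4) * μ.coeff 0 * φ.coeff 2 = 0 := by
      push_cast at c2
      linear_combination c2
    exact (mul_eq_zero.1 this).resolve_left (mul_ne_zero (by positivity) hμ)
  rw [Polynomial.X_pow_dvd_iff]
  intro d hd
  interval_cases d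
  exacts [p0, p1, p2]

end LocalExpansion

/-! ### Covariants of a cubic in tangent normal form. -/

section Bordered

/-- This is minus the quadratic form of the adjugate of `A` at `v`, written out so that `Θ` can be
expanded explicitly. -/
theorem det_bordered {R : Type*} [CommRing R] (A : Matrix (Fin 3) (Fin 3) R) (v : Fin 3 → R) :
    (Matrix.fromBlocks A (Matrix.of fun i (_ : Unit) => v i) (Matrix.of fun (_ : Unit) j => v j)
      0).det = -((A 1 1 * A 2 2 - A 1 2 * A 2 1) * (v 0 * v 0) +
      (A 0 0 * A 2 2 - A 0 2 * A 2 0) * (v 1 * v 1) +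
      (A 0 0 * A 1 1 - A 0 1 * A 1 0) * (v 2 * v 2) -
      (A 0 1 * A 2 2 - A 0 2 * A 2 1 + A 1 0 * A 2 2 - A 1 2 * A 2 0) * (v 0 * v 1) +
      (A 0 1 * A 1 2 - A 0 2 * A 1 1 + A 1 0 * A 2 1 - A 1 1 * A 2 0) * (v 0 * v 2) -
      (A 0 0 * A 1 2 - A 0 2 * A 1 0 + A 0 0 * A 2 1 - A 0 1 * A 2 0) * (v 1 * v 2)) := by
  let e : Fin 4 ≃ Fin 3 ⊕ Unit := Equiv.ofBijective
    ![Sum.inl 0, Sum.inl 1, Sum.inl 2, Sum.inr ()] (by decide)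
  rw [← Matrix.det_submatrix_equiv_self e]
  have e0 : e 0 = Sum.inl 0 := rfl
  have e1 : e 1 = Sum.inl 1 := rfl
  have e2 : e 2 = Sum.inl 2 := rfl
  have e3 : e 3 = Sum.inr () := rfl
  rw [Matrix.det_succ_row_zero]
  simp only [Fin.sum_univ_four, Matrix.det_fin_three, Matrix.submatrix_apply]
  simp [Fin.succAbove, e0, e1, e2, e3]
  ring

end Bordered

namespace TernaryCubic

/-- A ternary cubic through `(0 : 0 : 1)` with tangent line `x₂ = 0` there. -/
noncomputable def tangentForm (e a b c d : ℝ) : MvPolynomial (Fin 3) ℝ :=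
  X 1 * X 2 ^ 2 + C e * X 0 ^ 2 * X 2 + C a * X 0 ^ 3 + C b * X 0 ^ 2 * X 1 +
    C c * X 0 * X 1 ^ 2 + C d * X 1 ^ 3

variable (e a b c d : ℝ)

theorem H_tangentForm : H (tangentForm e a b c d) =
    C (-12 * c * e) * X 0 * X 1 * X 2 + C (-12 * d * e) * X 1 ^ 2 * X 2 + C (4 * e) * X 2 ^ 3 +
    C (-12 * a * c + 4 * b ^ 2 + 12 * d * e ^ 2) * X 0 ^ 2 * X 1 +
    C (-36 * a * d + 4 * b * c) * X 0 * X 1 ^ 2 + C (12 * a) * X 0 * X 2 ^ 2 +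
    C (-12 * b * d + 4 * c ^ 2) * X 1 ^ 3 + C (4 * b) * X 1 * X 2 ^ 2 +
    C (-8 * b * e) * X 0 ^ 2 * X 2 + C (4 * c * e ^ 2) * X 0 ^ 3 := by
  apply MvPolynomial.funext
  intro x
  simp [H, hessianMatrix, Matrix.det_fin_three, tangentForm, pderiv_X, -Nat.cast_ofNat]
  push_cast
  ring

theorem isHomogeneous_tangentForm : (tangentForm e a b c d).IsHomogeneous 3 := by
  have h := isHomogeneous_X (R := ℝ) (σ := Fin 3)
  have m : ∀ (r : ℝ) (i j k : Fin 3), (C r * (X i * X j * X k) :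
      MvPolynomial (Fin 3) ℝ).IsHomogeneous 3 := fun r i j k => (((h i).mul (h j)).mul (h k)).C_mul r
  have : tangentForm e a b c d = C 1 * (X 1 * X 2 * X 2) + C e * (X 0 * X 0 * X 2) +
      C a * (X 0 * X 0 * X 0) + C b * (X 0 * X 0 * X 1) + C c * (X 0 * X 1 * X 1) +
      C d * (X 1 * X 1 * X 1) := by
    rw [tangentForm, C_1]
    ring
  rw [this]
  exact (((((m _ _ _ _).add (m _ _ _ _)).add (m _ _ _ _)).add (m _ _ _ _)).add (m _ _ _ _)).add
    (m _ _ _ _)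

theorem eval_aeval_arc (γ : Fin 3 → Polynomial ℝ) (f : MvPolynomial (Fin 3) ℝ) (t : ℝ) :
    Polynomial.eval t (aeval γ f) = eval (fun i => Polynomial.eval t (γ i)) f := by
  induction f using MvPolynomial.induction_on with
  | C a => simp
  | add p q hp hq => simp [hp, hq]
  | mul_X p i hp => simp [hp]

/-- The arc `(t, -t², 1)` agrees with the branch of the curve at `(0 : 0 : 1)` to third order; only
the coefficients below `t³` are used later. The same holds for `Θ` and, with the arc `(t, 0, 1)`, at
a flex. -/
theorem nonflex_H : ∃ r, aeval ![Polynomial.X, -Polynomial.X ^ 2, 1] (H (tangentForm 1 0 b c d)) =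
    Polynomial.C 4 + Polynomial.C (-12 * b) * Polynomial.X ^ 2 + Polynomial.X ^ 3 * r := by
  refine ⟨Polynomial.C (16 * c) +
      Polynomial.C (-24 * d - 4 * b ^ 2) * Polynomial.X +
      Polynomial.C (4 * b * c) * Polynomial.X ^ 2 +
      Polynomial.C (-4 * c ^ 2 + 12 * b * d) * Polynomial.X ^ 3, ?_⟩
  apply Polynomial.funext
  intro t
  rw [H_tangentForm, eval_aeval_arc]
  simp
  ring

theorem nonflex_Θ : ∃ r, aeval ![Polynomial.X, -Polynomial.X ^ 2, 1] (Θ (tangentForm 1 0 b c d)) =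
    Polynomial.C (128 * b) + Polynomial.C (-576 * c) * Polynomial.X +
    Polynomial.C (1728 * d + 960 * b ^ 2) * Polynomial.X ^ 2 + Polynomial.X ^ 3 * r := by
  refine ⟨Polynomial.C (-2240 * b * c) +
      Polynomial.C (2880 * c ^ 2 - 1344 * b * d - 192 * b ^ 3) * Polynomial.X +
      Polynomial.C (-6528 * c * d) * Polynomial.X ^ 2 +
      Polynomial.C (6528 * d ^ 2 - 1856 * b * c ^ 2 + 6784 * b ^ 2 * d + 768 * b ^ 4) *
        Polynomial.X ^ 3 +
      Polynomial.C (576 * c ^ 3 + 1536 * b * c * d - 1920 * b ^ 3 * c) * Polynomial.X ^ 4 +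
      Polynomial.C (-1344 * c ^ 2 * d - 10944 * b * d ^ 2 + 3840 * b ^ 2 * c ^ 2 -
        7680 * b ^ 3 * d + 64 * b ^ 5) * Polynomial.X ^ 5 +
      Polynomial.C (6720 * c * d ^ 2 - 3904 * b * c ^ 3 + 11776 * b ^ 2 * c * d -
        128 * b ^ 4 * c) * Polynomial.X ^ 6 +
      Polynomial.C (-4032 * d ^ 3 + 1728 * c ^ 4 - 5568 * b * c ^ 2 * d - 1344 * b ^ 2 * d ^ 2 +
        256 * b ^ 3 * c ^ 2 - 640 * b ^ 4 * d) * Polynomial.X ^ 7 +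
      Polynomial.C (-1536 * c ^ 3 * d + 5568 * b * c * d ^ 2 - 192 * b ^ 2 * c ^ 3 +
        640 * b ^ 3 * c * d) * Polynomial.X ^ 8 +
      Polynomial.C (192 * c ^ 2 * d ^ 2 - 576 * b * d ^ 3 - 64 * b * c ^ 4 +
        704 * b ^ 2 * c ^ 2 * d - 1728 * b ^ 3 * d ^ 2) * Polynomial.X ^ 9, ?_⟩
  apply Polynomial.funext
  intro t
  rw [Θ, H_tangentForm, det_bordered, eval_aeval_arc]
  simp [hessianMatrix, tangentForm, pderiv_X, -Nat.cast_ofNat]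
  push_cast
  ring

theorem flex_H : aeval ![Polynomial.X, 0, 1] (H (tangentForm 0 a b c d)) =
    Polynomial.C (12 * a) * Polynomial.X := by
  apply Polynomial.funext
  intro t
  rw [H_tangentForm, eval_aeval_arc]
  simp

theorem flex_Θ : aeval ![Polynomial.X, 0, 1] (Θ (tangentForm 0 a b c d)) =
    Polynomial.C (192 * a ^ 2) + Polynomial.X ^ 3 *
      (Polynomial.C (1536 * a ^ 2 * b ^ 2 - 4608 * a ^ 3 * c) * Polynomial.X) := by
  apply Polynomial.funext
  intro t
  rw [Θ, H_tangentForm, det_bordered, eval_aeval_arc]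
  simp [hessianMatrix, tangentForm, pderiv_X, -Nat.cast_ofNat]
  push_cast
  ring

/-- Solving for `x₁` as a power series in `x₀ = t` (indices from `0`, with `x₂ = 1`) gives `-t² + b
t⁴ + …`. This truncation gives contact of order `5`, enough for a line through the point that meets
the branch to order at most `2`. -/
theorem nonflex_arc : aeval ![Polynomial.X, -Polynomial.X ^ 2 + Polynomial.C b * Polynomial.X ^ 4, 1]
    (tangentForm 1 0 b c d) = Polynomial.X ^ 5 * (Polynomial.C c +
      Polynomial.C (b ^ 2 - d) * Polynomial.X + Polynomial.C (-2 * b * c) * Polynomial.X ^ 2 +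
      Polynomial.C (3 * b * d) * Polynomial.X ^ 3 + Polynomial.C (b ^ 2 * c) * Polynomial.X ^ 4 +
      Polynomial.C (-3 * b ^ 2 * d) * Polynomial.X ^ 5 +
      Polynomial.C (b ^ 3 * d) * Polynomial.X ^ 7) := by
  apply Polynomial.funext
  intro t
  rw [eval_aeval_arc]
  simp [tangentForm]
  ring

/-- At a flex the series begins `-a t³ + a b t⁵`. Order `6` is needed because the tangent line meets
the branch to order `3`. -/
theorem flex_arc : aeval ![Polynomial.X, Polynomial.C (-a) * Polynomial.X ^ 3 +
      Polynomial.C (a * b) * Polynomial.X ^ 5, 1]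
    (tangentForm 0 a b c d) = Polynomial.X ^ 6 * (Polynomial.C (a * b ^ 2 + a ^ 2 * c) *
      Polynomial.X + Polynomial.C (-2 * a ^ 2 * b * c) * Polynomial.X ^ 3 +
      Polynomial.C (-a ^ 3 * d) * Polynomial.X ^ 3 +
      Polynomial.C (a ^ 2 * b ^ 2 * c + 3 * a ^ 3 * b * d) * Polynomial.X ^ 5 +
      Polynomial.C (-3 * a ^ 3 * b ^ 2 * d) * Polynomial.X ^ 7 +
      Polynomial.C (a ^ 3 * b ^ 3 * d) * Polynomial.X ^ 9) := by
  apply Polynomial.funext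
  intro t
  rw [eval_aeval_arc]
  simp [tangentForm]
  ring

end TernaryCubic

/-! ### Non-divisibility of the Jacobian determinant in normal form. -/

namespace TernaryCubic

variable {a b c d : ℝ}

/-- This cubic is `(x₂ + b x₁)(x₀² + x₁x₂ - b x₁²)`, indices from `0`. It is singular where the line
meets the conic, at `(r : 1 : -b)` with `r² = 2b`. -/
theorem nonflex_not_isNonsingular :
    ¬ (GenusOneModel.cubic _ (isHomogeneous_tangentForm 1 0 b 0 (-b ^ 2))).IsNonsingular := by
  intro h
  obtain ⟨r, hr⟩ := IsAlgClosed.exists_pow_nat_eq (2 * (b : ℂ)) (n := 2) (by norm_num)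
  obtain ⟨i, hi⟩ := h ![r, 1, -b] (fun h0 => by simpa using congrFun h0 1) (by
    simp [tangentForm]; ring)
  apply hi
  fin_cases i
  · simp [tangentForm, pderiv_X]
  · simp [tangentForm, pderiv_X]
    linear_combination (b : ℂ) * hr
  · simp [tangentForm, pderiv_X]
    linear_combination hr

/-- The line `x₁ = 0` is a component (indices from `0`), and it meets the residual conic at `(1 : 0
: r)` with `r² = -b`. -/
theorem flex_not_isNonsingular :
    ¬ (GenusOneModel.cubic _ (isHomogeneous_tangentForm 0 0 b c d)).IsNonsingular := by
  intro h
  obtain ⟨r, hr⟩ := IsAlgClosed.exists_pow_nat_eq (-(b : ℂ)) (n := 2) (by norm_num)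
  obtain ⟨i, hi⟩ := h ![1, 0, r] (fun h0 => by simpa using congrFun h0 0) (by
    simp [tangentForm])
  apply hi
  fin_cases i
  · simp [tangentForm, pderiv_X]
  · simp [tangentForm, pderiv_X]
    linear_combination hr
  · simp [tangentForm, pderiv_X]

/-- If the Jacobian determinant of `U`, `f` and a linear form through `(0 : 0 : 1)` is divisible
by `U`, then `f` vanishes to high order at that point. -/
theorem X_pow_three_dvd_aeval {U f q : MvPolynomial (Fin 3) ℝ} {N o : ℕ} (hU : U.IsHomogeneous 3)
    (hf : f.IsHomogeneous 6) {κ s : ℝ} (hfU : f = C κ * Θ U + C s * H U ^ 2 + U * q)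
    {γ γ₀ : Fin 3 → Polynomial ℝ} {L : Fin 3 → ℝ} {μ : Polynomial ℝ}
    (hγ₀ : ∀ i, Polynomial.X ^ 3 ∣ γ i - γ₀ i)
    (hγ : Polynomial.X ^ (N + 1) ∣ aeval γ U) (hN : 2 ≤ N) (hoN : o + 3 ≤ N)
    (hy : (aeval γ (pderiv 1 U)).coeff 0 ≠ 0) (hμ : μ.coeff 0 ≠ 0)
    (hL : ∑ i, Polynomial.C (L i) * γ i = Polynomial.X ^ (o + 1) * μ)
    (h : U ∣ (Matrix.of ![fun i => C (L i), fun i => pderiv i U, fun i => pderiv i f]).det) :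
    Polynomial.X ^ 3 ∣ Polynomial.C κ * aeval γ₀ (Θ U) + Polynomial.C s * aeval γ₀ (H U) ^ 2 := by
  have h1 := dvd_of_dvd_jacobian hU hf hγ hy h
  rw [hL] at h1
  have h2 := X_pow_three_dvd hμ ((pow_dvd_pow _ (by omega)).trans h1)
  have h3 : Polynomial.X ^ 3 ∣ aeval γ U := (pow_dvd_pow _ (by omega)).trans hγ
  have h4 : Polynomial.X ^ 3 ∣ aeval γ₀ f := (dvd_iff_dvd_of_dvd_sub (dvd_aeval_sub_aeval hγ₀ f)).1 h2
  have h5 : Polynomial.X ^ 3 ∣ aeval γ₀ U := (dvd_iff_dvd_of_dvd_sub (dvd_aeval_sub_aeval hγ₀ U)).1 h3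
  have h6 : Polynomial.C κ * aeval γ₀ (Θ U) + Polynomial.C s * aeval γ₀ (H U) ^ 2 =
      aeval γ₀ f - aeval γ₀ U * aeval γ₀ q := by
    rw [hfU]
    simp only [map_add, map_mul, map_pow, aeval_C, Polynomial.algebraMap_eq]
    ring
  rw [h6]
  exact dvd_sub h4 (h5.mul_right _)

theorem coeff_eq_zero_of_X_pow_three_dvd {p₀ p₁ p₂ : ℝ} {p q : Polynomial ℝ}
    (hp : p = Polynomial.C p₀ + Polynomial.C p₁ * Polynomial.X + Polynomial.C p₂ * Polynomial.X ^ 2 +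
      Polynomial.X ^ 3 * q) (h : Polynomial.X ^ 3 ∣ p) : p₀ = 0 ∧ p₁ = 0 ∧ p₂ = 0 := by
  rw [Polynomial.X_pow_dvd_iff, hp] at h
  have h0 := h 0 (by norm_num)
  have h1 := h 1 (by norm_num)
  have h2 := h 2 (by norm_num)
  simp [Polynomial.coeff_X_pow_mul', Polynomial.coeff_X, Polynomial.coeff_C] at h0 h1 h2
  exact ⟨h0, h1, h2⟩

/-- A linear form through the point vanishes along the arc to order `1`, or to order `2` if it
defines the tangent line. In either case `f` must vanish to order three there, and the three leading
coefficients leave only a singular cubic. -/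
theorem nonflex_not_dvd
    (hns : (GenusOneModel.cubic _ (isHomogeneous_tangentForm 1 0 b c d)).IsNonsingular)
    {f q : MvPolynomial (Fin 3) ℝ} (hf : f.IsHomogeneous 6) {κ s : ℝ} (hκs : s ≠ 0 ∨ κ ≠ 0)
    (hfU : f = C κ * Θ (tangentForm 1 0 b c d) + C s * H (tangentForm 1 0 b c d) ^ 2 +
      tangentForm 1 0 b c d * q) {L : Fin 3 → ℝ} (hL : L ≠ 0) (hL2 : L 2 = 0) :
    ¬ tangentForm 1 0 b c d ∣ (Matrix.of ![fun i => C (L i),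
      fun i => pderiv i (tangentForm 1 0 b c d), fun i => pderiv i f]).det := by
  intro h
  have key : Polynomial.X ^ 3 ∣ Polynomial.C κ * aeval ![Polynomial.X, -Polynomial.X ^ 2, 1]
      (Θ (tangentForm 1 0 b c d)) + Polynomial.C s *
      aeval ![Polynomial.X, -Polynomial.X ^ 2, 1] (H (tangentForm 1 0 b c d)) ^ 2 := by
    have hγ₀ : ∀ i, Polynomial.X ^ 3 ∣ (![Polynomial.X, -Polynomial.X ^ 2 +
        Polynomial.C b * Polynomial.X ^ 4, 1] : Fin 3 → Polynomial ℝ) i -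
        (![Polynomial.X, -Polynomial.X ^ 2, 1] : Fin 3 → Polynomial ℝ) i := by
      intro i
      fin_cases i
      · simp
      · exact ⟨Polynomial.C b * Polynomial.X, by simp; ring⟩
      · simp
    have hy : (aeval (![Polynomial.X, -Polynomial.X ^ 2 + Polynomial.C b * Polynomial.X ^ 4, 1] :
        Fin 3 → Polynomial ℝ) (pderiv 1 (tangentForm 1 0 b c d))).coeff 0 ≠ 0 := by
      rw [Polynomial.coeff_zero_eq_eval_zero, eval_aeval_arc]
      simp [tangentForm, pderiv_X]
    have harc := Dvd.intro _ (nonflex_arc b c d).symm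
    by_cases h0 : L 0 = 0
    · have h1 : L 1 ≠ 0 := fun h1 => hL (by ext i; fin_cases i <;> simp [h0, h1, hL2])
      refine X_pow_three_dvd_aeval (N := 4) (o := 1) (isHomogeneous_tangentForm _ _ _ _ _) hf hfU
        (μ := Polynomial.C (L 1) * (-1 + Polynomial.C b * Polynomial.X ^ 2)) hγ₀ harc (by norm_num)
        (by norm_num) hy (by simpa using h1) ?_ h
      simp [Fin.sum_univ_three, h0, hL2]
      ring
    · refine X_pow_three_dvd_aeval (N := 4) (o := 0) (isHomogeneous_tangentForm _ _ _ _ _) hf hfU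
        (μ := Polynomial.C (L 0) + Polynomial.C (L 1) *
          (-Polynomial.X + Polynomial.C b * Polynomial.X ^ 3)) hγ₀ harc (by norm_num)
        (by norm_num) hy (by simpa using h0) ?_ h
      simp [Fin.sum_univ_three, hL2]
      ring
  obtain ⟨r₁, hr₁⟩ := nonflex_Θ b c d
  obtain ⟨r₂, hr₂⟩ := nonflex_H b c d
  rw [hr₁, hr₂] at key
  obtain ⟨k0, k1, k2⟩ := coeff_eq_zero_of_X_pow_three_dvd (p₀ := κ * (128 * b) + s * 16)
    (p₁ := κ * (-576 * c)) (p₂ := κ * (1728 * d + 960 * b ^ 2) + s * (-96 * b))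
    (q := Polynomial.C κ * r₁ + Polynomial.C s * (Polynomial.X * (Polynomial.C (144 * b ^ 2)) +
      (Polynomial.C 8 + Polynomial.C (-24 * b) * Polynomial.X ^ 2) * r₂ +
        Polynomial.X ^ 3 * r₂ ^ 2)) (by
      apply Polynomial.funext
      intro t
      simp
      ring) key
  -- The constant term is `128bκ + 16s`, so `κ = 0` would give `s = 0`. The linear term gives `c =
  -- 0`, and adding `6b` times the constant term to the quadratic one gives `1728 κ (d + b²) = 0`.
  have hκ : κ ≠ 0 := by
    rintro rfl
    have : s = 0 := by linarith
    simp [this] at hκs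
  obtain rfl : c = 0 := by simpa [hκ] using k1
  obtain rfl : d = -b ^ 2 := by
    have : κ * (d + b ^ 2) = 0 := by linear_combination (k2 + 6 * b * k0) / 1728
    have := (mul_eq_zero.1 this).resolve_left hκ
    linarith
  exact nonflex_not_isNonsingular hns

/-- Here the orders of the linear form are `1` and `3`. The constant term sees only `κ`, because `H`
vanishes at a flex, and the quadratic term only `s`. Nonsingularity enters through `a ≠ 0`. -/
theorem flex_not_dvd
    (hns : (GenusOneModel.cubic _ (isHomogeneous_tangentForm 0 a b c d)).IsNonsingular)
    {f q : MvPolynomial (Fin 3) ℝ} (hf : f.IsHomogeneous 6) {κ s : ℝ} (hκs : s ≠ 0 ∨ κ ≠ 0)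
    (hfU : f = C κ * Θ (tangentForm 0 a b c d) + C s * H (tangentForm 0 a b c d) ^ 2 +
      tangentForm 0 a b c d * q) {L : Fin 3 → ℝ} (hL : L ≠ 0) (hL2 : L 2 = 0) :
    ¬ tangentForm 0 a b c d ∣ (Matrix.of ![fun i => C (L i),
      fun i => pderiv i (tangentForm 0 a b c d), fun i => pderiv i f]).det := by
  intro h
  have ha : a ≠ 0 := by
    rintro rfl
    exact flex_not_isNonsingular hns
  have key : Polynomial.X ^ 3 ∣ Polynomial.C κ * aeval ![Polynomial.X, 0, 1]
      (Θ (tangentForm 0 a b c d)) + Polynomial.C s *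
      aeval ![Polynomial.X, 0, 1] (H (tangentForm 0 a b c d)) ^ 2 := by
    have hγ₀ : ∀ i, Polynomial.X ^ 3 ∣ (![Polynomial.X, Polynomial.C (-a) * Polynomial.X ^ 3 +
        Polynomial.C (a * b) * Polynomial.X ^ 5, 1] : Fin 3 → Polynomial ℝ) i -
        (![Polynomial.X, 0, 1] : Fin 3 → Polynomial ℝ) i := by
      intro i
      fin_cases i
      · simp
      · exact ⟨Polynomial.C (-a) + Polynomial.C (a * b) * Polynomial.X ^ 2, by simp; ring⟩
      · simp
    have hy : (aeval (![Polynomial.X, Polynomial.C (-a) * Polynomial.X ^ 3 +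
        Polynomial.C (a * b) * Polynomial.X ^ 5, 1] :
        Fin 3 → Polynomial ℝ) (pderiv 1 (tangentForm 0 a b c d))).coeff 0 ≠ 0 := by
      rw [Polynomial.coeff_zero_eq_eval_zero, eval_aeval_arc]
      simp [tangentForm, pderiv_X]
    have harc := Dvd.intro _ (flex_arc a b c d).symm
    by_cases h0 : L 0 = 0
    · have h1 : L 1 ≠ 0 := fun h1 => hL (by ext i; fin_cases i <;> simp [h0, h1, hL2])
      refine X_pow_three_dvd_aeval (N := 5) (o := 2) (isHomogeneous_tangentForm _ _ _ _ _) hf hfU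
        (μ := Polynomial.C (L 1) * (Polynomial.C (-a) + Polynomial.C (a * b) * Polynomial.X ^ 2))
        hγ₀ harc (by norm_num) (by norm_num) hy (by simp [h1, ha]) ?_ h
      simp only [Fin.sum_univ_three, h0, hL2, Matrix.cons_val_zero, Matrix.cons_val_one,
        Matrix.cons_val, map_zero]
      ring
    · refine X_pow_three_dvd_aeval (N := 5) (o := 0) (isHomogeneous_tangentForm _ _ _ _ _) hf hfU
        (μ := Polynomial.C (L 0) + Polynomial.C (L 1) *
          (Polynomial.C (-a) * Polynomial.X ^ 2 + Polynomial.C (a * b) * Polynomial.X ^ 4))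
        hγ₀ harc (by norm_num) (by norm_num) hy (by simpa using h0) ?_ h
      simp only [Fin.sum_univ_three, hL2, Matrix.cons_val_zero, Matrix.cons_val_one,
        Matrix.cons_val, map_zero]
      ring
  rw [flex_H, flex_Θ] at key
  obtain ⟨k0, -, k2⟩ := coeff_eq_zero_of_X_pow_three_dvd (p₀ := κ * (192 * a ^ 2))
    (p₁ := 0) (p₂ := s * (144 * a ^ 2))
    (q := Polynomial.C κ * (Polynomial.C (1536 * a ^ 2 * b ^ 2 - 4608 * a ^ 3 * c) *
      Polynomial.X)) (by
      apply Polynomial.funext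
      intro t
      simp
      ring) key
  simp [ha] at k0 k2
  simp [k0, k2] at hκs

end TernaryCubic

/-! ### Behaviour of the covariants under linear substitutions. -/

namespace TernaryCubic

open Matrix

/-- Linear substitution of the variables. -/
noncomputable def subst (M : Matrix (Fin 3) (Fin 3) ℝ) :
    MvPolynomial (Fin 3) ℝ →ₐ[ℝ] MvPolynomial (Fin 3) ℝ :=
  bind₁ fun i => ∑ j, C (M i j) * X j

variable (M N : Matrix (Fin 3) (Fin 3) ℝ) (U f : MvPolynomial (Fin 3) ℝ)

theorem aeval_subst (x : Fin 3 → ℂ) :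
    aeval x (subst M f) = aeval (M.map (algebraMap ℝ ℂ) *ᵥ x) f := by
  rw [subst, aeval_bind₁]
  congr 2
  ext i
  simp [mulVec, dotProduct]

theorem eval_subst (x : Fin 3 → ℝ) : eval x (subst M f) = eval (M *ᵥ x) f := by
  rw [subst, eval, eval₂Hom_bind₁]
  congr 2
  ext i
  simp [mulVec, dotProduct]

theorem subst_subst : subst M (subst N f) = subst (N * M) f := by
  apply MvPolynomial.funext
  intro x
  rw [eval_subst, eval_subst, eval_subst, mulVec_mulVec]

theorem isHomogeneous_subst {d : ℕ} (hf : f.IsHomogeneous d) : (subst M f).IsHomogeneous d := by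
  have := hf.aeval (fun i => ∑ j, C (M i j) * X j) (n := 1)
    fun i => IsHomogeneous.sum _ _ _ fun j _ => isHomogeneous_C_mul_X _ _
  rwa [one_mul] at this

theorem pderiv_subst (k : Fin 3) :
    pderiv k (subst M f) = ∑ i, subst M (pderiv i f) * C (M i k) := by
  rw [subst, pderiv_bind₁]
  refine Finset.sum_congr rfl fun i _ => ?_
  congr 1
  rw [map_sum, Finset.sum_eq_single k]
  · rw [pderiv_C_mul, pderiv_X_self, mul_one]
  · intro j _ hj
    rw [pderiv_C_mul, pderiv_X_of_ne hj, mul_zero]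
  · simp

theorem hessianMatrix_subst : hessianMatrix (subst M U) =
    Mᵀ.map C * (hessianMatrix U).map (subst M) * M.map C := by
  refine Matrix.ext fun i j => ?_
  simp only [hessianMatrix, of_apply, Matrix.mul_apply, transpose_apply, Matrix.map_apply]
  rw [pderiv_subst, map_sum]
  refine Finset.sum_congr rfl fun k _ => ?_
  rw [pderiv_mul, pderiv_C, mul_zero, add_zero, pderiv_subst]
  congr 1
  exact Finset.sum_congr rfl fun l _ => mul_comm _ _

theorem det_map_C : (M.map (C : ℝ →+* MvPolynomial (Fin 3) ℝ)).det = C M.det :=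
  ((C : ℝ →+* MvPolynomial (Fin 3) ℝ).map_det M).symm

theorem H_subst : H (subst M U) = C (M.det ^ 2) * subst M (H U) := by
  have h1 : ((hessianMatrix U).map (subst M)).det = subst M (hessianMatrix U).det :=
    ((subst M).map_det _).symm
  have h2 : subst M (C (-(1 / 2))) = C (-(1 / 2)) := (subst M).commutes _
  rw [H, H, hessianMatrix_subst, det_mul, det_mul, det_map_C, det_map_C, det_transpose, h1,
    map_mul, h2, C_pow]
  ring

/-- The bordered matrix transforms by the block diagonal matrix of `M` and `det M ^ 2`, the second
block coming from the factor of `H` in its gradient. Its determinant `det M ^ 3` occurs twice. -/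
theorem Θ_subst : Θ (subst M U) = C (M.det ^ 6) * subst M (Θ U) := by
  set v : Matrix (Fin 3) Unit (MvPolynomial (Fin 3) ℝ) := of fun i _ => pderiv i (H U) with hv
  have h2 : subst M (C (1 / 3)) = C (1 / 3) := (subst M).commutes _
  set δ : Matrix Unit Unit (MvPolynomial (Fin 3) ℝ) := of fun _ _ => C (M.det ^ 2) with hδ
  set w : Matrix (Fin 3) Unit (MvPolynomial (Fin 3) ℝ) := v.map (subst M) with hw
  set K : Matrix (Fin 3) (Fin 3) (MvPolynomial (Fin 3) ℝ) := M.map C with hK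
  have hcol : (of fun i (_ : Unit) => pderiv i (H (subst M U)) :
      Matrix (Fin 3) Unit (MvPolynomial (Fin 3) ℝ)) = Kᵀ * w * δ := by
    refine Matrix.ext fun i j => ?_
    simp only [of_apply, Matrix.mul_apply, transpose_apply, Matrix.map_apply, H_subst, hv, hδ, hw, hK,
      pderiv_C_mul, pderiv_subst, Finset.univ_unique, Finset.sum_singleton]
    rw [mul_comm]
    congr 1
    exact Finset.sum_congr rfl fun l _ => mul_comm _ _
  have hrow : (of fun (_ : Unit) j => pderiv j (H (subst M U)) :
      Matrix Unit (Fin 3) (MvPolynomial (Fin 3) ℝ)) = δ * wᵀ * K := by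
    refine Matrix.ext fun i j => ?_
    simp only [of_apply, Matrix.mul_apply, transpose_apply, Matrix.map_apply, H_subst, hv, hδ, hw, hK,
      pderiv_C_mul, pderiv_subst, Finset.univ_unique, Finset.sum_singleton]
    rw [Finset.mul_sum]
    exact Finset.sum_congr rfl fun l _ => by ring
  have hblock : fromBlocks (hessianMatrix (subst M U))
      (of fun i (_ : Unit) => pderiv i (H (subst M U)))
      (of fun (_ : Unit) j => pderiv j (H (subst M U))) 0 =
      fromBlocks Kᵀ 0 0 δ * (fromBlocks (hessianMatrix U) v vᵀ 0).map (subst M) *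
      fromBlocks K 0 0 δ := by
    rw [fromBlocks_map, fromBlocks_multiply, fromBlocks_multiply, hcol, hrow, hessianMatrix_subst]
    have h0 : (0 : Matrix Unit Unit (MvPolynomial (Fin 3) ℝ)).map (subst M) = 0 := by
      ext; simp
    simp only [h0, Matrix.mul_zero, Matrix.zero_mul, add_zero, zero_add, ← hw, ← hK]
    rfl
  have hdet : ((fromBlocks (hessianMatrix U) v vᵀ 0).map (subst M)).det =
      subst M (fromBlocks (hessianMatrix U) v vᵀ 0).det := ((subst M).map_det _).symm
  have hvt : (of fun (_ : Unit) j => pderiv j (H U)) = vᵀ := rfl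
  rw [Θ, Θ, hblock, det_mul, det_mul, det_fromBlocks_zero₁₂, det_fromBlocks_zero₁₂, hdet, det_transpose,
    hK, det_map_C, det_unique δ, map_mul, h2, hvt]
  simp only [hδ, of_apply, C_pow, hv]
  ring

/-- The determinant of the gradients of a linear form, of `U` and of `f`. -/
noncomputable def linearJacobian (L : Fin 3 → ℝ) (U f : MvPolynomial (Fin 3) ℝ) :
    MvPolynomial (Fin 3) ℝ :=
  (Matrix.of ![fun i => C (L i), fun i => pderiv i U, fun i => pderiv i f]).det

theorem linearJacobian_subst (L : Fin 3 → ℝ) :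
    linearJacobian (L ᵥ* M) (subst M U) (subst M f) = subst M (linearJacobian L U f) * C M.det := by
  rw [linearJacobian, linearJacobian, AlgHom.map_det, ← det_map_C, ← det_mul]
  congr 1
  refine Matrix.ext fun i j => ?_
  rw [Matrix.mul_apply]
  fin_cases i
  · change C ((L ᵥ* M) j) = ∑ k, subst M (C (L k)) * C (M k j)
    rw [vecMul, dotProduct, map_sum]
    refine Finset.sum_congr rfl fun k _ => ?_
    rw [C_mul]
    congr 1
    exact ((subst M).commutes _).symm
  · exact pderiv_subst M U j
  · exact pderiv_subst M f j

variable {M U}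

theorem isNonsingular_subst {hU : U.IsHomogeneous 3} (hM : M.det ≠ 0)
    (hΦ : (GenusOneModel.cubic U hU).IsNonsingular) :
    (GenusOneModel.cubic _ (isHomogeneous_subst M U hU)).IsNonsingular := by
  intro x hx hxU
  have hMdet : (M.map (algebraMap ℝ ℂ)).det ≠ 0 := by
    have : (M.map (algebraMap ℝ ℂ)).det = algebraMap ℝ ℂ M.det := ((algebraMap ℝ ℂ).map_det M).symm
    rw [this]
    simpa using hM
  by_contra hcon
  push Not at hcon
  rw [aeval_subst] at hxU
  obtain ⟨i, hi⟩ := hΦ _ (fun h => hx (eq_zero_of_mulVec_eq_zero hMdet h)) hxU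
  have h0 : (fun i => aeval (M.map (algebraMap ℝ ℂ) *ᵥ x) (pderiv i U)) ᵥ*
      M.map (algebraMap ℝ ℂ) = 0 := by
    ext k
    rw [Pi.zero_apply, ← hcon k, pderiv_subst]
    simp [vecMul, dotProduct, aeval_subst]
  exact hi (congrFun (eq_zero_of_vecMul_eq_zero hMdet h0) i)

end TernaryCubic

/-! ### Reduction to the normal form at a real point. -/

namespace TernaryCubic

open Matrix

variable {U : MvPolynomial (Fin 3) ℝ}

theorem quadratic_form_three {f : MvPolynomial (Fin 3) ℝ} (hf : f.IsHomogeneous 2) :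
    ∃ c : Fin 6 → ℝ, f = C (c 0) * X 0 ^ 2 + C (c 1) * X 1 ^ 2 + C (c 2) * X 2 ^ 2 +
      C (c 3) * X 0 * X 1 + C (c 4) * X 0 * X 2 + C (c 5) * X 1 * X 2 := by
  obtain ⟨g, hg, rfl⟩ := exists_eq_sum_X_mul (d := 1) hf
  choose a ha using fun i => linear_form (hg i)
  refine ⟨![a 0 0, a 1 1, a 2 2, a 0 1 + a 1 0, a 0 2 + a 2 0, a 1 2 + a 2 1], ?_⟩
  simp [Fin.sum_univ_three, ha]
  ring

theorem cubic_form_three {f : MvPolynomial (Fin 3) ℝ} (hf : f.IsHomogeneous 3) :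
    ∃ p q k e m h a b c d : ℝ, f = C p * X 2 ^ 3 + C q * X 0 * X 2 ^ 2 + C k * X 1 * X 2 ^ 2 +
      C e * X 0 ^ 2 * X 2 + C m * X 0 * X 1 * X 2 + C h * X 1 ^ 2 * X 2 + C a * X 0 ^ 3 +
      C b * X 0 ^ 2 * X 1 + C c * X 0 * X 1 ^ 2 + C d * X 1 ^ 3 := by
  obtain ⟨g, hg, rfl⟩ := exists_eq_sum_X_mul (d := 2) hf
  choose r hr using fun i => quadratic_form_three (hg i)
  refine ⟨r 2 2, r 0 2 + r 2 4, r 1 2 + r 2 5, r 0 4 + r 2 0, r 0 5 + r 1 4 + r 2 3,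
    r 1 5 + r 2 1, r 0 0, r 0 3 + r 1 0, r 0 1 + r 1 3, r 1 1, ?_⟩
  simp [Fin.sum_univ_three, hr]
  ring

/-- A real zero of `U` on a coordinate line. -/
theorem exists_zero_on_line (hU : U.IsHomogeneous 3) (k : Fin 3) :
    ∃ p : Fin 3 → ℝ, p ≠ 0 ∧ p k = 0 ∧ eval p U = 0 := by
  obtain ⟨i, j, hik, hjk, hij⟩ : ∃ i j : Fin 3, i ≠ k ∧ j ≠ k ∧ i ≠ j := by
    clear * -
    revert k
    decide
  set γ : ℝ → Fin 3 → ℝ := fun θ => Pi.single i (Real.cos θ) + Pi.single j (Real.sin θ) with hγ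
  have hcont : Continuous fun θ => eval (γ θ) U := by
    refine (MvPolynomial.continuous_eval U).comp ?_
    refine continuous_pi fun l => ?_
    simp only [hγ, Pi.add_apply, Pi.single_apply]
    split_ifs <;> fun_prop
  -- A form of odd degree changes sign between antipodal points, so it has a zero on the half
  -- circle.
  have hneg : eval (γ Real.pi) U = -eval (γ 0) U := by
    have : γ Real.pi = (-1 : ℝ) • γ 0 := by
      ext l
      simp [hγ, Pi.single_apply]
    rw [this, eval_smul_of_isHomogeneous hU]
    ring
  obtain ⟨θ, hθ⟩ : (0 : ℝ) ∈ Set.range fun θ => eval (γ θ) U := by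
    rcases le_total (eval (γ 0) U) 0 with h | h
    · exact mem_range_of_exists_le_of_exists_ge hcont ⟨0, h⟩ ⟨Real.pi, by rw [hneg]; linarith⟩
    · exact mem_range_of_exists_le_of_exists_ge hcont ⟨Real.pi, by rw [hneg]; linarith⟩ ⟨0, h⟩
  refine ⟨γ θ, fun h0 => ?_, by simp [hγ, hik.symm, hjk.symm], hθ⟩
  have hi := congrFun h0 i
  have hj := congrFun h0 j
  simp [hγ, hij, hij.symm] at hi hj
  have := Real.sin_sq_add_cos_sq θ
  rw [hi, hj] at this
  norm_num at this

/-- A substitution fixing a point and the tangent line there. -/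
theorem subst_tangent {e m h a b c d lam κ μ ν α β e' a' : ℝ} (h₁ : μ * ν ^ 2 = 1)
    (h₂ : e * lam ^ 2 * ν = e') (h₃ : e * lam ^ 2 * α + a * lam ^ 3 = a')
    (h₄ : 2 * μ * α * ν + 2 * e * lam * κ * ν + m * lam * μ * ν = 0)
    (h₅ : 2 * μ * β * ν + e * κ ^ 2 * ν + m * κ * μ * ν + h * μ ^ 2 * ν = 0) :
    ∃ b' c' d', subst !![lam, κ, 0; 0, μ, 0; α, β, ν] (X 1 * X 2 ^ 2 + C e * X 0 ^ 2 * X 2 +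
      C m * X 0 * X 1 * X 2 + C h * X 1 ^ 2 * X 2 + C a * X 0 ^ 3 +
      C b * X 0 ^ 2 * X 1 + C c * X 0 * X 1 ^ 2 + C d * X 1 ^ 3) =
      tangentForm e' a' b' c' d' := by
  refine ⟨μ * α ^ 2 + e * (lam ^ 2 * β + 2 * lam * κ * α) + m * μ * lam * α +
      3 * a * lam ^ 2 * κ + b * μ * lam ^ 2,
    2 * μ * α * β + e * (2 * lam * κ * β + κ ^ 2 * α) + m * μ * (lam * β + κ * α) + h * μ ^ 2 * α +
      3 * a * lam * κ ^ 2 + 2 * b * μ * lam * κ + c * μ ^ 2 * lam,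
    μ * β ^ 2 + e * κ ^ 2 * β + m * μ * κ * β + h * μ ^ 2 * β + a * κ ^ 3 + b * μ * κ ^ 2 +
      c * μ ^ 2 * κ + d * μ ^ 3, ?_⟩
  apply MvPolynomial.funext
  intro x
  rw [eval_subst]
  simp [tangentForm, dotProduct, Fin.sum_univ_three]
  linear_combination h₁ * (x 1 * x 2 ^ 2) + h₂ * (x 0 ^ 2 * x 2) + h₃ * x 0 ^ 3 +
    h₄ * (x 0 * x 1 * x 2) + h₅ * (x 1 ^ 2 * x 2)

/-- The normal form of a plane cubic at a smooth point. -/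
theorem exists_subst_eq_tangentForm {hU : U.IsHomogeneous 3}
    (hΦ : (GenusOneModel.cubic U hU).IsNonsingular) {p : Fin 3 → ℝ} (hp : p ≠ 0)
    (hpU : eval p U = 0) : ∃ (M : Matrix (Fin 3) (Fin 3) ℝ) (ν : ℝ), M.det ≠ 0 ∧
      (∀ i, M i 2 = ν * p i) ∧
      ∃ b c d, subst M U = tangentForm 1 0 b c d ∨ ∃ a, subst M U = tangentForm 0 a b c d := by
  set g : Fin 3 → ℝ := fun i => eval p (pderiv i U) with hg
  have hg0 : g ≠ 0 := by
    obtain ⟨i, hi⟩ := hΦ (fun i => (p i : ℂ)) (fun h => hp (by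
      ext i
      simpa using congrFun h i)) (by rw [aeval_ofReal, hpU, Complex.ofReal_zero])
    rw [aeval_ofReal] at hi
    intro h
    exact hi (by rw [show eval p (pderiv i U) = g i from rfl, h]; simp)
  have hpg : p 0 * g 0 + p 1 * g 1 + p 2 * g 2 = 0 := by
    have := congrArg (eval p) hU.sum_X_mul_pderiv
    simpa [Fin.sum_univ_three, hpU] using this
  have hsq : ∀ v : Fin 3 → ℝ, v ≠ 0 → v 0 ^ 2 + v 1 ^ 2 + v 2 ^ 2 ≠ 0 := by
    intro v hv h
    apply hv
    have h0 : v 0 ^ 2 = 0 := by nlinarith [sq_nonneg (v 0), sq_nonneg (v 1), sq_nonneg (v 2)]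
    have h1 : v 1 ^ 2 = 0 := by nlinarith [sq_nonneg (v 0), sq_nonneg (v 1), sq_nonneg (v 2)]
    have h2 : v 2 ^ 2 = 0 := by nlinarith [sq_nonneg (v 0), sq_nonneg (v 1), sq_nonneg (v 2)]
    ext i
    fin_cases i
    · simpa using h0
    · simpa using h1
    · simpa using h2
  have hG := hsq g hg0
  have hP := hsq p hp
  set G := g 0 ^ 2 + g 1 ^ 2 + g 2 ^ 2 with hGdef
  -- The columns are `p × g`, a direction in the tangent line, then `g / |g|²`, transversal to it,
  -- and `p` itself. This makes the coefficients of `x₀x₂²` and `x₁x₂²` equal to `0` and `1`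
  -- (indices from `0`).
  set M₁ : Matrix (Fin 3) (Fin 3) ℝ :=
    !![p 1 * g 2 - p 2 * g 1, g 0 / G, p 0; p 2 * g 0 - p 0 * g 2, g 1 / G, p 1;
      p 0 * g 1 - p 1 * g 0, g 2 / G, p 2] with hM₁
  have hdet : M₁.det ≠ 0 := by
    have : M₁.det = -(p 0 ^ 2 + p 1 ^ 2 + p 2 ^ 2) := by
      rw [hM₁, det_fin_three]
      simp
      field_simp
      rw [hGdef]
      linear_combination (p 0 * g 0 + p 1 * g 1 + p 2 * g 2) * hpg
    rw [this]
    exact neg_ne_zero.2 hP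
  have hcol : M₁ *ᵥ ![0, 0, 1] = p := by
    ext i
    fin_cases i <;> simp [hM₁, mulVec, dotProduct, Fin.sum_univ_three]
  obtain ⟨p', q, k, e, m, h, a, b, c, d, hform⟩ := cubic_form_three (isHomogeneous_subst M₁ U hU)
  have hgrad : ∀ j, eval ![0, 0, 1] (pderiv j (subst M₁ U)) = ∑ i, g i * M₁ i j := by
    intro j
    rw [pderiv_subst]
    simp [eval_subst, hcol, hg]
  have hp' : p' = 0 := by
    have := eval_subst M₁ U ![0, 0, 1]
    rw [hcol, hpU, hform] at this
    simpa using this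
  have hq : q = 0 := by
    have := hgrad 0
    rw [hform] at this
    simp [pderiv_X, Fin.sum_univ_three, hM₁] at this
    rw [this]
    ring
  have hk : k = 1 := by
    have := hgrad 1
    rw [hform] at this
    simp [pderiv_X, Fin.sum_univ_three, hM₁] at this
    rw [this]
    field_simp
    rw [hGdef]
  have hform' : subst M₁ U = X 1 * X 2 ^ 2 + C e * X 0 ^ 2 * X 2 +
      C m * X 0 * X 1 * X 2 + C h * X 1 ^ 2 * X 2 + C a * X 0 ^ 3 +
      C b * X 0 ^ 2 * X 1 + C c * X 0 * X 1 ^ 2 + C d * X 1 ^ 3 := by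
    rw [hform, hp', hq, hk]
    simp
  have hcols : ∀ lam κ μ α β ν i, (M₁ * !![lam, κ, 0; 0, μ, 0; α, β, ν]) i 2 = ν * p i := by
    intro lam κ μ α β ν i
    fin_cases i <;> simp [hM₁, Matrix.mul_apply, Fin.sum_univ_three, mul_comm]
  have hdets : ∀ lam κ μ α β ν : ℝ, lam * μ * ν ≠ 0 →
      (M₁ * !![lam, κ, 0; 0, μ, 0; α, β, ν]).det ≠ 0 := by
    intro lam κ μ α β ν hne
    rw [det_mul]
    refine mul_ne_zero hdet ?_
    rw [det_fin_three]
    simpa using hne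
  by_cases he : e = 0
  -- The tangent line meets the cubic in `e x₀²x₂ + a x₀³` (indices from `0`), so `e = 0` is the
  -- case of a flex. Only the coefficients `m` and `h` are to be removed.
  · obtain ⟨b', c', d', hsub⟩ := subst_tangent (e := e) (m := m) (h := h) (a := a) (b := b)
      (c := c) (d := d) (lam := 1) (κ := 0) (μ := 1) (ν := 1) (α := -m / 2) (β := -h / 2)
      (e' := 0) (a' := a) (by ring) (by rw [he]; ring) (by rw [he]; ring) (by ring) (by ring)
    refine ⟨_, 1, hdets 1 0 1 (-m / 2) (-h / 2) 1 (by norm_num), hcols _ _ _ _ _ _, b', c', d',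
      Or.inr ⟨a, ?_⟩⟩
    rw [← subst_subst, hform', hsub]
  -- The values of `lam`, `μ`, `ν` normalize the two leading coefficients to `1`; then `α` removes
  -- `a`, `κ` removes `m` and `β` removes `h`, each from a linear equation.
  · obtain ⟨b', c', d', hsub⟩ := subst_tangent (e := e) (m := m) (h := h) (a := a) (b := b)
      (c := c) (d := d) (lam := 1 / e) (κ := (2 * a - m * e) / (2 * e ^ 4)) (μ := 1 / e ^ 2)
      (ν := e) (α := -a / e ^ 2)
      (β := -(e ^ 2) * (e * ((2 * a - m * e) / (2 * e ^ 4)) ^ 2 +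
        m * ((2 * a - m * e) / (2 * e ^ 4)) / e ^ 2 + h / e ^ 4) / 2)
      (e' := 1) (a' := 0) (by field_simp) (by field_simp) (by field_simp; ring)
      (by field_simp; ring) (by field_simp; ring)
    refine ⟨M₁ * _, e, ?_, ?_, b', c', d', Or.inl ((subst_subst _ _ U).symm.trans
      ((congrArg _ hform').trans hsub))⟩
    · exact hdets _ _ _ _ _ _
        (mul_ne_zero (mul_ne_zero (one_div_ne_zero he) (one_div_ne_zero (pow_ne_zero 2 he))) he)
    · exact hcols _ _ _ _ _ _

end TernaryCubic

/-! ### Finiteness for ternary cubics. -/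

namespace TernaryCubic

open Matrix

variable {U : MvPolynomial (Fin 3) ℝ}

/-- Combinations of `F₃` and `G₃` modulo `U`. -/
theorem exists_combination_eq (U : MvPolynomial (Fin 3) ℝ) (s κ : ℝ) :
    ∃ q, C s * F U + C κ * G U =
      C (κ / 192) * Θ U + C ((s - κ * b₂ U / 12) / 16) * H U ^ 2 + U * q := by
  refine ⟨C (s - κ * b₂ U / 12) * (C (b₂ U / 8) * H U + C (b₂ U ^ 2 / 16) * U) +
    C (κ / 192) * (C (b₂ U ^ 3) * U - C (12 * b₂ U ^ 2) * Z U), ?_⟩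
  apply MvPolynomial.funext
  intro x
  simp [F, G, Z]
  ring

/-- A real point of the curve on `x_k = 0` is moved to `(0 : 0 : 1)`. The linear form then passes
through that point, as the normal-form lemmas require. -/
theorem not_dvd_linearJacobian {hU : U.IsHomogeneous 3}
    (hΦ : (GenusOneModel.cubic U hU).IsNonsingular) {s κ : ℝ} (hsκ : s ≠ 0 ∨ κ ≠ 0) (k : Fin 3) :
    ¬ U ∣ linearJacobian (Pi.single k 1) U (C s * F U + C κ * G U) := by
  intro h
  obtain ⟨p, hp, hpk, hpU⟩ := exists_zero_on_line hU k
  obtain ⟨M, ν, hM, hMp, b, c, d, hnf⟩ := exists_subst_eq_tangentForm hΦ hp hpU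
  have hns := isNonsingular_subst hM hΦ
  have hdvd : subst M U ∣ linearJacobian (Pi.single k 1 ᵥ* M) (subst M U)
      (subst M (C s * F U + C κ * G U)) := by
    rw [linearJacobian_subst]
    exact (map_dvd (subst M) h).mul_right _
  have hL : Pi.single k 1 ᵥ* M ≠ 0 := fun h0 => by
    have := congrFun (eq_zero_of_vecMul_eq_zero hM h0) k
    simp at this
  have hL2 : (Pi.single k 1 ᵥ* M) 2 = 0 := by
    rw [single_one_vecMul, row_apply, hMp, hpk, mul_zero]
  have hf := isHomogeneous_subst M _
    (((isHomogeneous_F hU).C_mul s).add ((isHomogeneous_G hU).C_mul κ))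
  obtain ⟨q, hq⟩ := exists_combination_eq U s κ
  -- `Θ` and `H²` scale by `det M ^ 6` and `det M ^ 4`, which keeps the pair of coefficients
  -- nonzero.
  have hfU : subst M (C s * F U + C κ * G U) = C (κ / 192 / M.det ^ 6) * Θ (subst M U) +
      C ((s - κ * b₂ U / 12) / 16 / M.det ^ 4) * H (subst M U) ^ 2 + subst M U * subst M q := by
    apply MvPolynomial.funext
    intro x
    rw [hq, Θ_subst, H_subst]
    simp only [eval_subst, map_add, map_mul, map_pow, eval_C]
    field_simp
  have hne : (s - κ * b₂ U / 12) / 16 / M.det ^ 4 ≠ 0 ∨ κ / 192 / M.det ^ 6 ≠ 0 := by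
    by_cases hκ : κ = 0
    · left
      have : s ≠ 0 := by simpa [hκ] using hsκ
      simp [hκ, this, hM]
    · right
      simp [hκ, hM]
  generalize subst M (C s * F U + C κ * G U) = f at *
  generalize subst M q = q' at *
  obtain hnf | ⟨a, hnf⟩ := hnf
  · have hns' : (GenusOneModel.cubic _ (isHomogeneous_tangentForm 1 0 b c d)).IsNonsingular := by
      simpa only [hnf] using hns
    rw [hnf] at hdvd hfU
    exact nonflex_not_dvd hns' hf hne hfU hL hL2 hdvd
  · have hns' : (GenusOneModel.cubic _ (isHomogeneous_tangentForm 0 a b c d)).IsNonsingular := by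
      simpa only [hnf] using hns
    rw [hnf] at hdvd hfU
    exact flex_not_dvd hns' hf hne hfU hL hL2 hdvd

/-- A `2 × 2` minor is, up to sign, the determinant with the gradient of the omitted coordinate
adjoined. -/
theorem not_dvd_jacobianDet {hU : U.IsHomogeneous 3}
    (hΦ : (GenusOneModel.cubic U hU).IsNonsingular) {s κ : ℝ} (hsκ : s ≠ 0 ∨ κ ≠ 0) {i j : Fin 3}
    (hij : i ≠ j) : ¬ U ∣ jacobianDet ![U, C s * F U + C κ * G U] ![i, j] := by
  intro h
  generalize hf : C s * F U + C κ * G U = f at h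
  have key : ∃ k, linearJacobian (Pi.single k 1) U f = jacobianDet ![U, f] ![i, j] ∨
      linearJacobian (Pi.single k 1) U f = -jacobianDet ![U, f] ![i, j] := by
    have hl : ∀ k, linearJacobian (Pi.single k 1) U f = C ((Pi.single k 1 : Fin 3 → ℝ) 0) *
        (pderiv 1 U * pderiv 2 f - pderiv 2 U * pderiv 1 f) - C ((Pi.single k 1 : Fin 3 → ℝ) 1) *
        (pderiv 0 U * pderiv 2 f - pderiv 2 U * pderiv 0 f) + C ((Pi.single k 1 : Fin 3 → ℝ) 2) *
        (pderiv 0 U * pderiv 1 f - pderiv 1 U * pderiv 0 f) := by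
      intro k
      simp only [linearJacobian, det_fin_three, of_apply, cons_val_zero, cons_val_one, cons_val]
      ring
    have hJ : jacobianDet ![U, f] ![i, j] =
        pderiv i U * pderiv j f - pderiv j U * pderiv i f := by
      simp [jacobianDet, det_fin_two]
    simp only [hl, hJ]
    fin_cases i <;> fin_cases j
    · exact absurd rfl hij
    · exact ⟨2, Or.inl (by simp)⟩
    · exact ⟨1, Or.inr (by simp)⟩
    · exact ⟨2, Or.inr (by simp)⟩
    · exact absurd rfl hij
    · exact ⟨0, Or.inl (by simp)⟩
    · exact ⟨1, Or.inl (by simp)⟩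
    · exact ⟨0, Or.inr (by simp)⟩
    · exact absurd rfl hij
  obtain ⟨k, hk | hk⟩ := key
  · exact not_dvd_linearJacobian hΦ hsκ k (by rwa [hf, hk])
  · exact not_dvd_linearJacobian hΦ hsκ k (by rwa [hf, hk, dvd_neg])

/-- If `f = Uq`, the product rule makes every minor of the Jacobian of `(U, f)` a multiple of `U`.
-/
theorem not_dvd_combination {hU : U.IsHomogeneous 3}
    (hΦ : (GenusOneModel.cubic U hU).IsNonsingular) {s κ : ℝ} (hsκ : s ≠ 0 ∨ κ ≠ 0) :
    ¬ U ∣ C s * F U + C κ * G U := by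
  rintro ⟨q, hq⟩
  refine not_dvd_jacobianDet hΦ hsκ (i := 0) (j := 1) (by decide) ?_
  refine ⟨pderiv 0 U * pderiv 1 q - pderiv 1 U * pderiv 0 q, ?_⟩
  rw [hq]
  simp [jacobianDet, det_fin_two]
  ring

theorem isHomogeneous_jacobianDet {f g : MvPolynomial (Fin 3) ℝ} {d e : ℕ} (hf : f.IsHomogeneous d)
    (hg : g.IsHomogeneous e) (i j : Fin 3) :
    (jacobianDet ![f, g] ![i, j]).IsHomogeneous (d - 1 + (e - 1)) := by
  have : jacobianDet ![f, g] ![i, j] = pderiv i f * pderiv j g - pderiv j f * pderiv i g := by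
    simp [jacobianDet, det_fin_two]
  rw [this]
  exact (hf.pderiv.mul hg.pderiv).sub (hf.pderiv.mul hg.pderiv)

/-- Each condition is the vanishing of a form not divisible by the irreducible cubic `U`; for `x_i ±
x_j` this is clear from the degree. -/
theorem finite_candidates (hU : U.IsHomogeneous 3)
    (hΦ : (GenusOneModel.cubic U hU).IsNonsingular) (r : ℝ) :
    ((GenusOneModel.cubic U hU).candidates r).Finite := by
  have hirr := irreducible hΦ
  have hfin : ∀ {g : MvPolynomial (Fin 3) ℝ} {e : ℕ}, g.IsHomogeneous e → ¬ U ∣ g →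
      {P : (GenusOneModel.cubic U hU).RealPoint | eval (GenusOneModel.coords _ P) g = 0}.Finite := by
    intro g e hg hUg
    refine Set.Finite.of_finite_image (f := Subtype.val)
      ((finite_setOf_common_zero hU hg hirr hUg).subset ?_) Subtype.val_injective.injOn
    rintro _ ⟨P, hP, rfl⟩
    exact ⟨P.2, hP⟩
  have hform : ∀ s κ : ℝ, (C s * F U + C κ * G U).IsHomogeneous 6 := fun s κ =>
    ((isHomogeneous_F hU).C_mul s).add ((isHomogeneous_G hU).C_mul κ)
  have hlin : ∀ (i j : Fin 3) (c : ℝ), i ≠ j → ¬ U ∣ X i + C c * X j := by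
    intro i j c hij h
    have hne : (X i + C c * X j : MvPolynomial (Fin 3) ℝ) ≠ 0 := by
      intro h0
      have := congrArg (eval (Pi.single i 1)) h0
      simp [hij.symm] at this
    have := totalDegree_le_of_dvd_of_isDomain h hne
    rw [hU.totalDegree (ne_zero_of_isNonsingular hΦ),
      ((isHomogeneous_X _ _).add (isHomogeneous_C_mul_X _ _)).totalDegree hne] at this
    omega
  have hfinlin := fun (i j : Fin 3) (c : ℝ) (hij : i ≠ j) =>
    hfin ((isHomogeneous_X _ i).add (isHomogeneous_C_mul_X c j)) (hlin i j c hij)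
  have hcrit : ∀ {s κ : ℝ}, s ≠ 0 ∨ κ ≠ 0 → {P : (GenusOneModel.cubic U hU).RealPoint |
      GenusOneModel.IsCritical (GenusOneModel.cubic U hU) (C s * F U + C κ * G U)
        (GenusOneModel.coords _ P)}.Finite := by
    intro s κ hsκ
    refine (Set.finite_iUnion fun i : Fin 3 => Set.finite_iUnion fun j : Fin 3 =>
      show {P : (GenusOneModel.cubic U hU).RealPoint | i ≠ j ∧ eval (GenusOneModel.coords _ P)
        (jacobianDet ![U, C s * F U + C κ * G U] ![i, j]) = 0}.Finite from ?_).subset ?_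
    · by_cases hij : i = j
      · simp [hij]
      · exact (hfin (isHomogeneous_jacobianDet hU (hform s κ) i j)
          (not_dvd_jacobianDet hΦ hsκ hij)).subset fun P hP => hP.2
    · rintro P ⟨i, j, hij, h⟩
      exact Set.mem_iUnion₂.2 ⟨i, j, hij, h⟩
  have hF : F U = C 1 * F U + C 0 * G U := by simp
  have hS : (GenusOneModel.cubic U hU).shifted r = C r * F U + C 1 * G U := by
    simp [GenusOneModel.shifted, GenusOneModel.F, GenusOneModel.G]
  refine Set.Finite.subset ((Set.finite_iUnion fun i : Fin 3 => Set.finite_iUnion fun j : Fin 3 =>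
    Set.Finite.union (s := {p | i ≠ j ∧ eval (GenusOneModel.coords _ p) (X i + C (-1) * X j) = 0})
      (t := {p | i ≠ j ∧ eval (GenusOneModel.coords _ p) (X i + C 1 * X j) = 0}) ?_ ?_).union
    (((hfin (hform (1 - r) (-1)) (not_dvd_combination hΦ (by simp))).union
    (hfin (hform (1 + r) 1) (not_dvd_combination hΦ (by simp)))).union
    ((hcrit (s := 1) (κ := 0) (by simp)).union (hcrit (s := r) (κ := 1) (by simp))))) ?_
  · by_cases hij : i = j
    · simp [hij]
    · exact (hfinlin i j (-1) hij).subset fun P hP => hP.2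
  · by_cases hij : i = j
    · simp [hij]
    · exact (hfinlin i j 1 hij).subset fun P hP => hP.2
  · rintro p (⟨i, j, hij, h | h⟩ | (h | h) | ⟨h, -⟩ | h | h)
    · refine Or.inl (Set.mem_iUnion₂.2 ⟨i, j, Or.inl ⟨hij, ?_⟩⟩)
      simp [h]
    · refine Or.inl (Set.mem_iUnion₂.2 ⟨i, j, Or.inr ⟨hij, ?_⟩⟩)
      simp [h]
    · refine Or.inr (Or.inl (Or.inl ?_))
      simp [GenusOneModel.F, GenusOneModel.G, GenusOneModel.shifted] at h ⊢
      linear_combination h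
    · refine Or.inr (Or.inl (Or.inr ?_))
      simp [GenusOneModel.F, GenusOneModel.G, GenusOneModel.shifted] at h ⊢
      linear_combination h
    · simp at h
    · refine Or.inr (Or.inr (Or.inl ?_))
      rw [← hF]; exact h
    · refine Or.inr (Or.inr (Or.inr ?_))
      rw [hS] at h; exact h

end TernaryCubic

theorem mainTheorem11 {n : ℕ} (Φ : GenusOneModel n) (hΦ : Φ.IsNonsingular)
    (hne : Nonempty Φ.RealPoint) (r : ℝ) :
    (Φ.candidates r).Finite ∧
    BddAbove (Set.range (Φ.ratio r)) ∧
    IsGreatest (Φ.ratio r '' Φ.candidates r) (Φ.δ r) ∧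
    IsLeast (Φ.ratio r '' Φ.candidates r) (Φ.ε r) := by
  obtain ⟨⟨p, hp, hmax⟩, ⟨q, hq, hmin⟩⟩ := GenusOneModel.exists_extremal_candidates Φ hne r
  have hbdd : BddAbove (Set.range (Φ.ratio r)) := ⟨Φ.ratio r p, by rintro _ ⟨x, rfl⟩; exact hmax x⟩
  have hbdd' : BddBelow (Set.range (Φ.ratio r)) := ⟨Φ.ratio r q, by rintro _ ⟨x, rfl⟩; exact hmin x⟩
  have hδ : Φ.δ r = Φ.ratio r p := le_antisymm (ciSup_le hmax) (le_ciSup hbdd p)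
  have hε : Φ.ε r = Φ.ratio r q := le_antisymm (ciInf_le hbdd' q) (le_ciInf hmin)
  refine ⟨?_, hbdd, ⟨⟨p, hp, hδ.symm⟩, ?_⟩, ⟨⟨q, hq, hε.symm⟩, ?_⟩⟩
  · cases Φ with
    | quartic P Q hP hQ => exact BinaryQuartic.finite_candidates hP hQ hΦ r
    | cubic U hU => exact TernaryCubic.finite_candidates hU hΦ r
    | quadrics Q₁ Q₂ h₁ h₂ => exact QuadricIntersection.finite_candidates h₁ h₂ hΦ r
  · rintro _ ⟨x, -, rfl⟩
    rw [hδ]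
    exact hmax x
  · rintro _ ⟨x, -, rfl⟩
    rw [hε]
    exact hmin x
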